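/- **Superstructures and enlargements.** For an infinite set $S$ of base elements (elements of $S$ are not regarded as sets), let $S_0=S$, $S_{n+1}=S_n\cup\mathcal P(S_n)$ and $\hat S=\bigcup_n S_n$. Let $*\colon\hat S\to\hat W$, with $W={}^*S$ and ${}^*s=s$ for $s\in S\subseteq W$, be an enlargement: a bounded (quantifiers of the form $\forall x\in t$) first-order sentence with parameters in $\hat S$ holds in $\hat S$ if and only if the sentence with the parameters $a$ replaced by ${}^*a$ holds in $\hat W$ (transfer principle), and every non-empty family, of cardinality at most that of $\hat S$, of internal sets (elements of sets ${}^*M$ with $M\in\hat S$) with the finite intersection property has a common element (saturation). For $M\in\hat S$ a set, $*$ gives a map $M\to{}^*M$; maps and relations between sets in $\hat S$ have enlargements between the enlarged sets. **Categories.** A category $\mathcal C$ is $\hat S$-small if its set of morphisms is (in bijection with) a set in $\hat S$; objects are identified with their identity morphisms. Then ${}^*\mathcal C$ is the category whose objects and morphisms are the elements of ${}^*\mathrm{Ob}(\mathcal C)$ and ${}^*\mathrm{Mor}(\mathcal C)$, with source, target and composition the enlargements of those of $\mathcal C$; a functor $F\colon\mathcal C\to\mathcal D$ has an enlargement ${}^*F\colon{}^*\mathcal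 C\to{}^*\mathcal D$. If $\mathcal A$ is an $\hat S$-small abelian category, then ${}^*\mathcal A$ is abelian, and the category $\mathrm{Kom}(\mathcal A)$ of cochain complexes indexed by $\mathbb Z$ and the derived category $D(\mathcal A)$, its localization $Q\colon\mathrm{Kom}(\mathcal A)\to D(\mathcal A)$ at the quasi-isomorphisms, are (up to bijection of their sets of morphisms with sets in $\hat S$) $\hat S$-small. So there are the categories ${}^*\mathrm{Kom}(\mathcal A)$ of $*$-complexes (indexed by ${}^*\mathbb Z$) and ${}^*D(\mathcal A)$, the functor ${}^*Q\colon{}^*\mathrm{Kom}(\mathcal A)\to{}^*D(\mathcal A)$, and, for $j\in{}^*\mathbb Z$, the cohomology ${}^*h^j(X)\in{}^*\mathcal A$ of an object $X$ of ${}^*D(\mathcal A)$. The category ${}^*D(\mathcal A)$ has the translation functor ${}^*\Sigma$ and the class ${}^*\Delta$ of distinguished triangles, which are the enlargements of the translation functor $\Sigma$ and of the set $\Delta$ of distinguished triangles of $D(\mathcal A)$. Restricting a $*$-complex from ${}^*\mathbb Z$ to $\mathbb Z\subseteq{}^*\mathbb Z$ gives a functor $\rho\colon{}^*\mathrm{Kom}(\mathcal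 A)\to\mathrm{Kom}({}^*\mathcal A)$. **Statement.** Let $\mathcal A$ be an $\hat S$-small abelian category. There is a functor $$\mathrm{res}_{\mathcal A}\colon{}^*D(\mathcal A)\to D({}^*\mathcal A),$$ unique up to isomorphism, such that $\mathrm{res}_{\mathcal A}\circ{}^*Q\cong Q\circ\rho$. Let $D^b({}^*\mathcal A)\subseteq D({}^*\mathcal A)$ be the full triangulated subcategory of the objects $X$ for which there is an $i\in\mathbb N$ with $h^j(X)\cong0$ for all $j\in\mathbb Z$ with $|j|>i$. Let ${}^*D^{fb}(\mathcal A)\subseteq{}^*D(\mathcal A)$ be the full (external) subcategory of the objects $X$ for which there is a standard $i\in\mathbb N$ with $$\forall j\in{}^*\mathbb Z:\ |j|>i\ \Rightarrow\ {}^*h^j(X)\cong0\ \text{ in }{}^*\mathcal A .$$ 1. ${}^*D^{fb}(\mathcal A)$ is a triangulated subcategory of ${}^*D(\mathcal A)$: it contains a zero object, is closed under isomorphisms, $X$ lies in it if and only if ${}^*\Sigma X$ does, and if two of the three objects of a triangle in ${}^*\Delta$ lie in it, so does the third. 2. The functor $\mathrm{res}_{\mathcal A}$ maps ${}^*D^{fb}(\mathcal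 A)$ to $D^b({}^*\mathcal A)$. 3. There is a fully faithful functor $\Phi\colon D^b({}^*\mathcal A)\to{}^*D(\mathcal A)$ whose essential image is ${}^*D^{fb}(\mathcal A)$. It is triangulated: there is an isomorphism $\Phi\circ\Sigma\cong{}^*\Sigma\circ\Phi$ for which a triangle of $D^b({}^*\mathcal A)$ is distinguished if and only if its image under $\Phi$ lies in ${}^*\Delta$. 4. The functors $\Phi\colon D^b({}^*\mathcal A)\to{}^*D^{fb}(\mathcal A)$ and $\mathrm{res}_{\mathcal A}\colon{}^*D^{fb}(\mathcal A)\to D^b({}^*\mathcal A)$ are mutually quasi-inverse: both composites are isomorphic to the identity functors. (So $\Phi$ is canonical, i.e. determined by $\mathrm{res}_{\mathcal A}$ up to isomorphism.) -/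

import Mathlib

open CategoryTheory Limits

universe u v w v' w'

namespace Enlarging

/-! ### Superstructures -/

/-- The levels `S₀ = S` and `S_{n+1} = S ∪ 𝒫(S_n)` of the superstructure over the base set `S`
(as the levels are cumulative, this is `S_n ∪ 𝒫(S_n)`); elements of `S` are no sets. -/
def Lev (S : Type u) : ℕ → Type u
  | 0 => S
  | n + 1 => S ⊕ Set (Lev S n)

namespace Lev

variable {S : Type u}

/-- A base element in `S_n`. -/
def atom : (n : ℕ) → S → Lev S n
  | 0, s => s
  | _ + 1, s => Sum.inl s

/-- A subset of `S_n` as an element of `S_{n+1}`. -/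
def set {n : ℕ} (a : Set (Lev S n)) : Lev S (n + 1) := Sum.inr a

lemma set_injective {n : ℕ} : Function.Injective (set (S := S) (n := n)) := Sum.inr_injective

lemma atom_ne_set {n : ℕ} (s : S) (a : Set (Lev S n)) : atom (n + 1) s ≠ set a := Sum.inl_ne_inr

lemma zero_cases (x : Lev S 0) : ∃ s, x = atom 0 s := ⟨x, rfl⟩

lemma succ_cases {n : ℕ} (x : Lev S (n + 1)) : (∃ s, x = atom (n + 1) s) ∨ ∃ a, x = set a := by
  rcases x with s | a
  · exact Or.inl ⟨s, rfl⟩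
  · exact Or.inr ⟨a, rfl⟩

/-- The inclusion `S_n ⊆ S_{n+1}`. -/
def incl : (n : ℕ) → Lev S n → Lev S (n + 1)
  | 0, s => Sum.inl s
  | n + 1, x => Sum.map id (fun a => incl n '' a) x

lemma incl_atom (n : ℕ) (s : S) : incl n (atom n s) = atom (n + 1) s := by
  cases n <;> rfl

lemma incl_set {n : ℕ} (a : Set (Lev S n)) : incl (n + 1) (set a) = set (incl n '' a) := rfl

lemma incl_injective : ∀ n : ℕ, Function.Injective (incl (S := S) n)
  | 0 => Sum.inl_injective
  | n + 1 => Sum.map_injective.2 ⟨Function.injective_id, (incl_injective n).image_injective⟩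

/-- The inclusion `S_n ⊆ S_m` for `n ≤ m`. -/
def lift {n m : ℕ} (h : n ≤ m) (x : Lev S n) : Lev S m :=
  Nat.leRec (motive := fun m _ => Lev S m) x (fun m _ y => incl m y) h

@[simp] lemma lift_self {n : ℕ} (h : n ≤ n) (x : Lev S n) : lift h x = x := by
  simp [lift]

lemma lift_succ {n m : ℕ} (h : n ≤ m) (x : Lev S n) :
    lift (h.trans (Nat.le_succ m)) x = incl m (lift h x) := by
  simp only [lift]
  rw [Nat.leRec_succ]

lemma lift_lift {n m k : ℕ} (h : n ≤ m) (h' : m ≤ k) (x : Lev S n) :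
    lift h' (lift h x) = lift (h.trans h') x := by
  induction k, h' using Nat.le_induction with
  | base => simp
  | succ k hk ih => rw [lift_succ hk, ih, ← lift_succ]

lemma lift_injective {n m : ℕ} (h : n ≤ m) : Function.Injective (lift (S := S) h) := by
  induction m, h using Nat.le_induction with
  | base => intro x y; simp
  | succ k hk ih =>
    intro x y hxy
    rw [lift_succ hk, lift_succ hk] at hxy
    exact ih (incl_injective _ hxy)

lemma lift_set {n m : ℕ} (h : n ≤ m) (a : Set (Lev S n)) :
    lift (Nat.succ_le_succ h) (set a) = set (lift h '' a) := by
  induction m, h using Nat.le_induction with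
  | base =>
    rw [lift_self]
    congr 1
    ext y
    simp
  | succ k hk ih =>
    rw [lift_succ (Nat.succ_le_succ hk), ih, incl_set, Set.image_image]
    simp only [lift_succ hk]

lemma lift_atom {m : ℕ} (s : S) : lift (Nat.zero_le m) (atom 0 s) = atom m s := by
  induction m with
  | zero => simp
  | succ k ih => rw [lift_succ (Nat.zero_le _), ih, incl_atom]

end Lev

/-- Two elements of levels are identified if they agree in a common higher level. -/
def levSetoid (S : Type u) : Setoid (Σ n, Lev S n) where
  r x y := ∃ (k : ℕ) (hx : x.1 ≤ k) (hy : y.1 ≤ k), Lev.lift hx x.2 = Lev.lift hy y.2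
  iseqv :=
    { refl := fun x => ⟨x.1, le_rfl, le_rfl, rfl⟩
      symm := fun ⟨k, hx, hy, h⟩ => ⟨k, hy, hx, h.symm⟩
      trans := by
        rintro x y z ⟨k, hx, hy, h⟩ ⟨l, hy', hz, h'⟩
        refine ⟨max k l, hx.trans (le_max_left _ _), hz.trans (le_max_right _ _), ?_⟩
        rw [← Lev.lift_lift hx (le_max_left _ _), h, Lev.lift_lift,
          ← Lev.lift_lift hz (le_max_right _ _), ← h', Lev.lift_lift] }

/-- The superstructure `Ŝ = ⋃ₙ Sₙ` over the base set `S`. -/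
def Hat (S : Type u) : Type u := Quotient (levSetoid S)

namespace Hat

variable {S : Type u}

/-- The inclusion of `S_n` into the superstructure. -/
def ι (n : ℕ) (x : Lev S n) : Hat S := Quotient.mk (levSetoid S) ⟨n, x⟩

lemma ι_eq_iff {n m : ℕ} (x : Lev S n) (y : Lev S m) :
    ι n x = ι m y ↔ ∃ (k : ℕ) (hx : n ≤ k) (hy : m ≤ k), Lev.lift hx x = Lev.lift hy y :=
  Quotient.eq (r := levSetoid S)

lemma ι_lift {n m : ℕ} (h : n ≤ m) (x : Lev S n) : ι m (Lev.lift h x) = ι n x :=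
  (ι_eq_iff _ _).2 ⟨m, le_rfl, h, by simp⟩

lemma ι_injective (n : ℕ) : Function.Injective (ι (S := S) n) := by
  intro x y h
  obtain ⟨k, h1, h2, h⟩ := (ι_eq_iff _ _).1 h
  exact Lev.lift_injective h1 h

lemma exists_ι (x : Hat S) : ∃ (n : ℕ) (a : Lev S n), x = ι n a := by
  obtain ⟨⟨n, a⟩, rfl⟩ := Quotient.exists_rep x
  exact ⟨n, a, rfl⟩

/-- A base element. -/
def atom (s : S) : Hat S := ι 0 (Lev.atom 0 s)

/-- The elements of the superstructure that are sets, i.e. that are not base elements. -/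
def IsSet (x : Hat S) : Prop := ∃ (n : ℕ) (a : Set (Lev S n)), x = ι (n + 1) (Lev.set a)

instance : Membership (Hat S) (Hat S) where
  mem y x := ∃ (n : ℕ) (b : Lev S n) (a : Set (Lev S n)),
    x = ι n b ∧ y = ι (n + 1) (Lev.set a) ∧ b ∈ a

lemma mem_def (x y : Hat S) : x ∈ y ↔ ∃ (n : ℕ) (b : Lev S n) (a : Set (Lev S n)),
    x = ι n b ∧ y = ι (n + 1) (Lev.set a) ∧ b ∈ a := Iff.rfl

lemma mem_ι_set {n : ℕ} (a : Set (Lev S n)) (x : Hat S) :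
    x ∈ ι (n + 1) (Lev.set a) ↔ ∃ b ∈ a, x = ι n b := by
  constructor
  · rintro ⟨m, c, d, rfl, h, hc⟩
    obtain ⟨k, hn, hm, h⟩ := (ι_eq_iff _ _).1 h
    obtain ⟨k, rfl⟩ : ∃ k', k = k' + 1 := ⟨k - 1, by omega⟩
    have hn' : n ≤ k := by omega
    have hm' : m ≤ k := by omega
    rw [Lev.lift_set hn', Lev.lift_set hm'] at h
    have h' := Lev.set_injective h
    obtain ⟨b, hb, hbc⟩ : Lev.lift hm' c ∈ Lev.lift hn' '' a := h' ▸ ⟨c, hc, rfl⟩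
    refine ⟨b, hb, ?_⟩
    rw [← ι_lift hm', ← hbc, ι_lift]
  · rintro ⟨b, hb, rfl⟩
    exact ⟨n, b, a, rfl, rfl, hb⟩

lemma isSet_of_mem {x y : Hat S} (h : x ∈ y) : y.IsSet := by
  obtain ⟨n, b, a, -, rfl, -⟩ := h
  exact ⟨n, a, rfl⟩

lemma ext {x y : Hat S} (hx : x.IsSet) (hy : y.IsSet) (h : ∀ z, z ∈ x ↔ z ∈ y) : x = y := by
  obtain ⟨n, a, rfl⟩ := hx
  obtain ⟨m, b, rfl⟩ := hy
  rw [ι_eq_iff]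
  refine ⟨max n m + 1, by omega, by omega, ?_⟩
  rw [Lev.lift_set (le_max_left n m), Lev.lift_set (le_max_right n m)]
  congr 1
  ext c
  constructor
  · rintro ⟨d, hd, rfl⟩
    obtain ⟨e, he, h⟩ := (mem_ι_set _ _).1 ((h (ι n d)).1 ((mem_ι_set _ _).2 ⟨d, hd, rfl⟩))
    refine ⟨e, he, ι_injective _ ?_⟩
    rw [ι_lift, ι_lift, h]
  · rintro ⟨d, hd, rfl⟩
    obtain ⟨e, he, h⟩ := (mem_ι_set _ _).1 ((h (ι m d)).2 ((mem_ι_set _ _).2 ⟨d, hd, rfl⟩))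
    refine ⟨e, he, ι_injective _ ?_⟩
    rw [ι_lift, ι_lift, h]

/-- `x` lies in `S_n`. -/
def InLev (n : ℕ) (x : Hat S) : Prop := ∃ a : Lev S n, x = ι n a

lemma InLev.mono {n m : ℕ} (h : n ≤ m) {x : Hat S} (hx : x.InLev n) : x.InLev m := by
  obtain ⟨a, rfl⟩ := hx
  exact ⟨Lev.lift h a, (ι_lift h a).symm⟩

lemma exists_inLev (x : Hat S) : ∃ n, x.InLev n := exists_ι x

lemma not_isSet_atom (s : S) : ¬ (atom s).IsSet := by
  rintro ⟨n, a, h⟩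
  obtain ⟨k, hn, hm, h⟩ := (ι_eq_iff _ _).1 h
  obtain ⟨k, rfl⟩ : ∃ k', k = k' + 1 := ⟨k - 1, by omega⟩
  rw [Lev.lift_atom, Lev.lift_set (by omega : n ≤ k)] at h
  exact Lev.atom_ne_set _ _ h

lemma InLev.of_mem {n : ℕ} {x y : Hat S} (hy : y.InLev (n + 1)) (h : x ∈ y) : x.InLev n := by
  obtain ⟨c, rfl⟩ := hy
  obtain ⟨a, rfl⟩ | ⟨a, rfl⟩ := Lev.succ_cases c
  · exfalso
    refine not_isSet_atom a (isSet_of_mem (x := x) ?_)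
    rwa [atom, ← ι_lift (Nat.zero_le (n + 1)), Lev.lift_atom]
  · obtain ⟨b, -, rfl⟩ := (mem_ι_set _ _).1 h
    exact ⟨b, rfl⟩

lemma not_mem_of_inLev_zero {x y : Hat S} (hy : y.InLev 0) : x ∉ y := by
  obtain ⟨a, rfl⟩ := hy
  obtain ⟨s, hs⟩ := Lev.zero_cases a
  exact fun h => not_isSet_atom s (isSet_of_mem (hs ▸ h))

lemma not_mem_mem (x y : Hat S) (h : x ∈ y) (h' : y ∈ x) : False := by
  have key : ∀ n : ℕ, ∀ x y : Hat S, x ∈ y → y ∈ x → ¬ y.InLev n := by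
    intro n
    induction n with
    | zero => exact fun x y h _ hy => not_mem_of_inLev_zero hy h
    | succ n ih => exact fun x y h h' hy => ih y x h' h (hy.of_mem h)
  obtain ⟨n, hn⟩ := exists_inLev y
  exact key n x y h h' hn

/-- The set of the superstructure with the same elements as the set `A` of elements of `S_n`. -/
def ofSet (n : ℕ) (A : Set (Hat S)) : Hat S := ι (n + 1) (Lev.set {a : Lev S n | ι n a ∈ A})

lemma isSet_ofSet (n : ℕ) (A : Set (Hat S)) : (ofSet n A).IsSet := ⟨n, _, rfl⟩

lemma mem_ofSet {n : ℕ} {A : Set (Hat S)} (h : ∀ x ∈ A, x.InLev n) (x : Hat S) :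
    x ∈ ofSet n A ↔ x ∈ A := by
  rw [ofSet, mem_ι_set]
  constructor
  · rintro ⟨b, hb, rfl⟩; exact hb
  · intro hx
    obtain ⟨a, rfl⟩ := h x hx
    exact ⟨a, hx, rfl⟩

/-- A set of elements of the superstructure is contained in a level. -/
def IsBounded (A : Set (Hat S)) : Prop := ∃ n : ℕ, ∀ x ∈ A, x.InLev n

lemma exists_set {A : Set (Hat S)} (h : IsBounded A) :
    ∃ x : Hat S, x.IsSet ∧ ∀ y, y ∈ x ↔ y ∈ A := by
  obtain ⟨n, hn⟩ := h
  exact ⟨ofSet n A, isSet_ofSet _ _, mem_ofSet hn⟩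

/-- The element of the superstructure with elements `A`, for `A` contained in a level. -/
noncomputable def mkSet (A : Set (Hat S)) (h : IsBounded A) : Hat S := (exists_set h).choose

lemma isSet_mkSet (A : Set (Hat S)) (h : IsBounded A) : (mkSet A h).IsSet :=
  (exists_set h).choose_spec.1

@[simp] lemma mem_mkSet (A : Set (Hat S)) (h : IsBounded A) (y : Hat S) :
    y ∈ mkSet A h ↔ y ∈ A := (exists_set h).choose_spec.2 y

lemma isBounded_mem (x : Hat S) : IsBounded {y | y ∈ x} := by
  obtain ⟨n, hn⟩ := exists_inLev x
  exact ⟨n, fun y hy => (hn.mono (Nat.le_succ n)).of_mem hy⟩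

lemma IsBounded.subset {A B : Set (Hat S)} (hB : IsBounded B) (h : A ⊆ B) : IsBounded A := by
  obtain ⟨n, hn⟩ := hB
  exact ⟨n, fun y hy => hn y (h hy)⟩

lemma isBounded_pair (x y : Hat S) : IsBounded {x, y} := by
  obtain ⟨n, hn⟩ := exists_inLev x
  obtain ⟨m, hm⟩ := exists_inLev y
  refine ⟨max n m, ?_⟩
  rintro z (rfl | rfl)
  · exact hn.mono (le_max_left _ _)
  · exact hm.mono (le_max_right _ _)

/-- The set `{x, y}`. -/
noncomputable def upair (x y : Hat S) : Hat S := mkSet {x, y} (isBounded_pair x y)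

@[simp] lemma mem_upair (x y z : Hat S) : z ∈ upair x y ↔ z = x ∨ z = y := by simp [upair]

/-- The ordered pair `⟨a, b⟩ = {a, {a, b}}`. -/
noncomputable def pair (a b : Hat S) : Hat S := upair a (upair a b)

lemma upair_right_inj {a b d : Hat S} (h : upair a b = upair a d) : b = d := by
  have h1 : b ∈ upair a d := h ▸ (mem_upair _ _ _).2 (Or.inr rfl)
  have h2 : d ∈ upair a b := h ▸ (mem_upair _ _ _).2 (Or.inr rfl)
  rw [mem_upair] at h1 h2
  rcases h1 with h1 | h1
  · rcases h2 with h2 | h2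
    · rw [h1, h2]
    · exact h2.symm
  · exact h1

lemma pair_inj {a b c d : Hat S} : pair a b = pair c d ↔ a = c ∧ b = d := by
  constructor
  · intro h
    have hac : a = c := by
      have h1 : a ∈ pair c d := h ▸ (mem_upair _ _ _).2 (Or.inl rfl)
      have h2 : c ∈ pair a b := h ▸ (mem_upair _ _ _).2 (Or.inl rfl)
      rw [pair, mem_upair] at h1 h2
      rcases h1 with h1 | h1
      · exact h1
      · rcases h2 with h2 | h2
        · exact h2.symm
        · exfalso
          refine not_mem_mem a c ?_ ?_
          · rw [h2]; simp
          · rw [h1]; simp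
    subst hac
    exact ⟨rfl, upair_right_inj (upair_right_inj h)⟩
  · rintro ⟨rfl, rfl⟩; rfl

lemma InLev.upair {n : ℕ} {a b : Hat S} (ha : a.InLev n) (hb : b.InLev n) :
    (upair a b).InLev (n + 1) := by
  have : Hat.upair a b = ofSet n {a, b} := by
    refine ext (isSet_mkSet _ _) (isSet_ofSet _ _) fun z => ?_
    rw [mem_ofSet]
    · simp
    · rintro z (rfl | rfl) <;> assumption
  rw [this]
  exact ⟨_, rfl⟩

lemma InLev.pair {n : ℕ} {a b : Hat S} (ha : a.InLev n) (hb : b.InLev n) :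
    (pair a b).InLev (n + 2) :=
  (ha.mono (Nat.le_succ n)).upair (ha.upair hb)

open Classical in
/-- The value `f ∠ x`: it is `y` if `y` is the only element with `⟨x, y⟩ ∈ f`, and `∅` if there
is no such `y`. -/
noncomputable def app (f x : Hat S) : Hat S :=
  if h : ∃! y, pair x y ∈ f then h.choose else ofSet 0 ∅

variable (S) in
/-- The base set `S` as an element of the superstructure. -/
def base : Hat S := ofSet 0 (Set.range atom)

end Hat

/-! ### Formulas in a superstructure and enlargements -/

/-- Terms with constants in `U` and free variables indexed by `Fin n`. -/
inductive Term (U : Type u) (n : ℕ) : Type u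
  | const (x : U) : Term U n
  | var (i : Fin n) : Term U n
  | pair (s t : Term U n) : Term U n
  | app (s t : Term U n) : Term U n

/-- Bounded formulas with constants in `U` and free variables indexed by `Fin n`;
in `all t φ`, standing for `(∀ x ∈ t) φ`, the bound variable `x` is number `0` of `φ`, and the
variables of `t` are numbered from `1` on in `φ`. -/
inductive Formula (U : Type u) : ℕ → Type u
  | eq {n : ℕ} (s t : Term U n) : Formula U n
  | mem {n : ℕ} (s t : Term U n) : Formula U n
  | not {n : ℕ} (φ : Formula U n) : Formula U n
  | and {n : ℕ} (φ ψ : Formula U n) : Formula U n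
  | all {n : ℕ} (t : Term U n) (φ : Formula U (n + 1)) : Formula U n

namespace Term

/-- Replace the constants of a term. -/
@[simp] def map {U : Type u} {U' : Type v} (f : U → U') {n : ℕ} : Term U n → Term U' n
  | const x => const (f x)
  | var i => var i
  | pair s t => pair (s.map f) (t.map f)
  | app s t => app (s.map f) (t.map f)

/-- The value of a term. -/
@[simp] noncomputable def eval {S : Type u} {n : ℕ} (v : Fin n → Hat S) : Term (Hat S) n → Hat S
  | const x => x
  | var i => v i
  | pair s t => Hat.pair (s.eval v) (t.eval v)
  | app s t => Hat.app (s.eval v) (t.eval v)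

end Term

namespace Formula

/-- Replace the constants of a formula. -/
@[simp] def map {U : Type u} {U' : Type v} (f : U → U') : {n : ℕ} → Formula U n → Formula U' n
  | _, eq s t => eq (s.map f) (t.map f)
  | _, mem s t => mem (s.map f) (t.map f)
  | _, not φ => not (φ.map f)
  | _, and φ ψ => and (φ.map f) (ψ.map f)
  | _, all t φ => all (t.map f) (φ.map f)

/-- Truth of a formula. -/
@[simp] def Realize {S : Type u} : {n : ℕ} → Formula (Hat S) n → (Fin n → Hat S) → Prop
  | _, eq s t, v => s.eval v = t.eval v
  | _, mem s t, v => s.eval v ∈ t.eval v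
  | _, not φ, v => ¬ φ.Realize v
  | _, and φ ψ, v => φ.Realize v ∧ ψ.Realize v
  | _, all t φ, v => ∀ x, x ∈ t.eval v → φ.Realize (Matrix.vecCons x v)

end Formula

/-- An enlargement `* : Ŝ → Ŵ`, where `W = *S`. -/
structure Enlargement (S W : Type u) where
  /-- the map `*` -/
  star : Hat S → Hat W
  /-- the inclusion of base sets `S ⊆ *S = W` -/
  incl : S → W
  star_base : star (Hat.base S) = Hat.base W
  star_atom (s : S) : star (Hat.atom s) = Hat.atom (incl s)
  transfer (φ : Formula (Hat S) 0) : φ.Realize ![] ↔ (φ.map star).Realize ![]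
  saturation (I : Type u) [Nonempty I] (hI : Cardinal.mk I ≤ Cardinal.mk (Hat S))
    (V : I → Hat W) (internal : ∀ i, ∃ A : Hat S, A.IsSet ∧ V i ∈ star A)
    (fip : ∀ J : Finset I, J.Nonempty → ∃ x, ∀ j ∈ J, x ∈ V j) :
    ∃ x, ∀ i, x ∈ V i

/-! ### Types that are elements of a superstructure, and their enlargements -/

/-- A type `X` is given as an element of `Ŝ`: a set `M ∈ Ŝ` with a bijection from `X` to the
elements of `M`. -/
class Coded (S : Type u) (X : Type v) where
  /-- the set `M` -/
  set : Hat S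
  isSet : set.IsSet
  /-- the bijection -/
  equiv : X ≃ {x : Hat S // x ∈ set}

namespace Coded

section

variable (S : Type u) {X : Type v} {Y : Type w} [Coded S X] [Coded S Y]

/-- The element of `Ŝ` that corresponds to `x : X`. -/
def code (x : X) : Hat S := (equiv x : {x : Hat S // x ∈ set X}).1

lemma code_mem (x : X) : code S x ∈ set (S := S) X := (equiv x).2

lemma code_injective : Function.Injective (code S (X := X)) :=
  Subtype.val_injective.comp (equiv (S := S) (X := X)).injective

lemma exists_code {y : Hat S} (hy : y ∈ set (S := S) X) : ∃ x : X, y = code S x :=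
  ⟨equiv.symm ⟨y, hy⟩, by simp [code]⟩

/-- The subset of `Ŝ` that corresponds to a predicate on `X`. -/
noncomputable def sub (P : X → Prop) : Hat S :=
  Hat.mkSet {y | ∃ x, P x ∧ y = code S x} ((Hat.isBounded_mem (set (S := S) X)).subset (by
    rintro y ⟨x, -, rfl⟩; exact code_mem S x))

@[simp] lemma mem_sub (P : X → Prop) (y : Hat S) : y ∈ sub S P ↔ ∃ x, P x ∧ y = code S x := by
  simp [sub]

lemma code_mem_sub (P : X → Prop) (x : X) : code S x ∈ sub S P ↔ P x := by
  simp [(code_injective S).eq_iff]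

/-- Code a type by an injection to the elements of a set in `Ŝ`. -/
@[reducible] noncomputable def ofInjective {Z : Type v'} (f : Z → Hat S) (hf : Function.Injective f)
    (h : Hat.IsBounded (Set.range f)) : Coded S Z where
  set := Hat.mkSet _ h
  isSet := Hat.isSet_mkSet _ h
  equiv := (Equiv.ofInjective f hf).trans (Equiv.subtypeEquivRight fun y => by simp)

lemma isBounded_prod : Hat.IsBounded
    (Set.range fun p : X × Y => Hat.pair (code S p.1) (code S p.2)) := by
  obtain ⟨n, hn⟩ := Hat.isBounded_mem (set (S := S) X)
  obtain ⟨m, hm⟩ := Hat.isBounded_mem (set (S := S) Y)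
  refine ⟨max n m + 2, ?_⟩
  rintro _ ⟨p, rfl⟩
  exact ((hn _ (code_mem S p.1)).mono (le_max_left _ _)).pair
    ((hm _ (code_mem S p.2)).mono (le_max_right _ _))

lemma pair_code_injective :
    Function.Injective fun p : X × Y => Hat.pair (code S p.1) (code S p.2) := by
  rintro ⟨x, y⟩ ⟨x', y'⟩ h
  obtain ⟨h1, h2⟩ := Hat.pair_inj.1 h
  exact Prod.ext (code_injective S h1) (code_injective S h2)

/-- The product of two sets, consisting of the ordered pairs. -/
noncomputable instance prod : Coded S (X × Y) := ofInjective S _ (pair_code_injective S)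
  (isBounded_prod S)

@[simp] lemma code_prod (p : X × Y) : code S p = Hat.pair (code S p.1) (code S p.2) := rfl

end

end Coded

section FormulaAbbreviations

variable {S : Type u} {n : ℕ}

/-- implication -/
def Formula.imp {U : Type u} (φ ψ : Formula U n) : Formula U n := .not (.and φ (.not ψ))

/-- bounded existence -/
def Formula.ex {U : Type u} (t : Term U n) (φ : Formula U (n + 1)) : Formula U n :=
  .not (.all t (.not φ))

/-- equivalence -/
def Formula.iff {U : Type u} (φ ψ : Formula U n) : Formula U n := .and (φ.imp ψ) (ψ.imp φ)

@[simp] lemma Formula.map_imp {U : Type u} {U' : Type v} (f : U → U') (φ ψ : Formula U n) :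
    (φ.imp ψ).map f = (φ.map f).imp (ψ.map f) := rfl

@[simp] lemma Formula.map_ex {U : Type u} {U' : Type v} (f : U → U') (t : Term U n)
    (φ : Formula U (n + 1)) : (Formula.ex t φ).map f = Formula.ex (t.map f) (φ.map f) := rfl

@[simp] lemma Formula.map_iff {U : Type u} {U' : Type v} (f : U → U') (φ ψ : Formula U n) :
    (φ.iff ψ).map f = (φ.map f).iff (ψ.map f) := rfl

@[simp] lemma Formula.realize_imp (φ ψ : Formula (Hat S) n) (x : Fin n → Hat S) :
    (φ.imp ψ).Realize x ↔ (φ.Realize x → ψ.Realize x) := by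
  simp [Formula.imp]

@[simp] lemma Formula.realize_ex (t : Term (Hat S) n) (φ : Formula (Hat S) (n + 1))
    (x : Fin n → Hat S) :
    (Formula.ex t φ).Realize x ↔ ∃ y, y ∈ t.eval x ∧ φ.Realize (Matrix.vecCons y x) := by
  simp [Formula.ex]

@[simp] lemma Formula.realize_iff (φ ψ : Formula (Hat S) n) (x : Fin n → Hat S) :
    (φ.iff ψ).Realize x ↔ (φ.Realize x ↔ ψ.Realize x) := by
  simp [Formula.iff, iff_def]

end FormulaAbbreviations

namespace Enlargement

open Coded

variable {S W : Type u} (E : Enlargement S W)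

section Basic

variable {X : Type v} {Y : Type w} {Z : Type v'} {G : Type w'}
  [Coded S X] [Coded S Y] [Coded S Z] [Coded S G]

lemma star_mem_star {x y : Hat S} : E.star x ∈ E.star y ↔ x ∈ y := by
  simpa using (E.transfer (.mem (.const x) (.const y))).symm

variable (X) in
/-- The enlargement `*X`: the elements of the set `*M`, for `M ∈ Ŝ` the set that `X` is. -/
def Star : Type u := {x : Hat W // x ∈ E.star (Coded.set (S := S) X)}

/-- The map `* : X → *X`. -/
def std (x : X) : E.Star X := ⟨E.star (code S x), E.star_mem_star.2 (code_mem S x)⟩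

/-- The enlargement of a subset of `X`. -/
def StarPred (P : X → Prop) (x : E.Star X) : Prop := x.1 ∈ E.star (sub S P)

lemma star_pair_mem (x : E.Star X) (y : E.Star Y) :
    Hat.pair x.1 y.1 ∈ E.star (Coded.set (S := S) (X × Y)) := by
  have h := (E.transfer (.all (.const (Coded.set X)) (.all (.const (Coded.set Y))
    (.mem (.pair (.var 1) (.var 0)) (.const (Coded.set (X × Y))))))).1 (by
      simp only [Formula.Realize, Term.eval, Matrix.cons_val]
      intro a ha b hb
      obtain ⟨a, rfl⟩ := exists_code S ha
      obtain ⟨b, rfl⟩ := exists_code S hb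
      exact code_mem S (a, b))
  simp only [Formula.map, Term.map, Formula.Realize, Term.eval, Matrix.cons_val] at h
  exact h _ x.2 _ y.2

/-- The pair of two elements, as an element of `*(X × Y) = *X × *Y`. -/
noncomputable def pair (x : E.Star X) (y : E.Star Y) : E.Star (X × Y) :=
  ⟨Hat.pair x.1 y.1, E.star_pair_mem x y⟩

lemma pair_inj {x x' : E.Star X} {y y' : E.Star Y} :
    E.pair x y = E.pair x' y' ↔ x = x' ∧ y = y' := by
  refine Subtype.ext_iff.trans (Hat.pair_inj.trans ?_)
  exact and_congr Subtype.ext_iff.symm Subtype.ext_iff.symm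

lemma pair_std (x : X) (y : Y) : E.pair (E.std x) (E.std y) = E.std (x, y) := by
  have h := (E.transfer (.eq (.pair (.const (code S x)) (.const (code S y)))
    (.const (code S (x, y))))).1 rfl
  exact Subtype.ext h

lemma exists_pair (p : E.Star (X × Y)) : ∃ (x : E.Star X) (y : E.Star Y), p = E.pair x y := by
  have h := (E.transfer (.all (.const (Coded.set (X × Y))) (.ex (.const (Coded.set X))
    (.ex (.const (Coded.set Y)) (.eq (.var 2) (.pair (.var 1) (.var 0))))))).1 (by
      simp only [Formula.Realize, Formula.realize_ex, Term.eval, Matrix.cons_val]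
      intro a ha
      obtain ⟨a, rfl⟩ := exists_code S ha
      exact ⟨_, code_mem S a.1, _, code_mem S a.2, rfl⟩)
  simp only [Formula.map, Formula.map_ex, Term.map, Formula.Realize, Formula.realize_ex, Term.eval,
    Matrix.cons_val] at h
  obtain ⟨x, hx, y, hy, h⟩ := h p.1 p.2
  exact ⟨⟨x, hx⟩, ⟨y, hy⟩, Subtype.ext h⟩

/-- The enlargement of a relation. -/
def StarRel (R : X → Y → Prop) (x : E.Star X) (y : E.Star Y) : Prop :=
  E.StarPred (fun p : X × Y => R p.1 p.2) (E.pair x y)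

/-- The transfer principle for universally quantified statements. -/
lemma starPred_forall' (P : X → Prop) : (∀ x, E.StarPred P x) ↔ ∀ x, P x := by
  have h := E.transfer (.all (.const (Coded.set X)) (.mem (.var 0) (.const (sub S P))))
  simp only [Formula.map, Term.map, Formula.Realize, Term.eval, Matrix.cons_val] at h
  constructor
  · intro h' x
    rw [← code_mem_sub S P]
    exact h.2 (fun y hy => h' ⟨y, hy⟩) _ (code_mem S x)
  · intro h' x
    refine h.1 (fun y hy => ?_) _ x.2
    obtain ⟨y, rfl⟩ := exists_code S hy
    exact (code_mem_sub S P y).2 (h' y)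

lemma transfer_forall {P : X → Prop} (h : ∀ x, P x) (x : E.Star X) : E.StarPred P x :=
  (E.starPred_forall' P).2 h x

lemma starPred_std (P : X → Prop) (x : X) : E.StarPred P (E.std x) ↔ P x :=
  E.star_mem_star.trans (code_mem_sub S P x)

@[simp] lemma starPred_not (P : X → Prop) (x : E.Star X) :
    E.StarPred (fun x => ¬ P x) x ↔ ¬ E.StarPred P x := by
  have h := (E.transfer (.all (.const (Coded.set X)) (.iff
    (.mem (.var 0) (.const (sub S fun x => ¬ P x))) (.not (.mem (.var 0) (.const (sub S P))))))).1
    (by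
      simp only [Formula.Realize, Formula.realize_iff, Term.eval, Matrix.cons_val]
      intro a ha
      obtain ⟨a, rfl⟩ := exists_code S ha
      rw [code_mem_sub, code_mem_sub])
  simp only [Formula.map, Formula.map_iff, Term.map, Formula.Realize, Formula.realize_iff,
    Term.eval, Matrix.cons_val] at h
  exact h x.1 x.2

@[simp] lemma starPred_and (P Q : X → Prop) (x : E.Star X) :
    E.StarPred (fun x => P x ∧ Q x) x ↔ E.StarPred P x ∧ E.StarPred Q x := by
  have h := (E.transfer (.all (.const (Coded.set X)) (.iff
    (.mem (.var 0) (.const (sub S fun x => P x ∧ Q x)))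
    (.and (.mem (.var 0) (.const (sub S P))) (.mem (.var 0) (.const (sub S Q))))))).1
    (by
      simp only [Formula.Realize, Formula.realize_iff, Term.eval, Matrix.cons_val]
      intro a ha
      obtain ⟨a, rfl⟩ := exists_code S ha
      simp only [code_mem_sub])
  simp only [Formula.map, Formula.map_iff, Term.map, Formula.Realize, Formula.realize_iff,
    Term.eval, Matrix.cons_val] at h
  exact h x.1 x.2

@[simp] lemma starPred_or (P Q : X → Prop) (x : E.Star X) :
    E.StarPred (fun x => P x ∨ Q x) x ↔ E.StarPred P x ∨ E.StarPred Q x := by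
  have : (fun x => P x ∨ Q x) = fun x => ¬ (¬ P x ∧ ¬ Q x) := by
    funext x; simp only [eq_iff_iff]; tauto
  rw [this]
  simp only [starPred_not, starPred_and]
  tauto

@[simp] lemma starPred_imp (P Q : X → Prop) (x : E.Star X) :
    E.StarPred (fun x => P x → Q x) x ↔ (E.StarPred P x → E.StarPred Q x) := by
  have : (fun x => P x → Q x) = fun x => ¬ (P x ∧ ¬ Q x) := by
    funext x; simp only [eq_iff_iff]; tauto
  rw [this]
  simp only [starPred_not, starPred_and]
  tauto

@[simp] lemma starPred_exists (P : X → Y → Prop) (x : E.Star X) :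
    E.StarPred (fun x => ∃ y, P x y) x ↔
      ∃ y : E.Star Y, E.StarPred (fun p : X × Y => P p.1 p.2) (E.pair x y) := by
  have h := (E.transfer (.all (.const (Coded.set X)) (.iff
    (.mem (.var 0) (.const (sub S fun x => ∃ y, P x y)))
    (.ex (.const (Coded.set Y)) (.mem (.pair (.var 1) (.var 0))
      (.const (sub S fun p : X × Y => P p.1 p.2))))))).1
    (by
      simp only [Formula.Realize, Formula.realize_iff, Formula.realize_ex, Term.eval,
        Matrix.cons_val]
      intro a ha
      obtain ⟨a, rfl⟩ := exists_code S ha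
      rw [code_mem_sub]
      constructor
      · rintro ⟨y, hy⟩
        exact ⟨_, code_mem S y, (code_mem_sub S (fun p : X × Y => P p.1 p.2) (a, y)).2 hy⟩
      · rintro ⟨y, hy, h⟩
        obtain ⟨y, rfl⟩ := exists_code S hy
        exact ⟨y, (code_mem_sub S (fun p : X × Y => P p.1 p.2) (a, y)).1 h⟩)
  simp only [Formula.map, Formula.map_iff, Formula.map_ex, Term.map, Formula.Realize,
    Formula.realize_iff, Formula.realize_ex, Term.eval, Matrix.cons_val] at h
  refine (h x.1 x.2).trans ⟨?_, ?_⟩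
  · rintro ⟨y, hy, h'⟩
    exact ⟨⟨y, hy⟩, h'⟩
  · rintro ⟨y, h'⟩
    exact ⟨y.1, y.2, h'⟩

@[simp] lemma starPred_forall (P : X → Y → Prop) (x : E.Star X) :
    E.StarPred (fun x => ∀ y, P x y) x ↔
      ∀ y : E.Star Y, E.StarPred (fun p : X × Y => P p.1 p.2) (E.pair x y) := by
  have : (fun x => ∀ y, P x y) = fun x => ¬ ∃ y, ¬ P x y := by
    funext x; simp
  rw [this, starPred_not, starPred_exists]
  simp only [starPred_not, not_exists, not_not]

lemma starPred_congr {P Q : X → Prop} (h : ∀ x, P x ↔ Q x) (x : E.Star X) :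
    E.StarPred P x ↔ E.StarPred Q x := by
  rw [show P = Q from funext fun x => propext (h x)]

lemma starRel_eq (x y : E.Star X) : E.StarRel (fun x y : X => x = y) x y ↔ x = y := by
  have h := (E.transfer (.all (.const (Coded.set X)) (.all (.const (Coded.set X)) (.iff
    (.mem (.pair (.var 1) (.var 0)) (.const (sub S fun p : X × X => p.1 = p.2)))
    (.eq (.var 1) (.var 0)))))).1
    (by
      simp only [Formula.Realize, Formula.realize_iff, Term.eval, Matrix.cons_val]
      intro a ha b hb
      obtain ⟨a, rfl⟩ := exists_code S ha
      obtain ⟨b, rfl⟩ := exists_code S hb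
      exact (code_mem_sub S (fun p : X × X => p.1 = p.2) (a, b)).trans
        (code_injective S).eq_iff.symm)
  simp only [Formula.map, Formula.map_iff, Term.map, Formula.Realize, Formula.realize_iff,
    Term.eval, Matrix.cons_val] at h
  exact (h x.1 x.2 y.1 y.2).trans Subtype.ext_iff.symm

lemma existsUnique_starRel (f : X → Y) (x : E.Star X) :
    ∃! y : E.Star Y, E.StarRel (fun x y => y = f x) x y := by
  have h := (E.transfer (.all (.const (Coded.set X)) (.ex (.const (Coded.set Y))
    (.and (.mem (.pair (.var 1) (.var 0)) (.const (sub S fun p : X × Y => p.2 = f p.1)))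
    (.all (.const (Coded.set Y)) (.imp
      (.mem (.pair (.var 2) (.var 0)) (.const (sub S fun p : X × Y => p.2 = f p.1)))
      (.eq (.var 0) (.var 1)))))))).1
    (by
      simp only [Formula.Realize, Formula.realize_imp, Formula.realize_ex, Term.eval,
        Matrix.cons_val]
      intro a ha
      obtain ⟨a, rfl⟩ := exists_code S ha
      refine ⟨_, code_mem S (f a), (code_mem_sub S (fun p : X × Y => p.2 = f p.1) (a, f a)).2 rfl,
        fun b hb h => ?_⟩
      obtain ⟨b, rfl⟩ := exists_code S hb
      exact congr_arg _ ((code_mem_sub S (fun p : X × Y => p.2 = f p.1) (a, b)).1 h))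
  simp only [Formula.map, Formula.map_imp, Formula.map_ex, Term.map, Formula.Realize,
    Formula.realize_imp, Formula.realize_ex, Term.eval, Matrix.cons_val] at h
  obtain ⟨y, hy, h1, h2⟩ := h x.1 x.2
  exact ⟨⟨y, hy⟩, h1, fun z hz => Subtype.ext (h2 z.1 z.2 hz)⟩

/-- The enlargement `*f : *X → *Y` of a map: its graph is the enlargement of the graph of `f`. -/
noncomputable def starFun (f : X → Y) (x : E.Star X) : E.Star Y :=
  (E.existsUnique_starRel f x).choose

lemma starRel_starFun (f : X → Y) (x : E.Star X) (y : E.Star Y) :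
    E.StarRel (fun x y => y = f x) x y ↔ y = E.starFun f x := by
  have h := (E.existsUnique_starRel f x).choose_spec
  exact ⟨fun h' => h.2 y h', fun h' => h' ▸ h.1⟩

/-- Compatibility of the enlargement of predicates with substitution. -/
lemma starPred_comp (P : Y → Prop) (f : X → Y) (x : E.Star X) :
    E.StarPred (fun x => P (f x)) x ↔ E.StarPred P (E.starFun f x) := by
  have h := (E.transfer (.all (.const (Coded.set X)) (.all (.const (Coded.set Y)) (.imp
    (.mem (.pair (.var 1) (.var 0)) (.const (sub S fun p : X × Y => p.2 = f p.1)))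
    (.iff (.mem (.var 1) (.const (sub S fun x => P (f x))))
      (.mem (.var 0) (.const (sub S P)))))))).1
    (by
      simp only [Formula.Realize, Formula.realize_imp, Formula.realize_iff, Term.eval,
        Matrix.cons_val]
      intro a ha b hb h
      obtain ⟨a, rfl⟩ := exists_code S ha
      obtain ⟨b, rfl⟩ := exists_code S hb
      obtain rfl : b = f a := (code_mem_sub S (fun p : X × Y => p.2 = f p.1) (a, b)).1 h
      rw [code_mem_sub, code_mem_sub])
  simp only [Formula.map, Formula.map_imp, Formula.map_iff, Term.map, Formula.Realize,
    Formula.realize_imp, Formula.realize_iff, Term.eval, Matrix.cons_val] at h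
  exact h x.1 x.2 _ (E.starFun f x).2 ((E.starRel_starFun f x _).2 rfl)

lemma starFun_id (x : E.Star X) : E.starFun (fun x : X => x) x = x := by
  refine ((E.starRel_starFun _ _ _).1 ?_).symm
  rw [show (fun x y : X => y = x) = fun x y => x = y by funext x y; simp [eq_comm]]
  exact (E.starRel_eq x x).2 rfl

lemma starFun_comp (g : Y → Z) (f : X → Y) (x : E.Star X) :
    E.starFun (fun x => g (f x)) x = E.starFun g (E.starFun f x) := by
  have h := (E.transfer (.all (.const (Coded.set X)) (.all (.const (Coded.set Y))
    (.all (.const (Coded.set Z)) (.imp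
    (.mem (.pair (.var 2) (.var 1)) (.const (sub S fun p : X × Y => p.2 = f p.1)))
    (.imp (.mem (.pair (.var 1) (.var 0)) (.const (sub S fun p : Y × Z => p.2 = g p.1)))
      (.mem (.pair (.var 2) (.var 0))
        (.const (sub S fun p : X × Z => p.2 = g (f p.1)))))))))).1
    (by
      simp only [Formula.Realize, Formula.realize_imp, Term.eval, Matrix.cons_val]
      intro a ha b hb c hc h h'
      obtain ⟨a, rfl⟩ := exists_code S ha
      obtain ⟨b, rfl⟩ := exists_code S hb
      obtain ⟨c, rfl⟩ := exists_code S hc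
      obtain rfl : b = f a := (code_mem_sub S (fun p : X × Y => p.2 = f p.1) (a, b)).1 h
      exact (code_mem_sub S (fun p : X × Z => p.2 = g (f p.1)) (a, c)).2
        ((code_mem_sub S (fun p : Y × Z => p.2 = g p.1) (f a, c)).1 h'))
  simp only [Formula.map, Formula.map_imp, Term.map, Formula.Realize,
    Formula.realize_imp, Term.eval, Matrix.cons_val] at h
  exact ((E.starRel_starFun (fun x => g (f x)) x _).1 (h x.1 x.2 _ (E.starFun f x).2 _
    (E.starFun g (E.starFun f x)).2 ((E.starRel_starFun f x _).2 rfl)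
    ((E.starRel_starFun g _ _).2 rfl))).symm

lemma starFun_fst (x : E.Star X) (y : E.Star Y) :
    E.starFun (fun p : X × Y => p.1) (E.pair x y) = x := by
  have h := (E.transfer (.all (.const (Coded.set X)) (.all (.const (Coded.set Y))
    (.mem (.pair (.pair (.var 1) (.var 0)) (.var 1))
      (.const (sub S fun p : (X × Y) × X => p.2 = p.1.1)))))).1
    (by
      simp only [Formula.Realize, Term.eval, Matrix.cons_val]
      intro a ha b hb
      obtain ⟨a, rfl⟩ := exists_code S ha
      obtain ⟨b, rfl⟩ := exists_code S hb
      exact (code_mem_sub S (fun p : (X × Y) × X => p.2 = p.1.1) ((a, b), a)).2 rfl)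
  simp only [Formula.map, Term.map, Formula.Realize, Term.eval, Matrix.cons_val] at h
  exact ((E.starRel_starFun (fun p : X × Y => p.1) (E.pair x y) x).1 (h x.1 x.2 y.1 y.2)).symm

lemma starFun_snd (x : E.Star X) (y : E.Star Y) :
    E.starFun (fun p : X × Y => p.2) (E.pair x y) = y := by
  have h := (E.transfer (.all (.const (Coded.set X)) (.all (.const (Coded.set Y))
    (.mem (.pair (.pair (.var 1) (.var 0)) (.var 0))
      (.const (sub S fun p : (X × Y) × Y => p.2 = p.1.2)))))).1
    (by
      simp only [Formula.Realize, Term.eval, Matrix.cons_val]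
      intro a ha b hb
      obtain ⟨a, rfl⟩ := exists_code S ha
      obtain ⟨b, rfl⟩ := exists_code S hb
      exact (code_mem_sub S (fun p : (X × Y) × Y => p.2 = p.1.2) ((a, b), b)).2 rfl)
  simp only [Formula.map, Term.map, Formula.Realize, Term.eval, Matrix.cons_val] at h
  exact ((E.starRel_starFun (fun p : X × Y => p.2) (E.pair x y) y).1 (h x.1 x.2 y.1 y.2)).symm

lemma starFun_pair (f : X → Y) (g : X → Z) (x : E.Star X) :
    E.starFun (fun x => (f x, g x)) x = E.pair (E.starFun f x) (E.starFun g x) := by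
  obtain ⟨y, z, h⟩ := E.exists_pair (E.starFun (fun x => (f x, g x)) x)
  have h1 := E.starFun_comp (fun p : Y × Z => p.1) (fun x => (f x, g x)) x
  have h2 := E.starFun_comp (fun p : Y × Z => p.2) (fun x => (f x, g x)) x
  rw [h, starFun_fst] at h1
  rw [h, starFun_snd] at h2
  rw [h, ← h1, ← h2]

/-- Compatibility of the enlargement of relations with substitution. -/
lemma starPred_rel (P : Y → Z → Prop) (f : X → Y) (g : X → Z) (x : E.Star X) :
    E.StarPred (fun x => P (f x) (g x)) x ↔
      E.StarRel P (E.starFun f x) (E.starFun g x) := by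
  rw [StarRel, ← starFun_pair, ← E.starPred_comp (fun p : Y × Z => P p.1 p.2)]

lemma starPred_eq (f g : X → Y) (x : E.Star X) :
    E.StarPred (fun x => f x = g x) x ↔ E.starFun f x = E.starFun g x :=
  (E.starPred_rel (fun x y => x = y) f g x).trans (E.starRel_eq _ _)

lemma starFun_congr {f g : X → Y} (h : ∀ x, f x = g x) (x : E.Star X) :
    E.starFun f x = E.starFun g x :=
  (E.starPred_eq f g x).1 (E.transfer_forall h x)

lemma starFun_fst' (f : X → Y × Z) (x : E.Star X) (y : E.Star Y) (z : E.Star Z)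
    (h : E.starFun f x = E.pair y z) : E.starFun (fun x => (f x).1) x = y := by
  rw [E.starFun_comp (fun p : Y × Z => p.1), h, starFun_fst]

/-- The enlargement of a map in two variables. -/
noncomputable def starFun₂ (f : X → Y → Z) (x : E.Star X) (y : E.Star Y) : E.Star Z :=
  E.starFun (fun p : X × Y => f p.1 p.2) (E.pair x y)

lemma starFun_comp₂ (f : Y → Z → G) (a : X → Y) (b : X → Z) (x : E.Star X) :
    E.starFun (fun x => f (a x) (b x)) x = E.starFun₂ f (E.starFun a x) (E.starFun b x) := by
  rw [starFun₂, ← starFun_pair, ← E.starFun_comp (fun p : Y × Z => f p.1 p.2)]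

lemma starFun_std (f : X → Y) (x : X) : E.starFun f (E.std x) = E.std (f x) := by
  refine ((E.starRel_starFun _ _ _).1 ?_).symm
  rw [StarRel, E.pair_std]
  exact (E.starPred_std (fun p : X × Y => p.2 = f p.1) (x, f x)).2 rfl

end Basic

end Enlargement
/-! ### Small categories and their enlargements -/

/-- An `Ŝ`-small category: the set of its morphisms is (in bijection with) an element of `Ŝ`. -/
class SmallCat (S : Type u) (C : Type v) [Category.{w} C] where
  /-- the set of morphisms as an element of `Ŝ` -/
  coded : Coded S (Arrow C)

instance (S : Type u) (C : Type v) [Category.{w} C] [SmallCat S C] : Coded S (Arrow C) :=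
  SmallCat.coded

lemma arrow_id_injective (C : Type v) [Category.{w} C] :
    Function.Injective fun X : C => Arrow.mk (𝟙 X) :=
  fun _ _ h => congr_arg Arrow.left h

/-- The objects of an `Ŝ`-small category are identified with their identity morphisms. -/
noncomputable instance (S : Type u) (C : Type v) [Category.{w} C] [SmallCat S C] : Coded S C :=
  Coded.ofInjective S (fun X : C => Coded.code S (Arrow.mk (𝟙 X)))
    ((Coded.code_injective S).comp (arrow_id_injective C))
    ((Hat.isBounded_mem (Coded.set (S := S) (Arrow C))).subset (by
      rintro _ ⟨X, rfl⟩; exact Coded.code_mem S _))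

namespace Mor

section

variable {C : Type v} [Category.{w} C]

/-- source -/
def dom (f : Arrow C) : C := f.left

/-- target -/
def cod (f : Arrow C) : C := f.right

/-- identity -/
def ident (X : C) : Arrow C := Arrow.mk (𝟙 X)

open Classical in
/-- The composition (first `f`, then `g`) of composable morphisms (and `f` otherwise). -/
noncomputable def comp (f g : Arrow C) : Arrow C :=
  if h : f.right = g.left then Arrow.mk (f.hom ≫ eqToHom h ≫ g.hom) else f

/-- A functor as a map between the sets of morphisms. -/
def map {D : Type v'} [Category.{w'} D] (F : C ⥤ D) (f : Arrow C) : Arrow D :=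
  Arrow.mk (F.map f.hom)

lemma map_mk {D : Type v'} [Category.{w'} D] (F : C ⥤ D) {X Y : C} (f : X ⟶ Y) :
    map F (Arrow.mk f) = Arrow.mk (F.map f) := rfl

@[simp] lemma dom_mk {X Y : C} (f : X ⟶ Y) : dom (Arrow.mk f) = X := rfl
@[simp] lemma cod_mk {X Y : C} (f : X ⟶ Y) : cod (Arrow.mk f) = Y := rfl

lemma comp_mk {X Y Z : C} (f : X ⟶ Y) (g : Y ⟶ Z) :
    comp (Arrow.mk f) (Arrow.mk g) = Arrow.mk (f ≫ g) := by
  simp [comp]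

lemma exists_mk (f : Arrow C) : ∃ (X Y : C) (g : X ⟶ Y), f = Arrow.mk g := f.mk_surjective

lemma exists_mk_of_dom {f : Arrow C} {X : C} (h : dom f = X) :
    ∃ (Y : C) (g : X ⟶ Y), f = Arrow.mk g := by
  subst h; exact ⟨_, f.hom, rfl⟩

lemma exists_mk_of_cod {f : Arrow C} {Y : C} (h : cod f = Y) :
    ∃ (X : C) (g : X ⟶ Y), f = Arrow.mk g := by
  subst h; exact ⟨_, f.hom, rfl⟩

lemma exists_mk_of {f : Arrow C} {X Y : C} (h : dom f = X) (h' : cod f = Y) :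
    ∃ g : X ⟶ Y, f = Arrow.mk g := by
  subst h; subst h'; exact ⟨f.hom, rfl⟩

lemma mk_inj {X Y : C} {f g : X ⟶ Y} : Arrow.mk f = Arrow.mk g ↔ f = g := Arrow.mk_inj X Y

end

section

variable {C : Type v} [Category.{w} C] [Preadditive C]

/-- The zero morphism. -/
def zero (X Y : C) : Arrow C := Arrow.mk (0 : X ⟶ Y)

open Classical in
/-- The sum of parallel morphisms (and `f` otherwise). -/
noncomputable def add (f g : Arrow C) : Arrow C :=
  if h : g.left = f.left ∧ g.right = f.right then
    Arrow.mk (f.hom + eqToHom h.1.symm ≫ g.hom ≫ eqToHom h.2) else f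

/-- The opposite of a morphism. -/
def neg (f : Arrow C) : Arrow C := Arrow.mk (-f.hom)

lemma add_mk {X Y : C} (f g : X ⟶ Y) : add (Arrow.mk f) (Arrow.mk g) = Arrow.mk (f + g) := by
  simp [add]

end

end Mor

namespace Enlargement

variable {S W : Type u} (E : Enlargement S W)

section Projections

variable {X : Type v} {Y : Type w} {G : Type w'} [Coded S X] [Coded S Y] [Coded S G]

/-- The first projection of `*(X × Y) = *X × *Y`. -/
noncomputable def fst (p : E.Star (X × Y)) : E.Star X := E.starFun (fun p : X × Y => p.1) p

/-- The second projection of `*(X × Y) = *X × *Y`. -/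
noncomputable def snd (p : E.Star (X × Y)) : E.Star Y := E.starFun (fun p : X × Y => p.2) p

@[simp] lemma fst_pair (x : E.Star X) (y : E.Star Y) : E.fst (E.pair x y) = x := E.starFun_fst x y
@[simp] lemma snd_pair (x : E.Star X) (y : E.Star Y) : E.snd (E.pair x y) = y := E.starFun_snd x y

@[simp] lemma starFun_fst_comp (f : G → X × Y) (g : E.Star G) :
    E.starFun (fun x => (f x).1) g = E.fst (E.starFun f g) :=
  E.starFun_comp (fun p : X × Y => p.1) f g

@[simp] lemma starFun_snd_comp (f : G → X × Y) (g : E.Star G) :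
    E.starFun (fun x => (f x).2) g = E.snd (E.starFun f g) :=
  E.starFun_comp (fun p : X × Y => p.2) f g

end Projections

attribute [simp] starFun_id starPred_eq


section Cat

variable {C : Type v} [Category.{w} C] [SmallCat S C]
  {D : Type v'} [Category.{w'} D] [SmallCat S D]

/-- `*s` -/
noncomputable def dom (f : E.Star (Arrow C)) : E.Star C := E.starFun Mor.dom f
/-- `*t` -/
noncomputable def cod (f : E.Star (Arrow C)) : E.Star C := E.starFun Mor.cod f
/-- The enlargement of `X ↦ id_X`. -/
noncomputable def ident (X : E.Star C) : E.Star (Arrow C) := E.starFun Mor.ident X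
/-- The enlargement of the composition. -/
noncomputable def comp (f g : E.Star (Arrow C)) : E.Star (Arrow C) := E.starFun₂ Mor.comp f g
/-- The enlargement of a functor, on morphisms. -/
noncomputable def mapArr (F : C ⥤ D) (f : E.Star (Arrow C)) : E.Star (Arrow D) :=
  E.starFun (Mor.map F) f
/-- The enlargement of a functor, on objects. -/
noncomputable def mapObj (F : C ⥤ D) (X : E.Star C) : E.Star D := E.starFun F.obj X

@[simp] lemma starFun_dom₀ (f : E.Star (Arrow C)) : E.starFun Mor.dom f = E.dom f := rfl
@[simp] lemma starFun_cod₀ (f : E.Star (Arrow C)) : E.starFun Mor.cod f = E.cod f := rfl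
@[simp] lemma starFun_ident₀ (X : E.Star C) : E.starFun Mor.ident X = E.ident X := rfl
@[simp] lemma starFun_map₀ (F : C ⥤ D) (f : E.Star (Arrow C)) :
    E.starFun (Mor.map F) f = E.mapArr F f := rfl
@[simp] lemma starFun_obj₀ (F : C ⥤ D) (X : E.Star C) : E.starFun F.obj X = E.mapObj F X := rfl

section

variable {G : Type*} [Coded S G] (x : E.Star G)

@[simp] lemma starFun_dom (f : G → Arrow C) :
    E.starFun (fun x => Mor.dom (f x)) x = E.dom (E.starFun f x) := E.starFun_comp _ _ _
@[simp] lemma starFun_cod (f : G → Arrow C) :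
    E.starFun (fun x => Mor.cod (f x)) x = E.cod (E.starFun f x) := E.starFun_comp _ _ _
@[simp] lemma starFun_ident (f : G → C) :
    E.starFun (fun x => Mor.ident (f x)) x = E.ident (E.starFun f x) := E.starFun_comp _ _ _
@[simp] lemma starFun_comp' (f g : G → Arrow C) :
    E.starFun (fun x => Mor.comp (f x) (g x)) x = E.comp (E.starFun f x) (E.starFun g x) :=
  E.starFun_comp₂ _ _ _ _
@[simp] lemma starFun_map (F : C ⥤ D) (f : G → Arrow C) :
    E.starFun (fun x => Mor.map F (f x)) x = E.mapArr F (E.starFun f x) := E.starFun_comp _ _ _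
@[simp] lemma starFun_obj (F : C ⥤ D) (f : G → C) :
    E.starFun (fun x => F.obj (f x)) x = E.mapObj F (E.starFun f x) := E.starFun_comp _ _ _

end

lemma dom_ident (X : E.Star C) : E.dom (E.ident X) = X := by
  simpa using E.transfer_forall (P := fun X : C => Mor.dom (Mor.ident X) = X) (fun X => rfl) X

lemma cod_ident (X : E.Star C) : E.cod (E.ident X) = X := by
  simpa using E.transfer_forall (P := fun X : C => Mor.cod (Mor.ident X) = X) (fun X => rfl) X

lemma dom_comp {f g : E.Star (Arrow C)} (h : E.cod f = E.dom g) :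
    E.dom (E.comp f g) = E.dom f := by
  have := E.transfer_forall (P := fun f : Arrow C => ∀ g : Arrow C, Mor.cod f = Mor.dom g →
    Mor.dom (Mor.comp f g) = Mor.dom f) (by
      intro f g h
      obtain ⟨X, Y, f, rfl⟩ := Mor.exists_mk f
      obtain ⟨Z, g, rfl⟩ := Mor.exists_mk_of_dom (X := Y) h.symm
      rw [Mor.comp_mk]; rfl) f
  simp only [starPred_forall, starPred_imp, starPred_eq, starFun_dom, starFun_cod, starFun_comp',
    starFun_fst_comp, starFun_snd_comp, starFun_id, fst_pair, snd_pair] at this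
  exact this g h

lemma cod_comp {f g : E.Star (Arrow C)} (h : E.cod f = E.dom g) :
    E.cod (E.comp f g) = E.cod g := by
  have := E.transfer_forall (P := fun f : Arrow C => ∀ g : Arrow C, Mor.cod f = Mor.dom g →
    Mor.cod (Mor.comp f g) = Mor.cod g) (by
      intro f g h
      obtain ⟨X, Y, f, rfl⟩ := Mor.exists_mk f
      obtain ⟨Z, g, rfl⟩ := Mor.exists_mk_of_dom (X := Y) h.symm
      rw [Mor.comp_mk]; rfl) f
  simp at this
  exact this g h

lemma id_comp (f : E.Star (Arrow C)) : E.comp (E.ident (E.dom f)) f = f := by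
  have := E.transfer_forall (P := fun f : Arrow C => Mor.comp (Mor.ident (Mor.dom f)) f = f) (by
      intro f
      obtain ⟨X, Y, f, rfl⟩ := Mor.exists_mk f
      rw [Mor.ident, Mor.dom_mk, Mor.comp_mk, Category.id_comp]) f
  simpa using this

lemma comp_id (f : E.Star (Arrow C)) : E.comp f (E.ident (E.cod f)) = f := by
  have := E.transfer_forall (P := fun f : Arrow C => Mor.comp f (Mor.ident (Mor.cod f)) = f) (by
      intro f
      obtain ⟨X, Y, f, rfl⟩ := Mor.exists_mk f
      rw [Mor.ident, Mor.cod_mk, Mor.comp_mk, Category.comp_id]) f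
  simpa using this

lemma comp_assoc {f g h : E.Star (Arrow C)} (h₁ : E.cod f = E.dom g) (h₂ : E.cod g = E.dom h) :
    E.comp (E.comp f g) h = E.comp f (E.comp g h) := by
  have := E.transfer_forall (P := fun f : Arrow C => ∀ g h : Arrow C, Mor.cod f = Mor.dom g →
    Mor.cod g = Mor.dom h → Mor.comp (Mor.comp f g) h = Mor.comp f (Mor.comp g h)) (by
      intro f g h h₁ h₂
      obtain ⟨X, Y, f, rfl⟩ := Mor.exists_mk f
      obtain ⟨Z, g, rfl⟩ := Mor.exists_mk_of_dom (X := Y) h₁.symm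
      obtain ⟨Z', h, rfl⟩ := Mor.exists_mk_of_dom (X := Z) h₂.symm
      simp only [Mor.comp_mk, Category.assoc]) f
  simp at this
  exact this g h h₁ h₂

variable (C) in
/-- The enlargement `*C` of an `Ŝ`-small category: its objects are the elements of `*Ob(C)` and
its morphisms the elements of `*Mor(C)`. -/
@[ext] structure Cat : Type u where
  /-- the element of `*Ob(C)` -/
  pt : E.Star C

namespace Cat

variable {E}

/-- The morphisms `X ⟶ Y` of `*C` are the `f ∈ *Mor(C)` with `*s f = X` and `*t f = Y`. -/
@[ext] structure Hom (X Y : E.Cat C) : Type u where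
  /-- the element of `*Mor(C)` -/
  arr : E.Star (Arrow C)
  dom_arr : E.dom arr = X.pt
  cod_arr : E.cod arr = Y.pt

attribute [simp] Hom.dom_arr Hom.cod_arr

noncomputable instance : Category.{u} (E.Cat C) where
  Hom X Y := Hom X Y
  id X := ⟨E.ident X.pt, E.dom_ident X.pt, E.cod_ident X.pt⟩
  comp f g := ⟨E.comp f.arr g.arr, by rw [E.dom_comp (by simp), f.dom_arr],
    by rw [E.cod_comp (by simp), g.cod_arr]⟩
  id_comp := by
    rintro X Y ⟨f, h, h'⟩
    refine Hom.ext ?_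
    change E.comp (E.ident X.pt) f = f
    rw [← h, E.id_comp]
  comp_id := by
    rintro X Y ⟨f, h, h'⟩
    refine Hom.ext ?_
    change E.comp f (E.ident Y.pt) = f
    rw [← h', E.comp_id]
  assoc f g h := Hom.ext (E.comp_assoc (by simp) (by simp))

/-- The element of `*Mor(C)` underlying a morphism of `*C`. -/
def arr {X Y : E.Cat C} (f : X ⟶ Y) : E.Star (Arrow C) := Hom.arr f

/-- A morphism of `*C` from an element of `*Mor(C)`. -/
def homMk {X Y : E.Cat C} (f : E.Star (Arrow C)) (h : E.dom f = X.pt) (h' : E.cod f = Y.pt) :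
    X ⟶ Y := (⟨f, h, h'⟩ : Hom X Y)

@[simp] lemma arr_homMk {X Y : E.Cat C} (f : E.Star (Arrow C)) (h : E.dom f = X.pt)
    (h' : E.cod f = Y.pt) : arr (homMk f h h') = f := rfl
@[simp] lemma dom_arr {X Y : E.Cat C} (f : X ⟶ Y) : E.dom (arr f) = X.pt := Hom.dom_arr f
@[simp] lemma cod_arr {X Y : E.Cat C} (f : X ⟶ Y) : E.cod (arr f) = Y.pt := Hom.cod_arr f
@[simp] lemma arr_id (X : E.Cat C) : arr (𝟙 X) = E.ident X.pt := rfl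
@[simp] lemma arr_comp {X Y Z : E.Cat C} (f : X ⟶ Y) (g : Y ⟶ Z) :
    arr (f ≫ g) = E.comp (arr f) (arr g) := rfl
lemma hom_ext {X Y : E.Cat C} {f g : X ⟶ Y} (h : arr f = arr g) : f = g := Hom.ext h
lemma arr_inj {X Y : E.Cat C} {f g : X ⟶ Y} : arr f = arr g ↔ f = g :=
  ⟨hom_ext, fun h => h ▸ rfl⟩

end Cat

lemma dom_mapArr (F : C ⥤ D) (f : E.Star (Arrow C)) :
    E.dom (E.mapArr F f) = E.mapObj F (E.dom f) := by
  simpa using E.transfer_forall (P := fun f : Arrow C => Mor.dom (Mor.map F f) = F.obj (Mor.dom f))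
    (fun f => rfl) f

lemma cod_mapArr (F : C ⥤ D) (f : E.Star (Arrow C)) :
    E.cod (E.mapArr F f) = E.mapObj F (E.cod f) := by
  simpa using E.transfer_forall (P := fun f : Arrow C => Mor.cod (Mor.map F f) = F.obj (Mor.cod f))
    (fun f => rfl) f

lemma mapArr_ident (F : C ⥤ D) (X : E.Star C) :
    E.mapArr F (E.ident X) = E.ident (E.mapObj F X) := by
  simpa using E.transfer_forall
    (P := fun X : C => Mor.map F (Mor.ident X) = Mor.ident (F.obj X))
    (fun X => by simp [Mor.map, Mor.ident]) X

lemma mapArr_comp (F : C ⥤ D) {f g : E.Star (Arrow C)} (h : E.cod f = E.dom g) :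
    E.mapArr F (E.comp f g) = E.comp (E.mapArr F f) (E.mapArr F g) := by
  have := E.transfer_forall (P := fun f : Arrow C => ∀ g : Arrow C, Mor.cod f = Mor.dom g →
    Mor.map F (Mor.comp f g) = Mor.comp (Mor.map F f) (Mor.map F g)) (by
      intro f g h
      obtain ⟨X, Y, f, rfl⟩ := Mor.exists_mk f
      obtain ⟨Z, g, rfl⟩ := Mor.exists_mk_of_dom (X := Y) h.symm
      simp only [Mor.comp_mk, Mor.map_mk, Functor.map_comp]) f
  simp at this
  exact this g h

/-- The enlargement `*F : *C ⥤ *D` of a functor. -/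
noncomputable def mapFunctor (F : C ⥤ D) : E.Cat C ⥤ E.Cat D where
  obj X := ⟨E.mapObj F X.pt⟩
  map f := Cat.homMk (E.mapArr F (Cat.arr f)) (by rw [dom_mapArr, Cat.dom_arr])
    (by rw [cod_mapArr, Cat.cod_arr])
  map_id X := Cat.hom_ext (E.mapArr_ident F X.pt)
  map_comp f g := Cat.hom_ext (E.mapArr_comp F (by simp))

end Cat

end Enlargement
/-! ### The enlargement of an abelian category is abelian -/

namespace Mor

section

variable {C : Type v} [Category.{w} C]

/-- `f` is a monomorphism. -/
def IsMono (f : Arrow C) : Prop :=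
  ∀ a b : Arrow C, cod a = dom f → cod b = dom f → dom a = dom b → comp a f = comp b f → a = b

/-- `f` is an epimorphism. -/
def IsEpi (f : Arrow C) : Prop :=
  ∀ a b : Arrow C, dom a = cod f → dom b = cod f → cod a = cod b → comp f a = comp f b → a = b

lemma IsMono.mono {X Y : C} {f : X ⟶ Y} (hf : IsMono (Arrow.mk f)) : Mono f where
  right_cancellation a b h := mk_inj.1 (hf (Arrow.mk a) (Arrow.mk b) rfl rfl rfl (by
    rw [comp_mk, comp_mk, h]))

lemma IsEpi.epi {X Y : C} {f : X ⟶ Y} (hf : IsEpi (Arrow.mk f)) : Epi f where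
  left_cancellation a b h := mk_inj.1 (hf (Arrow.mk a) (Arrow.mk b) rfl rfl rfl (by
    rw [comp_mk, comp_mk, h]))

end

section

variable {C : Type v} [Category.{w} C] [Preadditive C]

/-- `k` is a kernel of `f`. -/
def IsKer (k f : Arrow C) : Prop :=
  cod k = dom f ∧ comp k f = zero (dom k) (cod f) ∧
    ∀ g : Arrow C, cod g = dom f → comp g f = zero (dom g) (cod f) →
      ∃ h : Arrow C, dom h = dom g ∧ cod h = dom k ∧ comp h k = g ∧
        ∀ h' : Arrow C, dom h' = dom g → cod h' = dom k → comp h' k = g → h' = h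

/-- `k` is a cokernel of `f`. -/
def IsCoker (k f : Arrow C) : Prop :=
  dom k = cod f ∧ comp f k = zero (dom f) (cod k) ∧
    ∀ g : Arrow C, dom g = cod f → comp f g = zero (dom f) (cod g) →
      ∃ h : Arrow C, cod h = cod g ∧ dom h = cod k ∧ comp k h = g ∧
        ∀ h' : Arrow C, cod h' = cod g → dom h' = cod k → comp k h' = g → h' = h

lemma isKer_of_isLimit {X Y Z : C} (f : Y ⟶ Z) (k : X ⟶ Y) (w : k ≫ f = 0)
    (hk : IsLimit (KernelFork.ofι k w)) : IsKer (Arrow.mk k) (Arrow.mk f) := by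
  refine ⟨rfl, ?_, fun g hg h => ?_⟩
  · rw [comp_mk, w]; rfl
  · obtain ⟨T, g, rfl⟩ := exists_mk_of_cod (Y := Y) hg
    rw [comp_mk] at h
    obtain ⟨l, hl⟩ := KernelFork.IsLimit.lift' hk g (mk_inj.1 h)
    replace hl : l ≫ k = g := hl
    refine ⟨Arrow.mk l, rfl, rfl, by rw [← hl, comp_mk], fun h' h1 h2 h3 => ?_⟩
    obtain ⟨h', rfl⟩ := exists_mk_of (X := T) (Y := X) h1 h2
    rw [comp_mk, mk_inj, ← hl] at h3
    rw [mk_inj]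
    exact Fork.IsLimit.hom_ext hk h3

lemma isCoker_of_isColimit {X Y Z : C} (f : X ⟶ Y) (k : Y ⟶ Z) (w : f ≫ k = 0)
    (hk : IsColimit (CokernelCofork.ofπ k w)) : IsCoker (Arrow.mk k) (Arrow.mk f) := by
  refine ⟨rfl, ?_, fun g hg h => ?_⟩
  · rw [comp_mk, w]; rfl
  · obtain ⟨T, g, rfl⟩ := exists_mk_of_dom (X := Y) hg
    rw [comp_mk] at h
    obtain ⟨l, hl⟩ := CokernelCofork.IsColimit.desc' hk g (mk_inj.1 h)
    replace hl : k ≫ l = g := hl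
    refine ⟨Arrow.mk l, rfl, rfl, by rw [← hl, comp_mk], fun h' h1 h2 h3 => ?_⟩
    obtain ⟨h', rfl⟩ := exists_mk_of (X := Z) (Y := T) h2 h1
    rw [comp_mk, mk_inj, ← hl] at h3
    rw [mk_inj]
    exact Cofork.IsColimit.hom_ext hk h3

end

end Mor

namespace Enlargement

variable {S W : Type u} (E : Enlargement S W)

section Preadditive

variable {C : Type v} [Category.{w} C] [SmallCat S C] [Preadditive C]

/-- The enlargement of the map that assigns the zero morphism to two objects. -/
noncomputable def zero (X Y : E.Star C) : E.Star (Arrow C) := E.starFun₂ Mor.zero X Y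
/-- The enlargement of the addition of morphisms. -/
noncomputable def add (f g : E.Star (Arrow C)) : E.Star (Arrow C) := E.starFun₂ Mor.add f g
/-- The enlargement of the negation of morphisms. -/
noncomputable def neg (f : E.Star (Arrow C)) : E.Star (Arrow C) := E.starFun Mor.neg f

@[simp] lemma starFun_neg₀ (f : E.Star (Arrow C)) : E.starFun Mor.neg f = E.neg f := rfl

section

variable {G : Type*} [Coded S G] (x : E.Star G)

@[simp] lemma starFun_zero (f g : G → C) :
    E.starFun (fun x => Mor.zero (f x) (g x)) x = E.zero (E.starFun f x) (E.starFun g x) :=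
  E.starFun_comp₂ _ _ _ _
@[simp] lemma starFun_add (f g : G → Arrow C) :
    E.starFun (fun x => Mor.add (f x) (g x)) x = E.add (E.starFun f x) (E.starFun g x) :=
  E.starFun_comp₂ _ _ _ _
@[simp] lemma starFun_neg (f : G → Arrow C) :
    E.starFun (fun x => Mor.neg (f x)) x = E.neg (E.starFun f x) := E.starFun_comp _ _ _

end

lemma dom_zero (X Y : E.Star C) : E.dom (E.zero X Y) = X := by
  have := E.transfer_forall (P := fun X : C => ∀ Y : C, Mor.dom (Mor.zero X Y) = X)
    (fun _ _ => rfl) X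
  simp at this
  exact this Y

lemma cod_zero (X Y : E.Star C) : E.cod (E.zero X Y) = Y := by
  have := E.transfer_forall (P := fun X : C => ∀ Y : C, Mor.cod (Mor.zero X Y) = Y)
    (fun _ _ => rfl) X
  simp at this
  exact this Y

lemma dom_neg (f : E.Star (Arrow C)) : E.dom (E.neg f) = E.dom f := by
  simpa using E.transfer_forall (P := fun f : Arrow C => Mor.dom (Mor.neg f) = Mor.dom f)
    (fun _ => rfl) f

lemma cod_neg (f : E.Star (Arrow C)) : E.cod (E.neg f) = E.cod f := by
  simpa using E.transfer_forall (P := fun f : Arrow C => Mor.cod (Mor.neg f) = Mor.cod f)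
    (fun _ => rfl) f

lemma dom_add {f g : E.Star (Arrow C)} (h : E.dom g = E.dom f) (h' : E.cod g = E.cod f) :
    E.dom (E.add f g) = E.dom f := by
  have := E.transfer_forall (P := fun f : Arrow C => ∀ g : Arrow C, Mor.dom g = Mor.dom f →
    Mor.cod g = Mor.cod f → Mor.dom (Mor.add f g) = Mor.dom f) (by
      intro f g h h'
      obtain ⟨X, Y, f, rfl⟩ := Mor.exists_mk f
      obtain ⟨g, rfl⟩ := Mor.exists_mk_of (X := X) (Y := Y) h h'
      rw [Mor.add_mk]; rfl) f
  simp at this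
  exact this g h h'

lemma cod_add {f g : E.Star (Arrow C)} (h : E.dom g = E.dom f) (h' : E.cod g = E.cod f) :
    E.cod (E.add f g) = E.cod f := by
  have := E.transfer_forall (P := fun f : Arrow C => ∀ g : Arrow C, Mor.dom g = Mor.dom f →
    Mor.cod g = Mor.cod f → Mor.cod (Mor.add f g) = Mor.cod f) (by
      intro f g h h'
      obtain ⟨X, Y, f, rfl⟩ := Mor.exists_mk f
      obtain ⟨g, rfl⟩ := Mor.exists_mk_of (X := X) (Y := Y) h h'
      rw [Mor.add_mk]; rfl) f
  simp at this
  exact this g h h'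

lemma add_assoc {f g h : E.Star (Arrow C)} (h₁ : E.dom g = E.dom f) (h₂ : E.cod g = E.cod f)
    (h₃ : E.dom h = E.dom f) (h₄ : E.cod h = E.cod f) :
    E.add (E.add f g) h = E.add f (E.add g h) := by
  have := E.transfer_forall (P := fun f : Arrow C => ∀ g h : Arrow C, Mor.dom g = Mor.dom f →
    Mor.cod g = Mor.cod f → Mor.dom h = Mor.dom f → Mor.cod h = Mor.cod f →
    Mor.add (Mor.add f g) h = Mor.add f (Mor.add g h)) (by
      intro f g h h₁ h₂ h₃ h₄
      obtain ⟨X, Y, f, rfl⟩ := Mor.exists_mk f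
      obtain ⟨g, rfl⟩ := Mor.exists_mk_of (X := X) (Y := Y) h₁ h₂
      obtain ⟨h, rfl⟩ := Mor.exists_mk_of (X := X) (Y := Y) h₃ h₄
      simp only [Mor.add_mk, _root_.add_assoc]) f
  simp at this
  exact this g h h₁ h₂ h₃ h₄

lemma add_comm {f g : E.Star (Arrow C)} (h₁ : E.dom g = E.dom f) (h₂ : E.cod g = E.cod f) :
    E.add f g = E.add g f := by
  have := E.transfer_forall (P := fun f : Arrow C => ∀ g : Arrow C, Mor.dom g = Mor.dom f →
    Mor.cod g = Mor.cod f → Mor.add f g = Mor.add g f) (by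
      intro f g h₁ h₂
      obtain ⟨X, Y, f, rfl⟩ := Mor.exists_mk f
      obtain ⟨g, rfl⟩ := Mor.exists_mk_of (X := X) (Y := Y) h₁ h₂
      simp only [Mor.add_mk, _root_.add_comm]) f
  simp at this
  exact this g h₁ h₂

lemma zero_add (f : E.Star (Arrow C)) : E.add (E.zero (E.dom f) (E.cod f)) f = f := by
  have := E.transfer_forall (P := fun f : Arrow C =>
    Mor.add (Mor.zero (Mor.dom f) (Mor.cod f)) f = f) (by
      intro f
      obtain ⟨X, Y, f, rfl⟩ := Mor.exists_mk f
      exact (Mor.add_mk 0 f).trans (congr_arg Arrow.mk (_root_.zero_add f))) f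
  simpa using this

lemma neg_add (f : E.Star (Arrow C)) : E.add (E.neg f) f = E.zero (E.dom f) (E.cod f) := by
  have := E.transfer_forall (P := fun f : Arrow C =>
    Mor.add (Mor.neg f) f = Mor.zero (Mor.dom f) (Mor.cod f)) (by
      intro f
      obtain ⟨X, Y, f, rfl⟩ := Mor.exists_mk f
      exact (Mor.add_mk (-f) f).trans (by rw [neg_add_cancel]; rfl)) f
  simpa using this

lemma add_comp {f g h : E.Star (Arrow C)} (h₁ : E.dom g = E.dom f) (h₂ : E.cod g = E.cod f)
    (h₃ : E.cod f = E.dom h) :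
    E.comp (E.add f g) h = E.add (E.comp f h) (E.comp g h) := by
  have := E.transfer_forall (P := fun f : Arrow C => ∀ g h : Arrow C, Mor.dom g = Mor.dom f →
    Mor.cod g = Mor.cod f → Mor.cod f = Mor.dom h →
    Mor.comp (Mor.add f g) h = Mor.add (Mor.comp f h) (Mor.comp g h)) (by
      intro f g h h₁ h₂ h₃
      obtain ⟨X, Y, f, rfl⟩ := Mor.exists_mk f
      obtain ⟨g, rfl⟩ := Mor.exists_mk_of (X := X) (Y := Y) h₁ h₂
      obtain ⟨Z, h, rfl⟩ := Mor.exists_mk_of_dom (X := Y) h₃.symm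
      simp only [Mor.add_mk, Mor.comp_mk, Preadditive.add_comp]) f
  simp at this
  exact this g h h₁ h₂ h₃

lemma comp_add {f g h : E.Star (Arrow C)} (h₁ : E.dom h = E.dom g) (h₂ : E.cod h = E.cod g)
    (h₃ : E.cod f = E.dom g) :
    E.comp f (E.add g h) = E.add (E.comp f g) (E.comp f h) := by
  have := E.transfer_forall (P := fun f : Arrow C => ∀ g h : Arrow C, Mor.dom h = Mor.dom g →
    Mor.cod h = Mor.cod g → Mor.cod f = Mor.dom g →
    Mor.comp f (Mor.add g h) = Mor.add (Mor.comp f g) (Mor.comp f h)) (by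
      intro f g h h₁ h₂ h₃
      obtain ⟨X, Y, f, rfl⟩ := Mor.exists_mk f
      obtain ⟨Z, g, rfl⟩ := Mor.exists_mk_of_dom (X := Y) h₃.symm
      obtain ⟨h, rfl⟩ := Mor.exists_mk_of (X := Y) (Y := Z) h₁ h₂
      simp only [Mor.add_mk, Mor.comp_mk, Preadditive.comp_add]) f
  simp at this
  exact this g h h₁ h₂ h₃

namespace Cat

variable {E}

/-- The zero morphism of `*C`. -/
noncomputable def zeroHom (X Y : E.Cat C) : X ⟶ Y :=
  homMk (E.zero X.pt Y.pt) (E.dom_zero _ _) (E.cod_zero _ _)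

/-- The sum of two morphisms of `*C`. -/
noncomputable def addHom {X Y : E.Cat C} (f g : X ⟶ Y) : X ⟶ Y :=
  homMk (E.add (arr f) (arr g)) (by rw [E.dom_add (by simp) (by simp), dom_arr])
    (by rw [E.cod_add (by simp) (by simp), cod_arr])

/-- The opposite of a morphism of `*C`. -/
noncomputable def negHom {X Y : E.Cat C} (f : X ⟶ Y) : X ⟶ Y :=
  homMk (E.neg (arr f)) (by rw [E.dom_neg, dom_arr]) (by rw [E.cod_neg, cod_arr])

/-- The addition of morphisms of `*C` is the enlargement of the addition of morphisms of `C`. -/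
noncomputable instance homGroup (X Y : E.Cat C) : AddCommGroup (X ⟶ Y) where
  zero := zeroHom X Y
  add := addHom
  neg := negHom
  add_assoc f g h := hom_ext (E.add_assoc (by simp) (by simp) (by simp) (by simp))
  zero_add f := hom_ext (by
    have h := E.zero_add (arr f)
    rwa [dom_arr, cod_arr] at h)
  add_zero f := hom_ext (by
    have h := E.zero_add (arr f)
    rw [dom_arr, cod_arr] at h
    exact (E.add_comm (f := arr f) (g := arr (zeroHom X Y)) (by simp) (by simp)).trans h)
  nsmul := @nsmulRec _ ⟨zeroHom X Y⟩ ⟨addHom⟩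
  zsmul := @zsmulRec _ ⟨zeroHom X Y⟩ ⟨addHom⟩ ⟨negHom⟩ (@nsmulRec _ ⟨zeroHom X Y⟩ ⟨addHom⟩)
  neg_add_cancel f := hom_ext (by
    have h := E.neg_add (arr f)
    rwa [dom_arr, cod_arr] at h)
  add_comm f g := hom_ext (E.add_comm (by simp) (by simp))

noncomputable instance preadditive : Preadditive (E.Cat C) where
  homGroup := homGroup
  add_comp X Y Z f f' g := hom_ext (E.add_comp (f := arr f) (g := arr f') (h := arr g)
    (by simp) (by simp) (by simp))
  comp_add X Y Z f g g' := hom_ext (E.comp_add (f := arr f) (g := arr g) (h := arr g')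
    (by simp) (by simp) (by simp))

lemma arr_zero (X Y : E.Cat C) : arr (0 : X ⟶ Y) = E.zero X.pt Y.pt := rfl
lemma arr_add {X Y : E.Cat C} (f g : X ⟶ Y) : arr (f + g) = E.add (arr f) (arr g) := rfl
lemma arr_neg {X Y : E.Cat C} (f : X ⟶ Y) : arr (-f) = E.neg (arr f) := rfl

lemma exists_isLimit {X Y Z : E.Cat C} (f : Y ⟶ Z) (k : X ⟶ Y)
    (h : E.StarRel Mor.IsKer (arr k) (arr f)) :
    ∃ w : k ≫ f = 0, Nonempty (IsLimit (KernelFork.ofι k w)) := by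
  simp only [StarRel, Mor.IsKer] at h
  simp at h
  obtain ⟨h2, h3⟩ := h
  have w : k ≫ f = 0 := hom_ext h2
  have key : ∀ (T : E.Cat C) (g : T ⟶ Y), g ≫ f = 0 → ∃ l : T ⟶ X, l ≫ k = g ∧
      ∀ l' : T ⟶ X, l' ≫ k = g → l' = l := by
    intro T g hg
    obtain ⟨l, h4, h5, h6, h7⟩ := h3 (arr g) (by simp) (by
      rw [← arr_comp, hg, dom_arr]; rfl)
    refine ⟨homMk l (by rw [h4, dom_arr]) h5, hom_ext h6, fun l' hl' => hom_ext ?_⟩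
    exact h7 (arr l') (by simp) (by simp) (by rw [← arr_comp, hl'])
  choose l hl hl' using key
  exact ⟨w, ⟨KernelFork.IsLimit.ofι k w (fun {T} g hg => l T g hg) (fun {T} g hg => hl T g hg)
    (fun {T} g hg m hm => hl' T g hg m hm)⟩⟩

lemma exists_isColimit {X Y Z : E.Cat C} (f : X ⟶ Y) (k : Y ⟶ Z)
    (h : E.StarRel Mor.IsCoker (arr k) (arr f)) :
    ∃ w : f ≫ k = 0, Nonempty (IsColimit (CokernelCofork.ofπ k w)) := by
  simp only [StarRel, Mor.IsCoker] at h
  simp at h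
  obtain ⟨h2, h3⟩ := h
  have w : f ≫ k = 0 := hom_ext h2
  have key : ∀ (T : E.Cat C) (g : Y ⟶ T), f ≫ g = 0 → ∃ l : Z ⟶ T, k ≫ l = g ∧
      ∀ l' : Z ⟶ T, k ≫ l' = g → l' = l := by
    intro T g hg
    obtain ⟨l, h4, h5, h6, h7⟩ := h3 (arr g) (by simp) (by
      rw [← arr_comp, hg, cod_arr]; rfl)
    refine ⟨homMk l h5 (by rw [h4, cod_arr]), hom_ext h6, fun l' hl' => hom_ext ?_⟩
    exact h7 (arr l') (by simp) (by simp) (by rw [← arr_comp, hl'])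
  choose l hl hl' using key
  exact ⟨w, ⟨CokernelCofork.IsColimit.ofπ k w (fun {T} g hg => l T g hg)
    (fun {T} g hg => hl T g hg) (fun {T} g hg m hm => hl' T g hg m hm)⟩⟩

end Cat

end Preadditive

section MonoEpi

variable {C : Type v} [Category.{w} C] [SmallCat S C]

namespace Cat

variable {E}

lemma starPred_isMono {X Y : E.Cat C} (f : X ⟶ Y) [Mono f] : E.StarPred Mor.IsMono (arr f) := by
  rw [show (Mor.IsMono (C := C)) = fun f => Mor.IsMono f from rfl]
  simp only [Mor.IsMono]
  simp
  intro a b h1 h2 h3 h4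
  have := (cancel_mono f).1 (show homMk (X := ⟨E.dom a⟩) a rfl h1 ≫ f =
    homMk (X := ⟨E.dom a⟩) b h3.symm h2 ≫ f from hom_ext h4)
  exact arr_inj.2 this

lemma starPred_isEpi {X Y : E.Cat C} (f : X ⟶ Y) [Epi f] : E.StarPred Mor.IsEpi (arr f) := by
  rw [show (Mor.IsEpi (C := C)) = fun f => Mor.IsEpi f from rfl]
  simp only [Mor.IsEpi]
  simp
  intro a b h1 h2 h3 h4
  have := (cancel_epi f).1 (show f ≫ homMk (Y := ⟨E.cod a⟩) a h1 rfl =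
    f ≫ homMk (Y := ⟨E.cod a⟩) b h2 h3.symm from hom_ext h4)
  exact arr_inj.2 this

end Cat

end MonoEpi

section Abelian

variable {A : Type v} [Category.{w} A] [SmallCat S A] [Abelian A]

namespace Cat

variable {E}

instance : HasZeroObject (E.Cat A) := by
  obtain ⟨Z, hZ⟩ := HasZeroObject.zero (C := A)
  have h : E.StarPred (fun X : A => Mor.ident X = Mor.zero X X) (E.std Z) :=
    (E.starPred_std _ _).2 (congr_arg Arrow.mk (hZ.eq_of_src _ _))
  simp at h
  exact ⟨⟨⟨E.std Z⟩, (IsZero.iff_id_eq_zero _).2 (hom_ext h)⟩⟩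

instance : HasKernels (E.Cat A) where
  has_limit {X Y} f := by
    have h := E.transfer_forall (P := fun f : Arrow A => ∃ k : Arrow A, Mor.IsKer k f) (by
      intro f
      obtain ⟨X, Y, f, rfl⟩ := Mor.exists_mk f
      exact ⟨_, Mor.isKer_of_isLimit f _ (kernel.condition f) (kernelIsKernel f)⟩) (arr f)
    simp only [starPred_exists, starPred_rel, starFun_fst_comp, starFun_snd_comp, starFun_id,
      fst_pair, snd_pair] at h
    obtain ⟨k, hk⟩ := h
    have hk' := hk
    simp only [StarRel, Mor.IsKer] at hk'
    simp at hk'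
    obtain ⟨w, ⟨hl⟩⟩ := exists_isLimit f (homMk (X := ⟨E.dom k⟩) k rfl hk'.1) hk
    exact ⟨⟨_, hl⟩⟩

instance : HasCokernels (E.Cat A) where
  has_colimit {X Y} f := by
    have h := E.transfer_forall (P := fun f : Arrow A => ∃ k : Arrow A, Mor.IsCoker k f) (by
      intro f
      obtain ⟨X, Y, f, rfl⟩ := Mor.exists_mk f
      exact ⟨_, Mor.isCoker_of_isColimit f _ (cokernel.condition f) (cokernelIsCokernel f)⟩) (arr f)
    simp only [starPred_exists, starPred_rel, starFun_fst_comp, starFun_snd_comp, starFun_id,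
      fst_pair, snd_pair] at h
    obtain ⟨k, hk⟩ := h
    have hk' := hk
    simp only [StarRel, Mor.IsCoker] at hk'
    simp at hk'
    obtain ⟨w, ⟨hl⟩⟩ := exists_isColimit f (homMk (Y := ⟨E.cod k⟩) k hk'.1 rfl) hk
    exact ⟨⟨_, hl⟩⟩

instance : IsNormalMonoCategory (E.Cat A) where
  normalMonoOfMono {X Y} f _ := by
    have h := E.transfer_forall (P := fun f : Arrow A => Mor.IsMono f →
        ∃ g : Arrow A, Mor.dom g = Mor.cod f ∧ Mor.IsKer f g) (by
      intro f hf
      obtain ⟨X, Y, f, rfl⟩ := Mor.exists_mk f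
      have := hf.mono
      have hn := Classical.choice (IsNormalMonoCategory.normalMonoOfMono f)
      exact ⟨Arrow.mk hn.g, rfl, Mor.isKer_of_isLimit hn.g f hn.w hn.isLimit⟩) (arr f)
    rw [starPred_imp] at h
    obtain ⟨g, hg⟩ := (E.starPred_exists _ _).1 (h (starPred_isMono f))
    simp only [starPred_and, starPred_rel, starRel_eq, starFun_dom, starFun_cod,
      starFun_fst_comp, starFun_snd_comp, starFun_id, fst_pair, snd_pair, cod_arr] at hg
    obtain ⟨w, ⟨hl⟩⟩ := exists_isLimit (homMk (Y := ⟨E.cod g⟩) g hg.1 rfl) f hg.2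
    exact ⟨⟨_, _, w, hl⟩⟩

instance : IsNormalEpiCategory (E.Cat A) where
  normalEpiOfEpi {X Y} f _ := by
    have h := E.transfer_forall (P := fun f : Arrow A => Mor.IsEpi f →
        ∃ g : Arrow A, Mor.cod g = Mor.dom f ∧ Mor.IsCoker f g) (by
      intro f hf
      obtain ⟨X, Y, f, rfl⟩ := Mor.exists_mk f
      have := hf.epi
      have hn := Classical.choice (IsNormalEpiCategory.normalEpiOfEpi f)
      exact ⟨Arrow.mk hn.g, rfl, Mor.isCoker_of_isColimit hn.g f hn.w hn.isColimit⟩) (arr f)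
    rw [starPred_imp] at h
    obtain ⟨g, hg⟩ := (E.starPred_exists _ _).1 (h (starPred_isEpi f))
    simp only [starPred_and, starPred_rel, starRel_eq, starFun_dom, starFun_cod,
      starFun_fst_comp, starFun_snd_comp, starFun_id, fst_pair, snd_pair, dom_arr] at hg
    obtain ⟨w, ⟨hl⟩⟩ := exists_isColimit (homMk (X := ⟨E.dom g⟩) g rfl hg.1) f hg.2
    exact ⟨⟨_, _, w, hl⟩⟩

instance : HasBinaryBiproducts (E.Cat A) where
  has_binary_biproduct X Y := by
    have h := E.transfer_forall (P := fun X : A => ∀ Y : A, ∃ i j p q : Arrow A,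
        (Mor.dom i = X ∧ Mor.dom j = Y ∧ Mor.cod j = Mor.cod i) ∧
        (Mor.dom p = Mor.cod i ∧ Mor.cod p = X ∧ Mor.dom q = Mor.cod i ∧ Mor.cod q = Y) ∧
        (Mor.comp i p = Mor.ident X ∧ Mor.comp i q = Mor.zero X Y ∧
          Mor.comp j p = Mor.zero Y X ∧ Mor.comp j q = Mor.ident Y) ∧
        Mor.add (Mor.comp p i) (Mor.comp q j) = Mor.ident (Mor.cod i)) (by
      intro X Y
      refine ⟨Arrow.mk (biprod.inl : X ⟶ X ⊞ Y), Arrow.mk (biprod.inr : Y ⟶ X ⊞ Y),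
        Arrow.mk (biprod.fst : X ⊞ Y ⟶ X), Arrow.mk (biprod.snd : X ⊞ Y ⟶ Y),
        ⟨rfl, rfl, rfl⟩, ⟨rfl, rfl, rfl, rfl⟩, ⟨?_, ?_, ?_, ?_⟩, ?_⟩
      · rw [Mor.comp_mk, biprod.inl_fst]; rfl
      · rw [Mor.comp_mk, biprod.inl_snd]; rfl
      · rw [Mor.comp_mk, biprod.inr_fst]; rfl
      · rw [Mor.comp_mk, biprod.inr_snd]; rfl
      · rw [Mor.comp_mk, Mor.comp_mk, Mor.add_mk, biprod.total]; rfl) X.pt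
    rw [starPred_forall] at h
    have h' := h Y.pt
    simp only [starPred_exists, starPred_and, starPred_eq, starFun_dom, starFun_cod, starFun_comp',
      starFun_ident, starFun_zero, starFun_add, starFun_fst_comp, starFun_snd_comp, starFun_id,
      fst_pair, snd_pair] at h'
    obtain ⟨i, j, p, q, ⟨h1, h2, h3⟩, ⟨h4, h5, h6, h7⟩, ⟨h8, h9, h10, h11⟩, h12⟩ := h'
    exact hasBinaryBiproduct_of_total
      { pt := ⟨E.cod i⟩
        fst := homMk p h4 h5
        snd := homMk q h6 h7
        inl := homMk i h1 rfl
        inr := homMk j h2 h3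
        inl_fst := hom_ext h8
        inl_snd := hom_ext h9
        inr_fst := hom_ext h10
        inr_snd := hom_ext h11 } (hom_ext h12)

/-- The enlargement of an abelian category is abelian. -/
noncomputable instance abelian : Abelian (E.Cat A) where
  has_finite_products := hasFiniteProducts_of_has_binary_and_terminal

end Cat

end Abelian

end Enlargement
/-! ### Complexes and the derived category as small categories -/

attribute [local instance] HasDerivedCategory.standard

namespace Coded

section

variable (S : Type u) (X : Type v) {Z : Type w} [Coded S X]

/-- Subtypes of types in the superstructure. -/
@[reducible] noncomputable def ofInj (f : Z → X) (hf : Function.Injective f) : Coded S Z :=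
  ofInjective S (fun z => code S (f z)) ((code_injective S).comp hf)
    ((Hat.isBounded_mem (set (S := S) X)).subset (by rintro _ ⟨z, rfl⟩; exact code_mem S _))

lemma sub_injective : Function.Injective fun A : Set X => sub S (fun x => x ∈ A) := by
  intro A B h
  ext x
  exact ((code_mem_sub S (fun x => x ∈ A) x).symm.trans
    (Set.ext_iff.1 (congr_arg (fun y => {z | z ∈ y}) h) (code S x))).trans
    (code_mem_sub S (fun x => x ∈ B) x)

lemma isBounded_sub : Hat.IsBounded (Set.range fun A : Set X => sub S (fun x => x ∈ A)) := by
  obtain ⟨n, hn⟩ := Hat.isBounded_mem (set (S := S) X)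
  refine ⟨n + 1, ?_⟩
  rintro _ ⟨A, rfl⟩
  have h : sub S (fun x => x ∈ A) = Hat.ofSet n {y | y ∈ sub S (fun x => x ∈ A)} := by
    refine Hat.ext (Hat.isSet_mkSet _ _) (Hat.isSet_ofSet _ _) fun z => ?_
    rw [Hat.mem_ofSet]
    · rfl
    · intro y hy
      obtain ⟨x, -, rfl⟩ := (mem_sub S _ y).1 hy
      exact hn _ (code_mem S x)
  exact ⟨Lev.set {a | Hat.ι n a ∈ sub S (fun x => x ∈ A)}, h⟩

/-- The power set. -/
noncomputable instance powerset : Coded S (Set X) :=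
  ofInjective S _ (sub_injective S X) (isBounded_sub S X)

/-- The integers, as distinct base elements. -/
noncomputable instance int [Infinite S] : Coded S ℤ :=
  ofInjective S (fun n => Hat.atom (Infinite.natEmbedding S (Equiv.intEquivNat n)))
    ((Hat.ι_injective 0).comp ((Infinite.natEmbedding S).injective.comp
      Equiv.intEquivNat.injective))
    ⟨0, by rintro _ ⟨n, rfl⟩; exact ⟨_, rfl⟩⟩

end

section Complexes

variable (S : Type u) [Infinite S] (A : Type v) [Category.{w} A] [Abelian A] [SmallCat S A]

variable {A} in
/-- A complex as a set of triples `(i, j, d : Kⁱ ⟶ Kʲ)`. -/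
def cpxSet (K : CochainComplex A ℤ) : Set (ℤ × ℤ × Arrow A) :=
  Set.range fun p : ℤ × ℤ => (p.1, p.2, Arrow.mk (K.d p.1 p.2))

variable {A} in
/-- A morphism of complexes as a set of pairs `(i, fⁱ : Kⁱ ⟶ Lⁱ)`. -/
def homSet (f : Arrow (CochainComplex A ℤ)) : Set (ℤ × Arrow A) :=
  Set.range fun i : ℤ => (i, Arrow.mk (f.hom.f i))

lemma cpxSet_injective : Function.Injective (cpxSet (A := A)) := by
  intro K L h
  have key : ∀ i j, Arrow.mk (K.d i j) = Arrow.mk (L.d i j) := by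
    intro i j
    have h1 : (i, j, Arrow.mk (K.d i j)) ∈ cpxSet L := h ▸ ⟨(i, j), rfl⟩
    obtain ⟨⟨i', j'⟩, h2⟩ := h1
    simp only [Prod.mk.injEq] at h2
    obtain ⟨rfl, rfl, h2⟩ := h2
    exact h2.symm
  obtain ⟨KX, Kd, hK, hK'⟩ := K
  obtain ⟨LX, Ld, hL, hL'⟩ := L
  have hX : KX = LX := funext fun i => congr_arg Arrow.left (key i i)
  subst hX
  have hd : Kd = Ld := by
    funext i j
    exact Mor.mk_inj.1 (key i j)
  subst hd
  rfl

lemma homSet_injective : Function.Injective fun f : Arrow (CochainComplex A ℤ) =>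
    (cpxSet f.left, cpxSet f.right, homSet f) := by
  intro f g h
  obtain ⟨K, L, f, rfl⟩ := Mor.exists_mk f
  obtain ⟨K', L', g, rfl⟩ := Mor.exists_mk g
  simp only [Prod.mk.injEq] at h
  obtain ⟨h1, h2, h3⟩ := h
  obtain rfl : K = K' := cpxSet_injective A h1
  obtain rfl : L = L' := cpxSet_injective A h2
  rw [Mor.mk_inj]
  ext i
  have h4 : (i, Arrow.mk (f.f i)) ∈ homSet (Arrow.mk g) := h3 ▸ ⟨i, rfl⟩
  obtain ⟨i', h4⟩ := h4
  simp only [Prod.mk.injEq] at h4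
  obtain ⟨rfl, h4⟩ := h4
  exact (Mor.mk_inj.1 h4).symm

end Complexes

end Coded

/-- The category of complexes of an `Ŝ`-small abelian category is `Ŝ`-small. -/
noncomputable instance (S : Type u) [Infinite S] (A : Type v) [Category.{w} A] [Abelian A]
    [SmallCat S A] : SmallCat S (CochainComplex A ℤ) where
  coded := Coded.ofInj S _ _ (Coded.homSet_injective A)

section

variable (A : Type v) [Category.{w} A] [Abelian A]

lemma exists_fraction (f : Arrow (DerivedCategory A)) :
    ∃ p : Arrow (CochainComplex A ℤ) × Arrow (CochainComplex A ℤ),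
      ∃ (h : p.1.left = p.2.left) (_ : IsIso (DerivedCategory.Q.map p.1.hom)),
        f = Arrow.mk (inv (DerivedCategory.Q.map p.1.hom) ≫
          DerivedCategory.Q.map (eqToHom h ≫ p.2.hom)) := by
  obtain ⟨X, Y, f, rfl⟩ := Mor.exists_mk f
  obtain ⟨K, rfl⟩ : ∃ K : CochainComplex A ℤ, DerivedCategory.Q.obj K = X :=
    (Localization.Construction.objEquiv _).surjective X
  obtain ⟨L, rfl⟩ : ∃ L : CochainComplex A ℤ, DerivedCategory.Q.obj L = Y :=
    (Localization.Construction.objEquiv _).surjective Y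
  obtain ⟨K', s, hs, g, rfl⟩ := DerivedCategory.right_fac f
  exact ⟨(Arrow.mk s, Arrow.mk g), rfl, hs, by simp⟩

/-- A fraction that represents a morphism of the derived category. -/
noncomputable def fraction (f : Arrow (DerivedCategory A)) :
    Arrow (CochainComplex A ℤ) × Arrow (CochainComplex A ℤ) := (exists_fraction A f).choose

lemma fraction_injective : Function.Injective (fraction A) := by
  intro f g h
  obtain ⟨h1, h2, h3⟩ := (exists_fraction A f).choose_spec
  obtain ⟨h4, h5, h6⟩ := (exists_fraction A g).choose_spec
  change (exists_fraction A f).choose = (exists_fraction A g).choose at h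
  rw [h3, h6]
  clear h3 h6
  generalize (exists_fraction A f).choose = p at *
  generalize (exists_fraction A g).choose = q at *
  subst h
  rfl

end

/-- The derived category of an `Ŝ`-small abelian category is `Ŝ`-small. -/
noncomputable instance (S : Type u) [Infinite S] (A : Type v) [Category.{w} A] [Abelian A]
    [SmallCat S A] : SmallCat S (DerivedCategory A) where
  coded := Coded.ofInj S _ _ (fraction_injective A)

/-! ### The restriction functor from `*`-complexes to complexes -/

/-- A natural transformation as a map from objects to morphisms. -/
def Mor.nat {C : Type v} [Category.{w} C] {D : Type v'} [Category.{w'} D] {F G : C ⥤ D}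
    (α : F ⟶ G) (X : C) : Arrow D := Arrow.mk (α.app X)

namespace Enlargement

variable {S W : Type u} (E : Enlargement S W)

section NatTrans

variable {C : Type v} [Category.{w} C] [SmallCat S C]
  {D : Type v'} [Category.{w'} D] [SmallCat S D] {F G H : C ⥤ D}

/-- The enlargement of a natural transformation. -/
noncomputable def nat (α : F ⟶ G) (X : E.Star C) : E.Star (Arrow D) := E.starFun (Mor.nat α) X

@[simp] lemma starFun_nat₀ (α : F ⟶ G) (X : E.Star C) : E.starFun (Mor.nat α) X = E.nat α X := rfl

@[simp] lemma starFun_nat {I : Type*} [Coded S I] (x : E.Star I) (α : F ⟶ G) (f : I → C) :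
    E.starFun (fun x => Mor.nat α (f x)) x = E.nat α (E.starFun f x) := E.starFun_comp _ _ _

lemma dom_nat (α : F ⟶ G) (X : E.Star C) : E.dom (E.nat α X) = E.mapObj F X := by
  simpa using E.transfer_forall (P := fun X : C => Mor.dom (Mor.nat α X) = F.obj X)
    (fun _ => rfl) X

lemma cod_nat (α : F ⟶ G) (X : E.Star C) : E.cod (E.nat α X) = E.mapObj G X := by
  simpa using E.transfer_forall (P := fun X : C => Mor.cod (Mor.nat α X) = G.obj X)
    (fun _ => rfl) X

lemma nat_naturality (α : F ⟶ G) (f : E.Star (Arrow C)) :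
    E.comp (E.mapArr F f) (E.nat α (E.cod f)) = E.comp (E.nat α (E.dom f)) (E.mapArr G f) := by
  simpa using E.transfer_forall (P := fun f : Arrow C =>
    Mor.comp (Mor.map F f) (Mor.nat α (Mor.cod f)) =
      Mor.comp (Mor.nat α (Mor.dom f)) (Mor.map G f)) (by
      intro f
      obtain ⟨X, Y, f, rfl⟩ := Mor.exists_mk f
      simp only [Mor.map_mk, Mor.nat, Mor.cod_mk, Mor.dom_mk, Mor.comp_mk, α.naturality]) f

lemma nat_comp (α : F ⟶ G) (β : G ⟶ H) (X : E.Star C) :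
    E.nat (α ≫ β) X = E.comp (E.nat α X) (E.nat β X) := by
  simpa using E.transfer_forall (P := fun X : C =>
    Mor.nat (α ≫ β) X = Mor.comp (Mor.nat α X) (Mor.nat β X)) (by
      intro X
      simp only [Mor.nat, Mor.comp_mk, NatTrans.comp_app]) X

lemma nat_zero [Preadditive D] (X : E.Star C) :
    E.nat (0 : F ⟶ G) X = E.zero (E.mapObj F X) (E.mapObj G X) := by
  simpa using E.transfer_forall (P := fun X : C =>
    Mor.nat (0 : F ⟶ G) X = Mor.zero (F.obj X) (G.obj X)) (fun _ => rfl) X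

/-- The enlargement of a natural transformation. -/
noncomputable def mapNatTrans (α : F ⟶ G) : E.mapFunctor F ⟶ E.mapFunctor G where
  app X := Cat.homMk (E.nat α X.pt) (E.dom_nat α X.pt) (E.cod_nat α X.pt)
  naturality X Y f := Cat.hom_ext (by
    have h := E.nat_naturality α (Cat.arr f)
    rw [Cat.dom_arr, Cat.cod_arr] at h
    exact h)

lemma mapNatTrans_comp (α : F ⟶ G) (β : G ⟶ H) :
    E.mapNatTrans (α ≫ β) = E.mapNatTrans α ≫ E.mapNatTrans β := by
  ext X
  exact Cat.hom_ext (E.nat_comp α β X.pt)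

lemma mapNatTrans_zero_app [Preadditive D] (X : E.Cat C) :
    (E.mapNatTrans (0 : F ⟶ G)).app X = 0 := by
  refine Cat.hom_ext ?_
  rw [Cat.arr_zero]
  exact E.nat_zero X.pt

end NatTrans

section Restriction

variable (A : Type v) [Category.{w} A] [Abelian A] [SmallCat S A] [Infinite S]

/-- The functor that restricts a `*`-complex, which is indexed by `*ℤ`, to `ℤ ⊆ *ℤ`. -/
noncomputable def restriction : E.Cat (CochainComplex A ℤ) ⥤ CochainComplex (E.Cat A) ℤ where
  obj K :=
    { X := fun i => (E.mapFunctor (HomologicalComplex.eval A _ i)).obj K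
      d := fun i j => (E.mapNatTrans (HomologicalComplex.dNatTrans A _ i j)).app K
      shape := fun i j h => by
        have h' : HomologicalComplex.dNatTrans A (ComplexShape.up ℤ) i j = 0 := by
          ext K
          exact K.shape i j h
        rw [h', mapNatTrans_zero_app]
      d_comp_d' := fun i j k _ _ => by
        have h' : HomologicalComplex.dNatTrans A (ComplexShape.up ℤ) i j ≫
            HomologicalComplex.dNatTrans A _ j k = 0 := by
          ext K
          exact K.d_comp_d i j k
        rw [← NatTrans.comp_app, ← mapNatTrans_comp, h', mapNatTrans_zero_app] }
  map φ :=
    { f := fun i => (E.mapFunctor (HomologicalComplex.eval A _ i)).map φ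
      comm' := fun i j _ =>
        (E.mapNatTrans (HomologicalComplex.dNatTrans A _ i j)).naturality φ }
  map_id K := by ext i; exact (E.mapFunctor (HomologicalComplex.eval A _ i)).map_id K
  map_comp φ ψ := by ext i; exact (E.mapFunctor (HomologicalComplex.eval A _ i)).map_comp φ ψ

variable {A} in
/-- `res : *D(A) ⥤ D(*A)` is induced by the restriction of `*`-complexes to `ℤ`. -/
def IsInducedByRestriction (res : E.Cat (DerivedCategory A) ⥤ DerivedCategory (E.Cat A)) : Prop :=
  Nonempty (E.mapFunctor (DerivedCategory.Q (C := A)) ⋙ res ≅ E.restriction A ⋙ DerivedCategory.Q)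

end Restriction

end Enlargement

/-! ### The bounded derived category and its counterpart in the enlargement -/

section Bounded

variable (B : Type v) [Category.{w} B] [Abelian B]

/-- The complexes whose cohomology vanishes outside of an interval `[-i, i]`. -/
def bounded : ObjectProperty (DerivedCategory B) := fun X =>
  ∃ i : ℕ, ∀ j : ℤ, (i : ℤ) < |j| → IsZero ((DerivedCategory.homologyFunctor B j).obj X)

lemma bounded_eq : bounded B = DerivedCategory.TStructure.t.bounded := by
  ext X
  constructor
  · rintro ⟨i, hi⟩
    refine ⟨⟨-i, (DerivedCategory.isGE_iff X _).2 fun j hj => hi j ?_⟩,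
      ⟨i, (DerivedCategory.isLE_iff X _).2 fun j hj => hi j ?_⟩⟩
    · exact lt_abs.2 (Or.inr (by omega))
    · exact lt_abs.2 (Or.inl (by omega))
  · rintro ⟨⟨a, ha⟩, ⟨b, hb⟩⟩
    refine ⟨a.natAbs + b.natAbs, fun j hj => ?_⟩
    rcases lt_abs.1 hj with hj | hj
    · exact (DerivedCategory.isLE_iff X b).1 hb j (by omega)
    · exact (DerivedCategory.isGE_iff X a).1 ha j (by omega)

instance : (bounded B).IsTriangulated := by
  rw [bounded_eq]; infer_instance

/-- The bounded derived category, with its structure of a triangulated category. -/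
abbrev BoundedDerivedCategory := (bounded B).FullSubcategory

end Bounded

namespace Enlargement

variable {S W : Type u} [Infinite S] (E : Enlargement S W)
variable {A : Type v} [Category.{w} A] [Abelian A] [SmallCat S A]

/-- The cohomology `*hʲ(X)` of an object of `*D(A)`, for `j ∈ *ℤ`. -/
noncomputable def cohomology (X : E.Cat (DerivedCategory A)) (j : E.Star ℤ) : E.Cat A :=
  ⟨E.starFun₂ (fun (X : DerivedCategory A) (j : ℤ) =>
    (DerivedCategory.homologyFunctor A j).obj X) X.pt j⟩

/-- The objects of `*D(A)` for which there is a standard natural number `i` such that the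
cohomology vanishes in all degrees `j ∈ *ℤ` with `|j| > i`. -/
def finitelyBounded : ObjectProperty (E.Cat (DerivedCategory A)) := fun X =>
  ∃ i : ℕ, ∀ j : E.Star ℤ,
    E.StarRel (fun a b : ℤ => a < b) (E.std (i : ℤ)) (E.starFun (fun n : ℤ => |n|) j) →
      IsZero (E.cohomology X j)

/-- The translation functor `*Σ` of `*D(A)`. -/
noncomputable def shift : E.Cat (DerivedCategory A) ⥤ E.Cat (DerivedCategory A) :=
  E.mapFunctor (shiftFunctor (DerivedCategory A) (1 : ℤ))

/-- The distinguished triangles `*Δ` of `*D(A)`: the elements of the enlargement of the set of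
the triples of morphisms that form a distinguished triangle of `D(A)`. -/
def Distinguished {X Y Z : E.Cat (DerivedCategory A)} (f : X ⟶ Y) (g : Y ⟶ Z)
    (h : Z ⟶ E.shift.obj X) : Prop :=
  E.StarPred (fun p : Arrow (DerivedCategory A) × Arrow (DerivedCategory A) ×
      Arrow (DerivedCategory A) => ∃ T ∈ Pretriangulated.distinguishedTriangles,
        p = (Arrow.mk T.mor₁, Arrow.mk T.mor₂, Arrow.mk T.mor₃))
    (E.pair (Cat.arr f) (E.pair (Cat.arr g) (Cat.arr h)))

/-- A class of objects of `*D(A)` that is (the class of objects of) a full and replete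
triangulated subcategory. -/
structure IsTriangulatedSubcategory (P : ObjectProperty (E.Cat (DerivedCategory A))) : Prop where
  zero : ∃ X, P X ∧ IsZero X
  iso {X Y : E.Cat (DerivedCategory A)} (e : X ≅ Y) (h : P X) : P Y
  shift_iff (X : E.Cat (DerivedCategory A)) : P (E.shift.obj X) ↔ P X
  ext₁ {X Y Z : E.Cat (DerivedCategory A)} (f : X ⟶ Y) (g : Y ⟶ Z) (h : Z ⟶ E.shift.obj X)
    (hT : E.Distinguished f g h) (hY : P Y) (hZ : P Z) : P X
  ext₂ {X Y Z : E.Cat (DerivedCategory A)} (f : X ⟶ Y) (g : Y ⟶ Z) (h : Z ⟶ E.shift.obj X)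
    (hT : E.Distinguished f g h) (hX : P X) (hZ : P Z) : P Y
  ext₃ {X Y Z : E.Cat (DerivedCategory A)} (f : X ⟶ Y) (g : Y ⟶ Z) (h : Z ⟶ E.shift.obj X)
    (hT : E.Distinguished f g h) (hX : P X) (hY : P Y) : P Z

/-- A functor `Φ : D^b(*A) ⥤ *D(A)` is triangulated: it commutes with the translation functors,
and it preserves and detects the distinguished triangles. -/
def IsTriangulatedFunctor (Φ : BoundedDerivedCategory (E.Cat A) ⥤ E.Cat (DerivedCategory A)) :
    Prop :=
  ∃ η : shiftFunctor (BoundedDerivedCategory (E.Cat A)) (1 : ℤ) ⋙ Φ ≅ Φ ⋙ E.shift,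
    ∀ T : Pretriangulated.Triangle (BoundedDerivedCategory (E.Cat A)),
      T ∈ Pretriangulated.distinguishedTriangles ↔
        E.Distinguished (Φ.map T.mor₁) (Φ.map T.mor₂) (Φ.map T.mor₃ ≫ η.hom.app T.obj₁)

end Enlargement

end Enlarging

attribute [local instance] HasDerivedCategory.standard

open Enlarging

/-! The functor `res` comes from the universal property of a localization. It becomes an equivalence
on bounded objects because it is bijective on morphisms between shifts of objects of the hearts, and
because bounded objects are built from such shifts in a standard finite number of steps.

Existence and uniqueness of `res`. The universal property of a localization quantifies over all
categories, so it does not transfer as it stands. However, `D(A)` has two properties that speak of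
finitely many morphisms only: every morphism is a right fraction, and two morphisms of complexes
with equal image become equal after a quasi-isomorphism and a homotopy, which a cylinder encodes.
Both transfer to `*Q`, and `isLocalization_of_exists_fraction` shows that they force `*Q` to be a
localization in the external sense. Kernels and cokernels also transfer, so the internal cohomology
in a standard degree is the cohomology of the restricted complex. Hence restriction sends the
morphisms inverted by `*Q` to quasi-isomorphisms (`quasiIso_restriction_map`).

`res` is triangulated. The axioms of a pretriangulated category transfer one by one to `*D(A)`. A
distinguished triangle there is isomorphic to that of an internal mapping cone; rotated, the latter
is an extension of complexes that splits in each degree. Restriction works degree by degree, so it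
preserves the splittings and the connecting morphism.

`res` is fully faithful on bounded objects. Both `*D(A)` and `D(*A)` contain `*A` as a full
subcategory, and `res` respects these embeddings. Between objects of `*A`, morphisms of negative
degree vanish and morphisms of positive standard degree are killed by an epimorphism onto the
source; an induction on the degree gives bijectivity (`bijOn_res_heart`). Five-lemma arguments in
each variable extend this to all objects generated by the hearts (`bijOn_of_generators`). Truncation
triangles exhibit a bounded object as an iterated extension of shifts of objects of the heart. The
length of this filtration is at most the width of the cohomological range, so for a standard bound
an ordinary induction applies in `*D(A)` too.

Essential surjectivity onto `D^b(*A)` follows since the essential image is a triangulated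
subcategory containing the heart. The functor `Φ` is a quasi-inverse followed by the inclusion.

Transfer is mostly organized by `IsMember`: a morphism of `*C` is presented as the member, at some
index in `*G`, of the enlargement of a family of morphisms of `C`. An identity between families over
`G` then gives the identity between their members. -/

namespace Enlarging

namespace Enlargement

variable {S W : Type u} (E : Enlargement S W)

/-! ### Members of enlarged families, and enlargements of functors and natural isomorphisms -/

section Constants

variable {X : Type*} {Y : Type*} {Z : Type*} [Coded S X] [Coded S Y] [Coded S Z]

@[simp] lemma starFun_const (y : Y) (x : E.Star X) : E.starFun (fun _ : X => y) x = E.std y := by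
  refine ((E.starRel_starFun (fun _ : X => y) x _).1 ?_).symm
  refine (E.starPred_comp (fun y' : Y => y' = y) (fun p : X × Y => p.2) _).2 ?_
  rw [E.starFun_snd]
  exact (E.starPred_std _ _).2 rfl

lemma starFun₂_std (f : X → Y → Z) (x : E.Star X) (y : Y) :
    E.starFun₂ f x (E.std y) = E.starFun (fun x => f x y) x := by
  rw [E.starFun_comp₂ f (fun x => x) (fun _ => y), starFun_id, starFun_const]

end Constants

section Families

variable {E} {C : Type v} [Category.{w} C] [SmallCat S C]
  {D : Type v'} [Category.{w'} D] [SmallCat S D]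
  {G : Type*} [Coded S G] {x : E.Star G}

/-- A morphism of `*C` is the member with index `x ∈ *G` of the enlargement of a family of
morphisms of `C` indexed by `G`. -/
def IsMember (x : E.Star G) {X Y : E.Cat C} (f : X ⟶ Y) {a b : G → C} (φ : ∀ t, a t ⟶ b t) : Prop :=
  Cat.arr f = E.starFun (fun t => Arrow.mk (φ t)) x

namespace IsMember

variable {X Y Z : E.Cat C} {a b c a' b' : G → C}

lemma source {f : X ⟶ Y} {φ : ∀ t, a t ⟶ b t} (h : IsMember x f φ) : X.pt = E.starFun a x := by
  rw [← Cat.dom_arr f, show Cat.arr f = _ from h, ← starFun_dom]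
  rfl

lemma target {f : X ⟶ Y} {φ : ∀ t, a t ⟶ b t} (h : IsMember x f φ) : Y.pt = E.starFun b x := by
  rw [← Cat.cod_arr f, show Cat.arr f = _ from h, ← starFun_cod]
  rfl

lemma id (hX : X.pt = E.starFun a x) : IsMember x (𝟙 X) (fun t => 𝟙 (a t)) := by
  rw [IsMember, Cat.arr_id, hX, ← starFun_ident]
  rfl

lemma comp {f : X ⟶ Y} {g : Y ⟶ Z} {φ : ∀ t, a t ⟶ b t} {ψ : ∀ t, b t ⟶ c t}
    (hf : IsMember x f φ) (hg : IsMember x g ψ) : IsMember x (f ≫ g) (fun t => φ t ≫ ψ t) := by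
  rw [IsMember] at *
  rw [Cat.arr_comp, hf, hg, ← starFun_comp']
  exact E.starFun_congr (fun t => Mor.comp_mk _ _) x

lemma map (F : C ⥤ D) {f : X ⟶ Y} {φ : ∀ t, a t ⟶ b t} (hf : IsMember x f φ) :
    IsMember x ((E.mapFunctor F).map f) (fun t => F.map (φ t)) := by
  change E.mapArr F (Cat.arr f) = _
  rw [show Cat.arr f = _ from hf, ← starFun_map]
  rfl

lemma congr {f : X ⟶ Y} {φ : ∀ t, a t ⟶ b t} {φ' : ∀ t, a' t ⟶ b' t} (hf : IsMember x f φ)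
    (h : ∀ t, Arrow.mk (φ t) = Arrow.mk (φ' t)) : IsMember x f φ' :=
  hf.trans (E.starFun_congr h x)

/-- Transfer in the form used below: an equation in `*C` at an arbitrary index follows from the
equation in `C` at every `t : G`. Comparing arrows rather than morphisms allows the two families to
have sources and targets that agree only up to a propositional equality. -/
lemma eq {f g : X ⟶ Y} {φ : ∀ t, a t ⟶ b t} {φ' : ∀ t, a' t ⟶ b' t} (hf : IsMember x f φ)
    (hg : IsMember x g φ') (h : ∀ t, Arrow.mk (φ t) = Arrow.mk (φ' t)) : f = g :=
  Cat.hom_ext ((hf.congr h).trans hg.symm)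

lemma eqToHom (h : X = Y) (hX : X.pt = E.starFun a x) (hab : a = b) :
    IsMember x (eqToHom h) (fun t => CategoryTheory.eqToHom (congr_fun hab t)) := by
  subst h hab
  exact IsMember.id hX

/-- Members can only be composed or compared over one index. This changes the index, for instance
from the source of a morphism to the morphism itself. -/
lemma reindex {G' : Type*} [Coded S G'] {y : E.Star G'} (r : G' → G) (hx : x = E.starFun r y)
    {f : X ⟶ Y} {φ : ∀ t, a t ⟶ b t} (hf : IsMember x f φ) : IsMember y f (fun t => φ (r t)) := by
  rw [IsMember, show Cat.arr f = _ from hf, hx]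
  exact (E.starFun_comp (fun t => Arrow.mk (φ t)) r y).symm

lemma homMk (φ : ∀ t, a t ⟶ b t) (h : E.dom _ = X.pt) (h' : E.cod _ = Y.pt) :
    IsMember x (Cat.homMk (X := X) (Y := Y) (E.starFun (fun t => Arrow.mk (φ t)) x) h h') φ := rfl

section Preadditive

variable [Preadditive C]

lemma zero (hX : X.pt = E.starFun a x) (hY : Y.pt = E.starFun b x) :
    IsMember x (0 : X ⟶ Y) (fun t => (0 : a t ⟶ b t)) := by
  rw [IsMember, Cat.arr_zero, hX, hY, ← starFun_zero]
  rfl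

lemma add {f g : X ⟶ Y} {φ ψ : ∀ t, a t ⟶ b t} (hf : IsMember x f φ) (hg : IsMember x g ψ) :
    IsMember x (f + g) (fun t => φ t + ψ t) := by
  rw [IsMember] at *
  rw [Cat.arr_add, hf, hg, ← starFun_add]
  exact E.starFun_congr (fun t => Mor.add_mk _ _) x

lemma neg {f : X ⟶ Y} {φ : ∀ t, a t ⟶ b t} (hf : IsMember x f φ) :
    IsMember x (-f) (fun t => -φ t) := by
  rw [IsMember, Cat.arr_neg, show Cat.arr f = _ from hf, ← starFun_neg]
  rfl

end Preadditive

end IsMember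

/-- The member with index `x ∈ *G` of the enlargement of a family of morphisms. -/
noncomputable def member (x : E.Star G) {a b : G → C} (φ : ∀ t, a t ⟶ b t) :
    (⟨E.starFun a x⟩ : E.Cat C) ⟶ ⟨E.starFun b x⟩ :=
  Cat.homMk (E.starFun (fun t => Arrow.mk (φ t)) x) (by rw [← starFun_dom]; rfl)
    (by rw [← starFun_cod]; rfl)

/-- The member with index `x ∈ *G` of the enlargement of a family of isomorphisms, between objects
that are the members of the families of sources and targets. -/
noncomputable def memberIso (x : E.Star G) {a b : G → C} (e : ∀ t, a t ≅ b t) {X Y : E.Cat C}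
    (hX : X.pt = E.starFun a x) (hY : Y.pt = E.starFun b x) : X ≅ Y where
  hom := Cat.homMk (E.starFun (fun t => Arrow.mk (e t).hom) x)
    (by rw [hX, ← starFun_dom]; rfl) (by rw [hY, ← starFun_cod]; rfl)
  inv := Cat.homMk (E.starFun (fun t => Arrow.mk (e t).inv) x)
    (by rw [hY, ← starFun_dom]; rfl) (by rw [hX, ← starFun_cod]; rfl)
  hom_inv_id := ((IsMember.homMk _ _ _).comp (IsMember.homMk _ _ _)).eq (.id hX) (by simp)
  inv_hom_id := ((IsMember.homMk _ _ _).comp (IsMember.homMk _ _ _)).eq (.id hY) (by simp)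

lemma isMember_memberIso_hom (x : E.Star G) {a b : G → C} (e : ∀ t, a t ≅ b t) {X Y : E.Cat C}
    (hX : X.pt = E.starFun a x) (hY : Y.pt = E.starFun b x) :
    IsMember x (memberIso x e hX hY).hom (fun t => (e t).hom) := rfl

/-- The tautological family, indexed by all morphisms of `C`: naturality statements about an
arbitrary `f` in `*C` start from it. -/
lemma IsMember.self {X Y : E.Cat C} (f : X ⟶ Y) : IsMember (Cat.arr f) f (fun t : Arrow C => t.hom) :=
  (E.starFun_id _).symm

end Families

section Functors

variable {C : Type*} [Category* C] [SmallCat S C] {D : Type*} [Category* D] [SmallCat S D]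
  {D' : Type*} [Category* D'] [SmallCat S D']

variable {E} in
lemma Cat.pt_eq (X : E.Cat C) : X.pt = E.starFun (fun t : C => t) X.pt := (E.starFun_id _).symm

variable {E} in
/-- A natural isomorphism between functors defined on `*C` whose components are the members of the
enlargement of a natural family of isomorphisms. -/
noncomputable def natIsoOfMembers {F F' : E.Cat C ⥤ E.Cat D} {a b : C ⥤ D} (e : a ≅ b)
    (hF : ∀ X, (F.obj X).pt = E.starFun a.obj X.pt)
    (hF' : ∀ X, (F'.obj X).pt = E.starFun b.obj X.pt)
    (hf : ∀ {X Y : E.Cat C} (f : X ⟶ Y), IsMember (Cat.arr f) (F.map f) (fun t => a.map t.hom))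
    (hf' : ∀ {X Y : E.Cat C} (f : X ⟶ Y), IsMember (Cat.arr f) (F'.map f) (fun t => b.map t.hom)) :
    F ≅ F' :=
  NatIso.ofComponents (fun X => memberIso X.pt (fun t => e.app t) (hF X) (hF' X))
    (fun {X Y} f => ((hf f).comp ((isMember_memberIso_hom Y.pt (fun t => e.app t) _ _).reindex
      (fun t : Arrow C => t.right) (IsMember.self f).target)).eq
      (((isMember_memberIso_hom X.pt (fun t => e.app t) _ _).reindex
      (fun t : Arrow C => t.left) (IsMember.self f).source).comp (hf' f)) (by simp))

variable {E} in
lemma isMember_natIsoOfMembers_hom_app {F F' : E.Cat C ⥤ E.Cat D} {a b : C ⥤ D} (e : a ≅ b)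
    (hF : ∀ X, (F.obj X).pt = E.starFun a.obj X.pt)
    (hF' : ∀ X, (F'.obj X).pt = E.starFun b.obj X.pt)
    (hf : ∀ {X Y : E.Cat C} (f : X ⟶ Y), IsMember (Cat.arr f) (F.map f) (fun t => a.map t.hom))
    (hf' : ∀ {X Y : E.Cat C} (f : X ⟶ Y), IsMember (Cat.arr f) (F'.map f) (fun t => b.map t.hom))
    (X : E.Cat C) :
    IsMember X.pt ((natIsoOfMembers e hF hF' hf hf').hom.app X) (fun t => e.hom.app t) := rfl

variable {E} in
lemma isMember_natIsoOfMembers_inv_app {F F' : E.Cat C ⥤ E.Cat D} {a b : C ⥤ D} (e : a ≅ b)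
    (hF : ∀ X, (F.obj X).pt = E.starFun a.obj X.pt)
    (hF' : ∀ X, (F'.obj X).pt = E.starFun b.obj X.pt)
    (hf : ∀ {X Y : E.Cat C} (f : X ⟶ Y), IsMember (Cat.arr f) (F.map f) (fun t => a.map t.hom))
    (hf' : ∀ {X Y : E.Cat C} (f : X ⟶ Y), IsMember (Cat.arr f) (F'.map f) (fun t => b.map t.hom))
    (X : E.Cat C) :
    IsMember X.pt ((natIsoOfMembers e hF hF' hf hf').inv.app X) (fun t => e.inv.app t) := rfl

instance [Preadditive C] [Preadditive D] (F : C ⥤ D) [F.Additive] : (E.mapFunctor F).Additive where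
  map_add {X Y f g} := by
    have h : ∀ f g : E.Star (Arrow C), E.dom g = E.dom f → E.cod g = E.cod f →
        E.mapArr F (E.add f g) = E.add (E.mapArr F f) (E.mapArr F g) := by
      intro f g h h'
      have := E.transfer_forall (P := fun f : Arrow C => ∀ g : Arrow C, Mor.dom g = Mor.dom f →
        Mor.cod g = Mor.cod f → Mor.map F (Mor.add f g) = Mor.add (Mor.map F f) (Mor.map F g)) (by
          intro f g h h'
          obtain ⟨X, Y, f, rfl⟩ := Mor.exists_mk f
          obtain ⟨g, rfl⟩ := Mor.exists_mk_of (X := X) (Y := Y) h h'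
          simp only [Mor.add_mk, Mor.map_mk, Functor.map_add]) f
      simp at this
      exact this g h h'
    exact Cat.hom_ext (h (Cat.arr f) (Cat.arr g) (by simp) (by simp))

/-- Fullness, faithfulness and, further below, essential surjectivity are statements about single
objects and morphisms, so they transfer. They are needed for the embedding of the heart and for
`*Q`. -/
instance (F : C ⥤ D) [F.Full] : (E.mapFunctor F).Full where
  map_surjective {X Y} g := by
    have := E.transfer_forall (P := fun X : C => ∀ (Y : C) (g : Arrow D), Mor.dom g = F.obj X →
      Mor.cod g = F.obj Y → ∃ f : Arrow C, Mor.dom f = X ∧ Mor.cod f = Y ∧ Mor.map F f = g) (by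
        intro X Y g h h'
        obtain ⟨g, rfl⟩ := Mor.exists_mk_of h h'
        exact ⟨Arrow.mk (F.preimage g), rfl, rfl, by rw [Mor.map_mk, F.map_preimage]⟩) X.pt
    simp at this
    obtain ⟨f, h1, h2, h3⟩ := this Y.pt (Cat.arr g) (Cat.dom_arr g) (Cat.cod_arr g)
    exact ⟨Cat.homMk f h1 h2, Cat.hom_ext h3⟩

instance (F : C ⥤ D) [F.Faithful] : (E.mapFunctor F).Faithful where
  map_injective {X Y} f g h := by
    have := E.transfer_forall (P := fun f : Arrow C => ∀ g : Arrow C, Mor.dom f = Mor.dom g →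
      Mor.cod f = Mor.cod g → Mor.map F f = Mor.map F g → f = g) (by
        intro f g h h' h''
        obtain ⟨X, Y, g, rfl⟩ := Mor.exists_mk g
        obtain ⟨f, rfl⟩ := Mor.exists_mk_of (X := X) (Y := Y) h h'
        exact Mor.mk_inj.2 (F.map_injective (Mor.mk_inj.1 h''))) (Cat.arr f)
    simp at this
    exact Cat.hom_ext (this (Cat.arr g) (by simp) (by simp) (congr_arg Cat.arr h))

lemma isMember_mapFunctor_map (F : C ⥤ D) {X Y : E.Cat C} (f : X ⟶ Y) :
    IsMember (Cat.arr f) ((E.mapFunctor F).map f) (fun t => F.map t.hom) :=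
  (IsMember.self f).map F

/-- The enlargement of a natural isomorphism. -/
noncomputable def mapNatIso {F F' : C ⥤ D} (e : F ≅ F') : E.mapFunctor F ≅ E.mapFunctor F' :=
  natIsoOfMembers e (fun _ => rfl) (fun _ => rfl) (E.isMember_mapFunctor_map F)
    (E.isMember_mapFunctor_map F')

/-- The enlargement of an identity functor. -/
noncomputable def mapIdIso : E.mapFunctor (𝟭 C) ≅ 𝟭 (E.Cat C) :=
  natIsoOfMembers (Iso.refl (𝟭 C)) (fun _ => rfl) (fun X => X.pt_eq) (E.isMember_mapFunctor_map _)
    IsMember.self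

/-- The enlargement of a composite of functors. -/
noncomputable def mapCompIso (F : C ⥤ D) (F' : D ⥤ D') :
    E.mapFunctor (F ⋙ F') ≅ E.mapFunctor F ⋙ E.mapFunctor F' :=
  natIsoOfMembers (Iso.refl (F ⋙ F')) (fun _ => rfl)
    (fun X => (E.starFun_comp F'.obj F.obj X.pt).symm) (E.isMember_mapFunctor_map _)
    (fun f => (E.isMember_mapFunctor_map F f).map F')

end Functors

end Enlargement

/-! ### Shifts on `*C` and functors commuting with them -/

namespace Enlargement

variable {S W : Type u} (E : Enlargement S W)

section Shift

variable (C : Type*) [Category* C] [SmallCat S C] (M : Type*) [AddMonoid M] [HasShift C M]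

/-- The shift functors of `*C` are the enlargements of those of `C`. -/
noncomputable def shiftMkCore : ShiftMkCore (E.Cat C) M where
  F n := E.mapFunctor (shiftFunctor C n)
  zero := natIsoOfMembers (shiftFunctorZero C M) (fun _ => rfl) (fun X => X.pt_eq)
    (E.isMember_mapFunctor_map _) IsMember.self
  add n m := natIsoOfMembers (shiftFunctorAdd C n m) (fun _ => rfl)
    (fun X => (E.starFun_comp (shiftFunctor C m).obj (shiftFunctor C n).obj X.pt).symm)
    (E.isMember_mapFunctor_map _) (fun f => (E.isMember_mapFunctor_map _ f).map _)
  assoc_hom_app m₁ m₂ m₃ X := by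
    -- Both sides of a coherence identity are members, indexed by `X`, of families of morphisms of
    -- `C`, so the coherence of the shift on `C` implies that on `*C`. The same pattern proves the
    -- two unit identities.
    refine ((isMember_natIsoOfMembers_hom_app ..).comp
      ((isMember_natIsoOfMembers_hom_app (shiftFunctorAdd C m₁ m₂) ..).map _)).eq
      ((IsMember.eqToHom (a := (shiftFunctor C (m₁ + m₂ + m₃)).obj) _ rfl (by rw [_root_.add_assoc])).comp
      ((isMember_natIsoOfMembers_hom_app ..).comp
      ((isMember_natIsoOfMembers_hom_app (shiftFunctorAdd C m₂ m₃) ..).reindex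
      (shiftFunctor C m₁).obj rfl))) (fun t => congr_arg Arrow.mk ?_)
    simpa [shiftFunctorAdd'] using shiftFunctorAdd_assoc_hom_app m₁ m₂ m₃ t
  zero_add_hom_app n X := by
    refine (isMember_natIsoOfMembers_hom_app ..).eq
      ((IsMember.eqToHom (a := (shiftFunctor C (0 + n)).obj) _ rfl (by rw [_root_.zero_add]; rfl)).comp
      ((isMember_natIsoOfMembers_inv_app (shiftFunctorZero C M) ..).map _))
      (fun t => congr_arg Arrow.mk ?_)
    rw [shiftFunctorAdd_zero_add_hom_app]
  add_zero_hom_app n X := by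
    refine (isMember_natIsoOfMembers_hom_app ..).eq
      ((IsMember.eqToHom (a := (shiftFunctor C (n + 0)).obj) _ rfl (by rw [_root_.add_zero]; rfl)).comp
      ((isMember_natIsoOfMembers_inv_app (shiftFunctorZero C M) ..).reindex
      (shiftFunctor C n).obj rfl))
      (fun t => congr_arg Arrow.mk ?_)
    rw [shiftFunctorAdd_add_zero_hom_app]

noncomputable instance : HasShift (E.Cat C) M := hasShiftMk _ _ (E.shiftMkCore C M)

variable {C M}

instance [Preadditive C] [∀ n : M, (shiftFunctor C n).Additive] (n : M) :
    (shiftFunctor (E.Cat C) n).Additive :=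
  inferInstanceAs (E.mapFunctor (shiftFunctor C n)).Additive

lemma isMember_shiftFunctorZero_hom_app (X : E.Cat C) :
    IsMember X.pt ((shiftFunctorZero (E.Cat C) M).hom.app X)
      (fun t => (shiftFunctorZero C M).hom.app t) := by
  rw [ShiftMkCore.shiftFunctorZero_eq]
  rfl

lemma isMember_shiftFunctorZero_inv_app (X : E.Cat C) :
    IsMember X.pt ((shiftFunctorZero (E.Cat C) M).inv.app X)
      (fun t => (shiftFunctorZero C M).inv.app t) := by
  rw [ShiftMkCore.shiftFunctorZero_eq]
  rfl

lemma isMember_shiftFunctorAdd_hom_app (n m : M) (X : E.Cat C) :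
    IsMember X.pt ((shiftFunctorAdd (E.Cat C) n m).hom.app X)
      (fun t => (shiftFunctorAdd C n m).hom.app t) := by
  rw [ShiftMkCore.shiftFunctorAdd_eq]
  rfl

lemma isMember_shiftFunctorAdd_inv_app (n m : M) (X : E.Cat C) :
    IsMember X.pt ((shiftFunctorAdd (E.Cat C) n m).inv.app X)
      (fun t => (shiftFunctorAdd C n m).inv.app t) := by
  rw [ShiftMkCore.shiftFunctorAdd_eq]
  rfl

variable {D : Type*} [Category* D] [SmallCat S D] [HasShift D M] (F : C ⥤ D) [F.CommShift M]

/-- The enlargement of the compatibility of a functor with shifts. -/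
noncomputable def commShiftIso₀ (n : M) :
    shiftFunctor (E.Cat C) n ⋙ E.mapFunctor F ≅ E.mapFunctor F ⋙ shiftFunctor (E.Cat D) n :=
  natIsoOfMembers (F.commShiftIso n)
    (fun X => (E.starFun_comp F.obj (shiftFunctor C n).obj X.pt).symm)
    (fun X => (E.starFun_comp (shiftFunctor D n).obj F.obj X.pt).symm)
    (fun f => (E.isMember_mapFunctor_map (shiftFunctor C n) f).map F)
    (fun f => (E.isMember_mapFunctor_map F f).map (shiftFunctor D n))

lemma isMember_commShiftIso₀_hom_app (n : M) (X : E.Cat C) :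
    IsMember X.pt ((E.commShiftIso₀ F n).hom.app X) (fun t => (F.commShiftIso n).hom.app t) := rfl

noncomputable instance : (E.mapFunctor F).CommShift M where
  commShiftIso n := E.commShiftIso₀ F n
  commShiftIso_zero := by
    ext X
    rw [Functor.CommShift.isoZero_hom_app]
    have h₁ := (E.isMember_shiftFunctorZero_hom_app (M := M) X).map F
    have h₂ : IsMember X.pt ((shiftFunctorZero (E.Cat D) M).inv.app ((E.mapFunctor F).obj X))
        (fun t => (shiftFunctorZero D M).inv.app (F.obj t)) :=
      (E.isMember_shiftFunctorZero_inv_app ((E.mapFunctor F).obj X)).reindex F.obj rfl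
    refine (isMember_commShiftIso₀_hom_app E F 0 X).eq (h₁.comp h₂) (fun t => congr_arg Arrow.mk ?_)
    rw [F.commShiftIso_zero, Functor.CommShift.isoZero_hom_app]
  commShiftIso_add n m := by
    ext X
    rw [Functor.CommShift.isoAdd_hom_app]
    have h₁ := (E.isMember_shiftFunctorAdd_hom_app n m X).map F
    have h₂ : IsMember X.pt ((commShiftIso₀ E F m).hom.app ((shiftFunctor (E.Cat C) n).obj X))
        (fun t => (F.commShiftIso m).hom.app ((shiftFunctor C n).obj t)) :=
      (isMember_commShiftIso₀_hom_app E F m _).reindex (shiftFunctor C n).obj rfl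
    have h₃ := (isMember_commShiftIso₀_hom_app E F n X).map (shiftFunctor D m)
    have h₄ : IsMember X.pt ((shiftFunctorAdd (E.Cat D) n m).inv.app ((E.mapFunctor F).obj X))
        (fun t => (shiftFunctorAdd D n m).inv.app (F.obj t)) :=
      (E.isMember_shiftFunctorAdd_inv_app n m ((E.mapFunctor F).obj X)).reindex F.obj rfl
    refine (isMember_commShiftIso₀_hom_app E F (n + m) X).eq (h₁.comp (h₂.comp (h₃.comp h₄)))
      (fun t => congr_arg Arrow.mk ?_)
    rw [F.commShiftIso_add, Functor.CommShift.isoAdd_hom_app]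

lemma isMember_commShiftIso_hom_app (n : M) (X : E.Cat C) :
    IsMember X.pt (((E.mapFunctor F).commShiftIso n).hom.app X)
      (fun t => (F.commShiftIso n).hom.app t) := rfl

end Shift

end Enlargement

/-! ### A criterion for a functor to be a localization, in terms of single morphisms -/

section Localization

variable {C : Type*} [Category* C] {D : Type*} [Category* D]

/-- Two parallel morphisms become equal in every localization of `C` that inverts the morphisms
which `L` inverts, as they are identified by a cylinder. -/
def IdentifiedByCylinder (L : C ⥤ D) {X Y : C} (f g : X ⟶ Y) : Prop :=
  ∃ (Z T : C) (w : Z ⟶ X) (i j : Z ⟶ T) (p : T ⟶ Z) (h : T ⟶ Y), IsIso (L.map w) ∧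
    IsIso (L.map p) ∧ i ≫ p = 𝟙 Z ∧ j ≫ p = 𝟙 Z ∧ i ≫ h = w ≫ f ∧ j ≫ h = w ≫ g

variable {L : C ⥤ D}

/-- Both `i` and `j` are sections of `p`, so inverting `p` identifies them. Then `w ≫ f` and `w ≫ g`
agree, and inverting `w` leaves `f` and `g` equal. -/
lemma IdentifiedByCylinder.map_eq {X Y : C} {f g : X ⟶ Y} (h : IdentifiedByCylinder L f g)
    {B : Type*} [Category* B] (F : C ⥤ B)
    (hF : ((MorphismProperty.isomorphisms D).inverseImage L).IsInvertedBy F) :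
    F.map f = F.map g := by
  obtain ⟨Z, T, w, i, j, p, h, hw, hp, hi, hj, hf, hg⟩ := h
  have := hF w hw
  have := hF p hp
  have hij : F.map i = F.map j := by
    rw [← cancel_mono (F.map p), ← F.map_comp, ← F.map_comp, hi, hj]
  rw [← cancel_epi (F.map w), ← F.map_comp, ← F.map_comp, ← hf, ← hg, F.map_comp, F.map_comp, hij]

/-- A functor is a localization if its target consists of fractions and if it only identifies the
morphisms that it has to identify. -/
lemma isLocalization_of_exists_fraction [L.EssSurj]
    (hL : ∀ ⦃X Y : C⦄ (f : L.obj X ⟶ L.obj Y), ∃ (X' : C) (s : X' ⟶ X) (_ : IsIso (L.map s))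
      (g : X' ⟶ Y), L.map s ≫ f = L.map g)
    (hL' : ∀ ⦃X Y : C⦄ (f g : X ⟶ Y), L.map f = L.map g → IdentifiedByCylinder L f g) :
    L.IsLocalization ((MorphismProperty.isomorphisms D).inverseImage L) := by
  let W := (MorphismProperty.isomorphisms D).inverseImage L
  have hW : W.IsInvertedBy L := fun _ _ _ h => h
  have hQ : ∀ {X Y : C} {f g : X ⟶ Y}, L.map f = L.map g → W.Q.map f = W.Q.map g :=
    fun h => (hL' _ _ h).map_eq _ W.Q_inverts
  -- The comparison functor from the constructed localization to `D`; the claim is that it is an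
  -- equivalence.
  let G := Localization.Construction.lift L hW
  have hG : ∀ {X Y : C} (f : X ⟶ Y), G.map (W.Q.map f) = L.map f := fun f =>
    (Functor.congr_hom (Localization.Construction.fac L hW) f).trans
      ((Category.id_comp _).trans (Category.comp_id _))
  have hQ' : ∀ {X Y : C} (f : X ⟶ Y) (_ : IsIso (L.map f)), IsIso (W.Q.map f) :=
    fun f hf => W.Q_inverts f hf
  have hobj : ∀ A : W.Localization, ∃ X, A = W.Q.obj X :=
    fun A => ⟨_, ((Localization.Construction.objEquiv W).right_inv A).symm⟩
  -- The morphisms of the constructed localization that are right fractions. An object of the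
  -- localization is only propositionally the image of an object of `C`, so the property quantifies
  -- over all such presentations.
  let P : MorphismProperty W.Localization := fun A B φ =>
    ∀ (X Y : C) (hX : W.Q.obj X = A) (hY : W.Q.obj Y = B), ∃ (X' : C) (s : X' ⟶ X)
      (_ : IsIso (L.map s)) (g : X' ⟶ Y), W.Q.map s ≫ eqToHom hX ≫ φ = W.Q.map g ≫ eqToHom hY
  have hPQ : ∀ {X Y : C} (φ : W.Q.obj X ⟶ W.Q.obj Y) (X' : C) (s : X' ⟶ X) (_ : IsIso (L.map s))
      (g : X' ⟶ Y) (_ : W.Q.map s ≫ φ = W.Q.map g), P φ := by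
    intro X Y φ X' s hs g h X₁ Y₁ hX hY
    obtain rfl := (Localization.Construction.objEquiv W).injective hX
    obtain rfl := (Localization.Construction.objEquiv W).injective hY
    exact ⟨X', s, hs, g, by simpa using h⟩
  have hPQ' : ∀ {X Y : C} (φ : W.Q.obj X ⟶ W.Q.obj Y) (_ : P φ), ∃ (X' : C) (s : X' ⟶ X)
      (_ : IsIso (L.map s)) (g : X' ⟶ Y), W.Q.map s ≫ φ = W.Q.map g := by
    intro X Y φ h
    simpa using h X Y rfl rfl
  have : P.IsStableUnderComposition := ⟨by
    intro A B B' φ ψ hφ hψ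
    obtain ⟨X, rfl⟩ := hobj A
    obtain ⟨Y, rfl⟩ := hobj B
    obtain ⟨Z, rfl⟩ := hobj B'
    obtain ⟨X', s, hs, g, hg⟩ := hPQ' φ hφ
    obtain ⟨Y', t, ht, k, hk⟩ := hPQ' ψ hψ
    -- To compose the fractions `s⁻¹g` and `t⁻¹k`, the middle part `g t⁻¹` is turned into a right
    -- fraction `a⁻¹m`. This is possible in `D`, and `hQ` carries the resulting relation between `a
    -- ≫ g` and `m ≫ t` back to the localization.
    obtain ⟨U, a, ha, m, hm⟩ := hL (L.map g ≫ inv (L.map t))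
    have h : W.Q.map (a ≫ g) = W.Q.map (m ≫ t) := hQ (by
      rw [L.map_comp, L.map_comp, ← hm]; simp)
    refine hPQ _ U (a ≫ s) (by rw [L.map_comp]; infer_instance) (m ≫ k) ?_
    rw [W.Q.map_comp, W.Q.map_comp, ← hk, ← Category.assoc (W.Q.map m), ← W.Q.map_comp m, ← h,
      W.Q.map_comp, Category.assoc, Category.assoc, reassoc_of% hg]⟩
  -- The localization is generated under composition by the images of morphisms of `C` and the
  -- formal inverses, and both are fractions.
  have hP : P = ⊤ := Localization.Construction.morphismProperty_eq_top P
    (fun X Y f => hPQ _ X (𝟙 X) (by rw [L.map_id]; infer_instance) f (by simp))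
    (fun X Y w hw => hPQ _ X w hw (𝟙 X) (by
      rw [W.Q.map_id]; exact (Localization.Construction.wIso w hw).hom_inv_id))
  have hP' : ∀ {X Y : C} (φ : W.Q.obj X ⟶ W.Q.obj Y), ∃ (X' : C) (s : X' ⟶ X)
      (_ : IsIso (L.map s)) (g : X' ⟶ Y), W.Q.map s ≫ φ = W.Q.map g :=
    fun φ => hPQ' φ (hP ▸ MorphismProperty.top_apply _)
  have : G.Faithful := ⟨by
    intro A B φ ψ h
    obtain ⟨X, rfl⟩ := hobj A
    obtain ⟨Y, rfl⟩ := hobj B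
    obtain ⟨X', s, hs, g, hg⟩ := hP' φ
    have := hQ' s hs
    -- With `φ = s⁻¹g` and `s ≫ ψ = t⁻¹k`, equality of `φ` and `ψ` amounts to that of the images of
    -- `t ≫ g` and `k`. These are morphisms of `C`, whose images in `D` agree by assumption.
    obtain ⟨Y', t, ht, k, hk⟩ := hP' (W.Q.map s ≫ ψ)
    have := hQ' t ht
    have h1 : L.map (t ≫ g) = L.map k := by
      rw [← hG k, ← hk, G.map_comp, G.map_comp, ← h, ← G.map_comp (W.Q.map s), hg, hG, hG,
        L.map_comp]
      rfl
    rw [← cancel_epi (W.Q.map s), ← cancel_epi (W.Q.map t), hg, hk, ← W.Q.map_comp, hQ h1]⟩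
  have : G.Full := ⟨by
    intro A B f
    obtain ⟨X, rfl⟩ := hobj A
    obtain ⟨Y, rfl⟩ := hobj B
    obtain ⟨X', s, hs, g, hg⟩ := hL (X := X) (Y := Y) f
    have := hQ' s hs
    refine ⟨inv (W.Q.map s) ≫ W.Q.map g, ?_⟩
    rw [← cancel_epi (G.map (W.Q.map s)), ← G.map_comp, IsIso.hom_inv_id_assoc, hG, hG]
    exact hg.symm⟩
  have : G.EssSurj := ⟨fun Y => ⟨W.Q.obj (L.objPreimage Y), ⟨L.objObjPreimageIso Y⟩⟩⟩
  exact { inverts := hW, isEquivalence := { } }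

end Localization

/-! ### The functor `*Q` is a localization -/

section DerivedCategory

variable {A : Type v} [Category.{w} A] [Abelian A]

/-- The calculus of fractions on the homotopy category provides a quasi-isomorphism `s` with `s ≫ f`
homotopic to `s ≫ g`. The homotopy is recorded as a morphism from the cylinder, so that the
conclusion mentions only five morphisms of complexes and can be transferred. -/
lemma identifiedByCylinder_of_Q_map_eq {K L : CochainComplex A ℤ} (f g : K ⟶ L)
    (h : DerivedCategory.Q.map f = DerivedCategory.Q.map g) :
    IdentifiedByCylinder DerivedCategory.Q f g := by
  have h1 : DerivedCategory.Qh.map ((HomotopyCategory.quotient _ _).map f) =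
      DerivedCategory.Qh.map ((HomotopyCategory.quotient _ _).map g) := by
    rw [← cancel_mono ((DerivedCategory.quotientCompQhIso A).hom.app L),
      DerivedCategory.quotientCompQhIso_hom_naturality,
      DerivedCategory.quotientCompQhIso_hom_naturality, h]
  obtain ⟨Z, s, hs, hfg⟩ := (MorphismProperty.map_eq_iff_precomp DerivedCategory.Qh
    (HomotopyCategory.quasiIso A (ComplexShape.up ℤ)) _ _).1 h1
  obtain ⟨Z, rfl⟩ := HomotopyCategory.quotient_obj_surjective Z
  obtain ⟨s, rfl⟩ := (HomotopyCategory.quotient _ _).map_surjective s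
  have H : Homotopy (s ≫ f) (s ≫ g) := HomotopyCategory.homotopyOfEq _ _ (by simpa using hfg)
  have hs' : QuasiIso s := (HomotopyCategory.quotient_map_mem_quasiIso_iff s).1 hs
  -- The projection of the cylinder is a homotopy equivalence provided that every degree is preceded
  -- by another one.
  have hc : ∀ j : ℤ, ∃ i, (ComplexShape.up ℤ).Rel i j := fun j => ⟨j - 1, by simp⟩
  have hp : QuasiIso (HomologicalComplex.cylinder.π Z) :=
    inferInstanceAs (QuasiIso (HomologicalComplex.cylinder.homotopyEquiv Z hc).hom)
  exact ⟨Z, _, s, HomologicalComplex.cylinder.ι₀ Z, HomologicalComplex.cylinder.ι₁ Z,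
    HomologicalComplex.cylinder.π Z, HomologicalComplex.cylinder.desc _ _ H, inferInstance,
    inferInstance, by simp, by simp, by simp, by simp⟩

end DerivedCategory

namespace Mor

variable {C : Type v} [Category.{w} C]

/-- `f` is an isomorphism. -/
def IsIso (f : Arrow C) : Prop :=
  ∃ g : Arrow C, dom g = cod f ∧ cod g = dom f ∧ comp f g = ident (dom f) ∧
    comp g f = ident (cod f)

lemma isIso_mk_iff {X Y : C} (f : X ⟶ Y) : IsIso (Arrow.mk f) ↔ CategoryTheory.IsIso f := by
  constructor
  · rintro ⟨g, h1, h2, h3, h4⟩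
    obtain ⟨g, rfl⟩ := exists_mk_of (X := Y) (Y := X) h1 h2
    rw [comp_mk] at h3 h4
    exact ⟨g, mk_inj.1 h3, mk_inj.1 h4⟩
  · intro h
    exact ⟨Arrow.mk (inv f), rfl, rfl, by rw [comp_mk, IsIso.hom_inv_id]; rfl,
      by rw [comp_mk, IsIso.inv_hom_id]; rfl⟩

end Mor

namespace Enlargement

variable {S W : Type u} (E : Enlargement S W)

section Isomorphisms

variable {C : Type*} [Category* C] [SmallCat S C] {D : Type*} [Category* D] [SmallCat S D]

/-- The enlargement of the set of isomorphisms. -/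
def IsIsoArr (f : E.Star (Arrow C)) : Prop := E.StarPred Mor.IsIso f

@[simp] lemma starPred_isIso {G : Type*} [Coded S G] (x : E.Star G) (f : G → Arrow C) :
    E.StarPred (fun x => Mor.IsIso (f x)) x ↔ E.IsIsoArr (E.starFun f x) :=
  E.starPred_comp Mor.IsIso f x

/-- An inverse given by transfer is an element of `*Mor(C)`, and these are exactly the morphisms of
`*C`. So internal and external invertibility coincide. -/
lemma isIsoArr_iff {X Y : E.Cat C} (f : X ⟶ Y) : E.IsIsoArr (Cat.arr f) ↔ IsIso f := by
  have : E.IsIsoArr (Cat.arr f) ↔ E.StarPred (fun f => Mor.IsIso f) (Cat.arr f) := Iff.rfl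
  rw [this]
  simp only [Mor.IsIso]
  simp
  constructor
  · rintro ⟨g, h1, h2, h3, h4⟩
    exact ⟨Cat.homMk g h1 h2, Cat.hom_ext h3, Cat.hom_ext h4⟩
  · intro h
    exact ⟨Cat.arr (inv f), Cat.dom_arr _, Cat.cod_arr _, by rw [← Cat.arr_comp, IsIso.hom_inv_id]; rfl,
      by rw [← Cat.arr_comp, IsIso.inv_hom_id]; rfl⟩

instance (F : C ⥤ D) [F.EssSurj] : (E.mapFunctor F).EssSurj where
  mem_essImage Y := by
    have := E.transfer_forall (P := fun Y : D => ∃ (X : C) (f : Arrow D), Mor.dom f = F.obj X ∧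
      Mor.cod f = Y ∧ Mor.IsIso f) (fun Y => ⟨F.objPreimage Y,
        Arrow.mk (F.objObjPreimageIso Y).hom, rfl, rfl, (Mor.isIso_mk_iff _).2 inferInstance⟩) Y.pt
    simp at this
    obtain ⟨X, f, h1, h2, h3⟩ := this
    let f' : (E.mapFunctor F).obj ⟨X⟩ ⟶ Y := Cat.homMk f h1 h2
    have : IsIso f' := (E.isIsoArr_iff f').1 h3
    exact ⟨⟨X⟩, ⟨asIso f'⟩⟩

end Isomorphisms

section Localization

variable {C : Type*} [Category* C] [SmallCat S C] {D : Type*} [Category* D] [SmallCat S D]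

/-- The hypothesis asserts the existence of two morphisms subject to equations and to the
invertibility of `L.map s`, so it transfers. -/
lemma mapFunctor_exists_fraction {L : C ⥤ D}
    (hL : ∀ ⦃X Y : C⦄ (f : L.obj X ⟶ L.obj Y), ∃ (X' : C) (s : X' ⟶ X) (_ : IsIso (L.map s))
      (g : X' ⟶ Y), L.map s ≫ f = L.map g)
    {X Y : E.Cat C} (f : (E.mapFunctor L).obj X ⟶ (E.mapFunctor L).obj Y) :
    ∃ (X' : E.Cat C) (s : X' ⟶ X) (_ : IsIso ((E.mapFunctor L).map s)) (g : X' ⟶ Y),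
      (E.mapFunctor L).map s ≫ f = (E.mapFunctor L).map g := by
  have := E.transfer_forall (P := fun X : C => ∀ (Y : C) (f : Arrow D), Mor.dom f = L.obj X →
    Mor.cod f = L.obj Y → ∃ s g : Arrow C, Mor.cod s = X ∧ Mor.dom g = Mor.dom s ∧ Mor.cod g = Y ∧
      Mor.IsIso (Mor.map L s) ∧ Mor.comp (Mor.map L s) f = Mor.map L g) (by
      intro X Y f h h'
      obtain ⟨f, rfl⟩ := Mor.exists_mk_of h h'
      obtain ⟨X', s, hs, g, hg⟩ := hL f
      refine ⟨Arrow.mk s, Arrow.mk g, rfl, rfl, rfl, ?_, ?_⟩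
      · rwa [Mor.map_mk, Mor.isIso_mk_iff]
      · rw [Mor.map_mk, Mor.map_mk, Mor.comp_mk, hg]) X.pt
  simp [-exists_and_left] at this
  obtain ⟨s, g, h1, h2, h3, h4, h5⟩ := this Y.pt (Cat.arr f) (Cat.dom_arr f) (Cat.cod_arr f)
  exact ⟨⟨E.dom s⟩, Cat.homMk s rfl h1, (E.isIsoArr_iff _).1 h4, Cat.homMk g h2 h3, Cat.hom_ext h5⟩

lemma mapFunctor_identifiedByCylinder {L : C ⥤ D}
    (hL : ∀ ⦃X Y : C⦄ (f g : X ⟶ Y), L.map f = L.map g → IdentifiedByCylinder L f g)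
    {X Y : E.Cat C} (f g : X ⟶ Y) (h : (E.mapFunctor L).map f = (E.mapFunctor L).map g) :
    IdentifiedByCylinder (E.mapFunctor L) f g := by
  have := E.transfer_forall (P := fun f : Arrow C => ∀ g : Arrow C, Mor.dom f = Mor.dom g →
    Mor.cod f = Mor.cod g → Mor.map L f = Mor.map L g → ∃ w i j p h : Arrow C,
      Mor.cod w = Mor.dom f ∧ Mor.dom i = Mor.dom w ∧ Mor.dom j = Mor.dom w ∧
      Mor.cod j = Mor.cod i ∧ Mor.dom p = Mor.cod i ∧ Mor.cod p = Mor.dom w ∧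
      Mor.dom h = Mor.cod i ∧ Mor.cod h = Mor.cod f ∧ Mor.IsIso (Mor.map L w) ∧
      Mor.IsIso (Mor.map L p) ∧ Mor.comp i p = Mor.ident (Mor.dom w) ∧
      Mor.comp j p = Mor.ident (Mor.dom w) ∧ Mor.comp i h = Mor.comp w f ∧
      Mor.comp j h = Mor.comp w g) (by
      intro f g h h' hfg
      obtain ⟨X, Y, g, rfl⟩ := Mor.exists_mk g
      obtain ⟨f, rfl⟩ := Mor.exists_mk_of (X := X) (Y := Y) h h'
      obtain ⟨Z, T, w, i, j, p, k, hw, hp, hi, hj, hif, hjg⟩ := hL f g (Mor.mk_inj.1 hfg)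
      refine ⟨Arrow.mk w, Arrow.mk i, Arrow.mk j, Arrow.mk p, Arrow.mk k, rfl, rfl, rfl, rfl, rfl,
        rfl, rfl, rfl, ?_, ?_, ?_, ?_, ?_, ?_⟩
      · rwa [Mor.map_mk, Mor.isIso_mk_iff]
      · rwa [Mor.map_mk, Mor.isIso_mk_iff]
      · rw [Mor.comp_mk, hi]; rfl
      · rw [Mor.comp_mk, hj]; rfl
      · rw [Mor.comp_mk, Mor.comp_mk, hif]
      · rw [Mor.comp_mk, Mor.comp_mk, hjg]) (Cat.arr f)
  simp [-exists_and_left] at this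
  obtain ⟨w, i, j, p, k, h1, h2, h3, h4, h5, h6, h7, h8, hw, hp, hi, hj, hif, hjg⟩ :=
    this (Cat.arr g) (by simp) (by simp) (congr_arg Cat.arr h)
  exact ⟨⟨E.dom w⟩, ⟨E.cod i⟩, Cat.homMk w rfl h1, Cat.homMk i h2 rfl, Cat.homMk j h3 h4,
    Cat.homMk p h5 h6, Cat.homMk k h7 h8, (E.isIsoArr_iff _).1 hw, (E.isIsoArr_iff _).1 hp,
    Cat.hom_ext hi, Cat.hom_ext hj, Cat.hom_ext hif, Cat.hom_ext hjg⟩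

variable [Infinite S] (A : Type*) [Category* A] [Abelian A] [SmallCat S A]

/-- The morphisms of `*Kom(A)` that become isomorphisms in `*D(A)`. -/
abbrev quasiIso : MorphismProperty (E.Cat (CochainComplex A ℤ)) :=
  (MorphismProperty.isomorphisms _).inverseImage (E.mapFunctor DerivedCategory.Q)

/-- This makes `*D(A)` have the universal property with respect to external functors. Functors and
isomorphisms out of it, in particular `res`, are constructed on `*`-complexes from here on. -/
instance : (E.mapFunctor (DerivedCategory.Q (C := A))).IsLocalization (E.quasiIso A) := by
  refine isLocalization_of_exists_fraction (fun X Y f => E.mapFunctor_exists_fraction ?_ f)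
    (fun X Y f g h => E.mapFunctor_identifiedByCylinder ?_ f g h)
  · intro X Y f
    obtain ⟨X', s, hs, g, rfl⟩ := DerivedCategory.right_fac f
    exact ⟨X', s, hs, g, by simp⟩
  · exact fun X Y f g h => identifiedByCylinder_of_Q_map_eq f g h

end Localization

end Enlargement

/-! ### The cohomology of a `*`-complex and of its restriction -/

section LeftHomologyData

variable {C : Type*} [Category* C] [Preadditive C] {T : ShortComplex C} {K H : C}
  {i : K ⟶ T.X₂} {π : K ⟶ H} {l : T.X₁ ⟶ K} {wi : i ≫ T.g = 0} {wπ : l ≫ π = 0}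

lemma isLimit_lift_eq (hi : IsLimit (KernelFork.ofι i wi)) (hl : l ≫ i = T.f) :
    hi.lift (KernelFork.ofι T.f T.zero) = l :=
  Fork.IsLimit.hom_ext hi ((Fork.IsLimit.lift_ι hi).trans hl.symm)

/-- A left homology data for which the map to the cycles is given. -/
noncomputable def leftHomologyDataOfEq (hi : IsLimit (KernelFork.ofι i wi)) (hl : l ≫ i = T.f)
    (hπ : IsColimit (CokernelCofork.ofπ π wπ)) : T.LeftHomologyData where
  K := K
  H := H
  i := i
  π := π
  wi := wi
  hi := hi
  wπ := by rw [isLimit_lift_eq hi hl, wπ]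
  hπ := CokernelCofork.IsColimit.ofπ _ _
    (fun g hg => hπ.desc (CokernelCofork.ofπ g (by rwa [isLimit_lift_eq hi hl] at hg)))
    (fun g hg => Cofork.IsColimit.π_desc hπ)
    (fun g hg m hm => Cofork.IsColimit.hom_ext hπ (by
      rw [Cofork.IsColimit.π_desc]
      exact hm))

lemma leftHomologyDataOfEq_f' (hi : IsLimit (KernelFork.ofι i wi)) (hl : l ≫ i = T.f)
    (hπ : IsColimit (CokernelCofork.ofπ π wπ)) : (leftHomologyDataOfEq hi hl hπ).f' = l :=
  isLimit_lift_eq hi hl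

end LeftHomologyData

namespace Enlargement

variable {S W : Type u} (E : Enlargement S W)

section Limits

variable {E} {C : Type*} [Category* C] [Preadditive C] [SmallCat S C] {G : Type*} [Coded S G]
  {x : E.Star G} {X Y Z : E.Cat C} {a b c : G → C}

/-- The members of the enlargement of a family of kernels are kernels. -/
lemma IsMember.exists_isLimit {k : X ⟶ Y} {f : Y ⟶ Z} {κ : ∀ t, a t ⟶ b t} {φ : ∀ t, b t ⟶ c t}
    (hk : IsMember x k κ) (hf : IsMember x f φ)
    (h : ∀ t, ∃ w : κ t ≫ φ t = 0, Nonempty (IsLimit (KernelFork.ofι (κ t) w))) :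
    ∃ w : k ≫ f = 0, Nonempty (IsLimit (KernelFork.ofι k w)) := by
  refine Cat.exists_isLimit f k ?_
  rw [show Cat.arr k = _ from hk, show Cat.arr f = _ from hf, ← E.starPred_rel]
  exact E.transfer_forall (fun t => by
    obtain ⟨w, ⟨hw⟩⟩ := h t
    exact Mor.isKer_of_isLimit _ _ w hw) x

/-- The members of the enlargement of a family of cokernels are cokernels. -/
lemma IsMember.exists_isColimit {f : X ⟶ Y} {k : Y ⟶ Z} {φ : ∀ t, a t ⟶ b t} {κ : ∀ t, b t ⟶ c t}
    (hf : IsMember x f φ) (hk : IsMember x k κ)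
    (h : ∀ t, ∃ w : φ t ≫ κ t = 0, Nonempty (IsColimit (CokernelCofork.ofπ (κ t) w))) :
    ∃ w : f ≫ k = 0, Nonempty (IsColimit (CokernelCofork.ofπ k w)) := by
  refine Cat.exists_isColimit f k ?_
  rw [show Cat.arr k = _ from hk, show Cat.arr f = _ from hf, ← E.starPred_rel]
  exact E.transfer_forall (fun t => by
    obtain ⟨w, ⟨hw⟩⟩ := h t
    exact Mor.isCoker_of_isColimit _ _ w hw) x

end Limits

section Restriction

variable [Infinite S] {A : Type v} [Category.{w} A] [Abelian A] [SmallCat S A]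

lemma isMember_restriction_d (K : E.Cat (CochainComplex A ℤ)) (i j : ℤ) :
    IsMember K.pt (((E.restriction A).obj K).d i j) (fun K => K.d i j) := rfl

lemma isMember_restriction_map_f {K L : E.Cat (CochainComplex A ℤ)} (f : K ⟶ L) (i : ℤ) :
    IsMember (Cat.arr f) (((E.restriction A).map f).f i) (fun f => f.hom.f i) :=
  E.isMember_mapFunctor_map (HomologicalComplex.eval A _ i) f

/-- The cycles of a `*`-complex in a standard degree. -/
noncomputable abbrev cycles (K : E.Cat (CochainComplex A ℤ)) (j : ℤ) : E.Cat A :=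
  (E.mapFunctor (HomologicalComplex.cyclesFunctor A _ j)).obj K

/-- The inclusion of the cycles of a `*`-complex. -/
noncomputable def iCycles (K : E.Cat (CochainComplex A ℤ)) (j : ℤ) :
    E.cycles K j ⟶ ((E.restriction A).obj K).X j :=
  member K.pt (fun K : CochainComplex A ℤ => K.iCycles j)

lemma isMember_iCycles (K : E.Cat (CochainComplex A ℤ)) (j : ℤ) :
    IsMember K.pt (E.iCycles K j) (fun K => K.iCycles j) := rfl

/-- The homology of a `*`-complex in a standard degree. -/
noncomputable abbrev homology (K : E.Cat (CochainComplex A ℤ)) (j : ℤ) : E.Cat A :=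
  (E.mapFunctor (HomologicalComplex.homologyFunctor A _ j)).obj K

/-- The projection from the cycles of a `*`-complex to its homology. -/
noncomputable def homologyπ (K : E.Cat (CochainComplex A ℤ)) (j : ℤ) :
    E.cycles K j ⟶ E.homology K j :=
  member K.pt (fun K : CochainComplex A ℤ => K.homologyπ j)

lemma isMember_homologyπ (K : E.Cat (CochainComplex A ℤ)) (j : ℤ) :
    IsMember K.pt (E.homologyπ K j) (fun K => K.homologyπ j) := rfl

/-- The map from a `*`-complex to its cycles. -/
noncomputable def toCycles (K : E.Cat (CochainComplex A ℤ)) (i j : ℤ) :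
    ((E.restriction A).obj K).X i ⟶ E.cycles K j :=
  member K.pt (fun K : CochainComplex A ℤ => K.toCycles i j)

lemma isMember_toCycles (K : E.Cat (CochainComplex A ℤ)) (i j : ℤ) :
    IsMember K.pt (E.toCycles K i j) (fun K => K.toCycles i j) := rfl

lemma toCycles_i (K : E.Cat (CochainComplex A ℤ)) (i j : ℤ) :
    E.toCycles K i j ≫ E.iCycles K j = ((E.restriction A).obj K).d i j :=
  ((E.isMember_toCycles K i j).comp (E.isMember_iCycles K j)).eq (E.isMember_restriction_d K i j)
    (fun K => by rw [HomologicalComplex.toCycles_i])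

/-- Being a kernel is a condition on two morphisms that quantifies over morphisms of `A` only. So
the enlarged cycles are kernels in `*A`, against all morphisms of `*A`. The same holds for the
cokernel that defines the homology. -/
lemma exists_isLimit_iCycles (K : E.Cat (CochainComplex A ℤ)) (j k : ℤ)
    (hk : (ComplexShape.up ℤ).next j = k) :
    ∃ w : E.iCycles K j ≫ ((E.restriction A).obj K).d j k = 0,
      Nonempty (IsLimit (KernelFork.ofι (E.iCycles K j) w)) :=
  (E.isMember_iCycles K j).exists_isLimit (E.isMember_restriction_d K j k)
    (fun K => ⟨_, ⟨K.cyclesIsKernel j k hk⟩⟩)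

lemma exists_isColimit_homologyπ (K : E.Cat (CochainComplex A ℤ)) (i j : ℤ)
    (hi : (ComplexShape.up ℤ).prev j = i) :
    ∃ w : E.toCycles K i j ≫ E.homologyπ K j = 0,
      Nonempty (IsColimit (CokernelCofork.ofπ (E.homologyπ K j) w)) :=
  (E.isMember_toCycles K i j).exists_isColimit (E.isMember_homologyπ K j)
    (fun K => ⟨_, ⟨K.homologyIsCokernel i j hi⟩⟩)

/-- The homology of a `*`-complex computes the homology of its restriction. -/
noncomputable def leftHomologyData (K : E.Cat (CochainComplex A ℤ)) (j : ℤ) :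
    (((E.restriction A).obj K).sc j).LeftHomologyData :=
  leftHomologyDataOfEq (E.exists_isLimit_iCycles K j _ rfl).choose_spec.some (E.toCycles_i K _ j)
    (E.exists_isColimit_homologyπ K _ j rfl).choose_spec.some

lemma leftHomologyData_f' (K : E.Cat (CochainComplex A ℤ)) (j : ℤ) :
    (E.leftHomologyData K j).f' = E.toCycles K _ j :=
  leftHomologyDataOfEq_f' _ _ _

section Maps

variable {E} {K L : E.Cat (CochainComplex A ℤ)} (f : K ⟶ L)

/-- The map that a morphism of `*`-complexes induces on the cycles. -/
noncomputable abbrev cyclesMap (j : ℤ) : E.cycles K j ⟶ E.cycles L j :=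
  (E.mapFunctor (HomologicalComplex.cyclesFunctor A _ j)).map f

/-- The map that a morphism of `*`-complexes induces on the homology. -/
noncomputable abbrev homologyMap (j : ℤ) : E.homology K j ⟶ E.homology L j :=
  (E.mapFunctor (HomologicalComplex.homologyFunctor A _ j)).map f

lemma isMember_cyclesMap (j : ℤ) : IsMember (Cat.arr f) (cyclesMap f j)
    (fun f => HomologicalComplex.cyclesMap f.hom j) :=
  E.isMember_mapFunctor_map (HomologicalComplex.cyclesFunctor A _ j) f

lemma isMember_homologyMap (j : ℤ) : IsMember (Cat.arr f) (homologyMap f j)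
    (fun f => HomologicalComplex.homologyMap f.hom j) :=
  E.isMember_mapFunctor_map (HomologicalComplex.homologyFunctor A _ j) f

lemma cyclesMap_i (j : ℤ) : cyclesMap f j ≫ E.iCycles L j =
    E.iCycles K j ≫ ((E.restriction A).map f).f j :=
  ((isMember_cyclesMap f j).comp ((E.isMember_iCycles L j).reindex
    (fun t : Arrow (CochainComplex A ℤ) => t.right) (IsMember.self f).target)).eq
      (((E.isMember_iCycles K j).reindex (fun t => t.left) (IsMember.self f).source).comp
        (E.isMember_restriction_map_f f j)) (fun f => by simp)

lemma toCycles_naturality (i j : ℤ) : E.toCycles K i j ≫ cyclesMap f j =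
    ((E.restriction A).map f).f i ≫ E.toCycles L i j :=
  (((E.isMember_toCycles K i j).reindex (fun t : Arrow (CochainComplex A ℤ) => t.left)
      (IsMember.self f).source).comp (isMember_cyclesMap f j)).eq
    ((E.isMember_restriction_map_f f i).comp ((E.isMember_toCycles L i j).reindex
      (fun t : Arrow (CochainComplex A ℤ) => t.right) (IsMember.self f).target)) (fun f => by
      congr 1
      rw [← cancel_mono (f.right.iCycles j)]
      simp)

lemma homologyπ_naturality (j : ℤ) : E.homologyπ K j ≫ homologyMap f j =
    cyclesMap f j ≫ E.homologyπ L j :=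
  (((E.isMember_homologyπ K j).reindex (fun t : Arrow (CochainComplex A ℤ) => t.left)
      (IsMember.self f).source).comp (isMember_homologyMap f j)).eq
    ((isMember_cyclesMap f j).comp ((E.isMember_homologyπ L j).reindex
      (fun t : Arrow (CochainComplex A ℤ) => t.right) (IsMember.self f).target)) (fun f => by simp)

/-- The maps on the homology of `*`-complexes and of their restrictions agree. -/
noncomputable def leftHomologyMapData (j : ℤ) :
    ShortComplex.LeftHomologyMapData ((HomologicalComplex.shortComplexFunctor _ _ j).map
      ((E.restriction A).map f)) (E.leftHomologyData K j) (E.leftHomologyData L j) where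
  φK := cyclesMap f j
  φH := homologyMap f j
  commi := cyclesMap_i f j
  commf' := by
    rw [leftHomologyData_f', leftHomologyData_f']
    exact toCycles_naturality f _ j
  commπ := homologyπ_naturality f j

end Maps

/-- The homology of `*`-complexes is the homology of their restrictions. -/
noncomputable def restrictionHomologyIso (j : ℤ) :
    E.restriction A ⋙ HomologicalComplex.homologyFunctor (E.Cat A) _ j ≅
      E.mapFunctor (HomologicalComplex.homologyFunctor A _ j) :=
  NatIso.ofComponents (fun K => (E.leftHomologyData K j).homologyIso)
    (fun f => (leftHomologyMapData f j).homologyMap_comm)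

/-- In each standard degree the map on the homology of the restrictions is identified with the map
given by the enlarged homology functor. That functor factors through `*Q`, which inverts `f`. -/
lemma quasiIso_restriction_map {K L : E.Cat (CochainComplex A ℤ)} (f : K ⟶ L)
    (hf : E.quasiIso A f) : QuasiIso ((E.restriction A).map f) := by
  rw [quasiIso_iff]
  intro j
  rw [quasiIsoAt_iff, (leftHomologyMapData f j).quasiIso_iff]
  have : IsIso ((E.mapFunctor DerivedCategory.Q).map f) := hf
  exact ((NatIso.isIso_map_iff (E.mapNatIso (DerivedCategory.homologyFunctorFactors A j)) f).1
    ((NatIso.isIso_map_iff (E.mapCompIso DerivedCategory.Q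
      (DerivedCategory.homologyFunctor A j)) f).2 (by dsimp; infer_instance)))

end Restriction

end Enlargement

/-! ### Restriction and shifts; the functor `res` and its effect on cohomology -/

namespace Enlargement

variable {S W : Type u} (E : Enlargement S W)

section

variable {E} {C : Type*} [Category* C] [Preadditive C] [SmallCat S C] {G : Type*} [Coded S G]
  {x : E.Star G} {X Y : E.Cat C} {a b : G → C}

/-- Accounts for the sign `(-1)ⁿ` in the differential of a complex shifted by `n`. -/
lemma IsMember.units_smul {f : X ⟶ Y} {φ : ∀ t, a t ⟶ b t} (hf : IsMember x f φ) (n : ℤˣ) :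
    IsMember x (n • f) (fun t => n • φ t) := by
  obtain rfl | rfl := Int.units_eq_one_or n
  · simpa using hf
  · simpa using hf.neg

end

variable [Infinite S] {A : Type v} [Category.{w} A] [Abelian A] [SmallCat S A]

section Members

variable {E} {G : Type*} [Coded S G] {x : E.Star G}

lemma IsMember.restriction_map_f {X Y : E.Cat (CochainComplex A ℤ)} {a b : G → CochainComplex A ℤ}
    {f : X ⟶ Y} {φ : ∀ t, a t ⟶ b t} (hf : IsMember x f φ) (i : ℤ) :
    IsMember x (((E.restriction A).map f).f i) (fun t => (φ t).f i) :=
  hf.map (HomologicalComplex.eval A _ i)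

lemma isMember_restriction_XIsoOfEq_hom (K : E.Cat (CochainComplex A ℤ)) {i j : ℤ} (h : i = j) :
    IsMember K.pt (((E.restriction A).obj K).XIsoOfEq h).hom (fun t => (t.XIsoOfEq h).hom) :=
  IsMember.eqToHom (by rw [h]) rfl (by rw [h])

end Members

/-- The restriction of a shifted `*`-complex in a degree. -/
noncomputable def restrictionShiftXIso (n : ℤ) (K : E.Cat (CochainComplex A ℤ)) (i : ℤ) :
    ((E.restriction A).obj ((shiftFunctor (E.Cat (CochainComplex A ℤ)) n).obj K)).X i ≅
      ((E.restriction A).obj K).X (i + n) :=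
  memberIso K.pt (fun t : CochainComplex A ℤ => Iso.refl (t.X (i + n)))
    (E.starFun_comp (HomologicalComplex.eval A _ i).obj (shiftFunctor _ n).obj K.pt).symm rfl

lemma isMember_restrictionShiftXIso_hom (n : ℤ) (K : E.Cat (CochainComplex A ℤ)) (i : ℤ) :
    IsMember K.pt (E.restrictionShiftXIso n K i).hom
      (fun t => 𝟙 ((shiftFunctor (CochainComplex A ℤ) n).obj t |>.X i)) := rfl

lemma restrictionShiftXIso_hom_comp_d (n : ℤ) (K : E.Cat (CochainComplex A ℤ)) (i j : ℤ) :
    (E.restrictionShiftXIso n K i).hom ≫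
        (n.negOnePow • ((E.restriction A).obj K).d (i + n) (j + n)) =
      ((E.restriction A).obj ((shiftFunctor (E.Cat (CochainComplex A ℤ)) n).obj K)).d i j ≫
        (E.restrictionShiftXIso n K j).hom := by
  have h : IsMember K.pt (((E.restriction A).obj
      ((shiftFunctor (E.Cat (CochainComplex A ℤ)) n).obj K)).d i j)
      (fun t => ((shiftFunctor (CochainComplex A ℤ) n).obj t).d i j) :=
    IsMember.reindex (x := (K⟦n⟧).pt) (shiftFunctor (CochainComplex A ℤ) n).obj rfl
      (E.isMember_restriction_d (K⟦n⟧) i j)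
  exact ((E.isMember_restrictionShiftXIso_hom n K i).comp
    ((E.isMember_restriction_d K (i + n) (j + n)).units_smul n.negOnePow)).eq
      (h.comp (E.isMember_restrictionShiftXIso_hom n K j)) (fun t => by simp)

lemma restrictionShiftXIso_hom_naturality (n : ℤ) {K L : E.Cat (CochainComplex A ℤ)} (f : K ⟶ L)
    (i : ℤ) : ((E.restriction A).map ((shiftFunctor (E.Cat (CochainComplex A ℤ)) n).map f)).f i ≫
        (E.restrictionShiftXIso n L i).hom =
      (E.restrictionShiftXIso n K i).hom ≫ ((E.restriction A).map f).f (i + n) := by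
  have h₁ : IsMember (Cat.arr f) (E.restrictionShiftXIso n L i).hom
      (fun t => 𝟙 ((shiftFunctor (CochainComplex A ℤ) n).obj t.right |>.X i)) :=
    (E.isMember_restrictionShiftXIso_hom n L i).reindex
      (fun t : Arrow (CochainComplex A ℤ) => t.right) (IsMember.self f).target
  have h₂ : IsMember (Cat.arr f) (E.restrictionShiftXIso n K i).hom
      (fun t => 𝟙 ((shiftFunctor (CochainComplex A ℤ) n).obj t.left |>.X i)) :=
    (E.isMember_restrictionShiftXIso_hom n K i).reindex
      (fun t : Arrow (CochainComplex A ℤ) => t.left) (IsMember.self f).source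
  exact (((E.isMember_mapFunctor_map _ f).restriction_map_f i).comp h₁).eq
    (h₂.comp (E.isMember_restriction_map_f f (i + n))) (fun f => by simp)

/-- The restriction of `*`-complexes commutes with the shifts. -/
noncomputable def restrictionShiftIso (n : ℤ) :
    shiftFunctor (E.Cat (CochainComplex A ℤ)) n ⋙ E.restriction A ≅
      E.restriction A ⋙ shiftFunctor (CochainComplex (E.Cat A) ℤ) n :=
  NatIso.ofComponents (fun K => HomologicalComplex.Hom.isoOfComponents
    (fun i => E.restrictionShiftXIso n K i)
    (fun i j _ => E.restrictionShiftXIso_hom_comp_d n K i j))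
    (fun {K L} f => by
      ext i
      exact E.restrictionShiftXIso_hom_naturality n f i)

lemma restrictionShiftXIso_zero (K : E.Cat (CochainComplex A ℤ)) (i : ℤ) :
    (E.restrictionShiftXIso 0 K i).hom =
      ((E.restriction A).map ((shiftFunctorZero _ ℤ).hom.app K)).f i ≫
        (((E.restriction A).obj K).XIsoOfEq (_root_.add_zero i).symm).hom :=
  (E.isMember_restrictionShiftXIso_hom 0 K i).eq
    (((E.isMember_shiftFunctorZero_hom_app K).restriction_map_f i).comp
      (isMember_restriction_XIsoOfEq_hom K _)) (fun t => by
        simp [CochainComplex.shiftFunctorZero_hom_app_f])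

/-- All the isomorphisms involved are members of families of identities or of transports along `i +
n + m = i + (m + n)`, so the coherence in `Kom(A)` decides the matter. -/
lemma restrictionShiftXIso_add (m n : ℤ) (K : E.Cat (CochainComplex A ℤ)) (i : ℤ) :
    (E.restrictionShiftXIso (m + n) K i).hom =
      ((E.restriction A).map ((shiftFunctorAdd _ m n).hom.app K)).f i ≫
        (E.restrictionShiftXIso n (K⟦m⟧) i).hom ≫ (E.restrictionShiftXIso m K (i + n)).hom ≫
        (((E.restriction A).obj K).XIsoOfEq (by omega : i + n + m = i + (m + n))).hom := by
  have h : IsMember K.pt (E.restrictionShiftXIso n (K⟦m⟧) i).hom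
      (fun t => 𝟙 ((t⟦m⟧⟦n⟧ : CochainComplex A ℤ).X i)) :=
    IsMember.reindex (x := (K⟦m⟧).pt) (shiftFunctor (CochainComplex A ℤ) m).obj rfl
      (E.isMember_restrictionShiftXIso_hom n (K⟦m⟧) i)
  have h' : IsMember K.pt (((E.restriction A).map ((shiftFunctorAdd _ m n).hom.app K)).f i)
      (fun t => ((shiftFunctorAdd (CochainComplex A ℤ) m n).hom.app t).f i) :=
    (E.isMember_shiftFunctorAdd_hom_app m n K).restriction_map_f i
  have h'' : IsMember K.pt (E.restrictionShiftXIso m K (i + n)).hom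
      (fun t => 𝟙 ((t⟦m⟧⟦n⟧ : CochainComplex A ℤ).X i)) :=
    E.isMember_restrictionShiftXIso_hom m K (i + n)
  refine (E.isMember_restrictionShiftXIso_hom (m + n) K i).eq
    (h'.comp (h.comp (h''.comp (isMember_restriction_XIsoOfEq_hom K _)))) (fun t => ?_)
  rw [CochainComplex.shiftFunctorAdd_hom_app_f]
  erw [Category.id_comp, Category.id_comp]
  simp

noncomputable instance : (E.restriction A).CommShift ℤ where
  commShiftIso := E.restrictionShiftIso
  commShiftIso_zero := by
    ext K i
    rw [Functor.CommShift.isoZero_hom_app, HomologicalComplex.comp_f,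
      CochainComplex.shiftFunctorZero_inv_app_f]
    exact E.restrictionShiftXIso_zero K i
  commShiftIso_add m n := by
    ext K i
    rw [Functor.CommShift.isoAdd_hom_app, HomologicalComplex.comp_f, HomologicalComplex.comp_f,
      HomologicalComplex.comp_f, CochainComplex.shiftFunctorAdd_inv_app_f,
      CochainComplex.shiftFunctor_map_f']
    exact E.restrictionShiftXIso_add m n K i

variable (A)

lemma isInvertedBy_restriction_comp_Q :
    (E.quasiIso A).IsInvertedBy (E.restriction A ⋙ DerivedCategory.Q) := by
  intro K L f hf
  have := E.quasiIso_restriction_map f hf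
  exact inferInstanceAs (IsIso (DerivedCategory.Q.map ((E.restriction A).map f)))

/-- The functor `*D(A) ⥤ D(*A)` induced by the restriction of `*`-complexes to `ℤ`. -/
noncomputable def res : E.Cat (DerivedCategory A) ⥤ DerivedCategory (E.Cat A) :=
  Localization.lift (E.restriction A ⋙ DerivedCategory.Q) (E.isInvertedBy_restriction_comp_Q A)
    (E.mapFunctor DerivedCategory.Q)

noncomputable instance : Localization.Lifting (E.mapFunctor DerivedCategory.Q) (E.quasiIso A)
    (E.restriction A ⋙ DerivedCategory.Q) (E.res A) :=
  Localization.liftingLift _ _ _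

/-- The functor `res` is induced by the restriction of `*`-complexes to `ℤ`. -/
noncomputable def resFac : E.mapFunctor DerivedCategory.Q ⋙ E.res A ≅
    E.restriction A ⋙ DerivedCategory.Q :=
  Localization.Lifting.iso _ (E.quasiIso A) _ _

lemma isInducedByRestriction_res : E.IsInducedByRestriction (E.res A) := ⟨E.resFac A⟩

variable {A} in
-- Two functors with isomorphic composites with a localization functor are isomorphic.
lemma IsInducedByRestriction.nonempty_iso
    {res' : E.Cat (DerivedCategory A) ⥤ DerivedCategory (E.Cat A)}
    (h : E.IsInducedByRestriction res') : Nonempty (res' ≅ E.res A) := by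
  obtain ⟨e⟩ := h
  have : Localization.Lifting (E.mapFunctor DerivedCategory.Q) (E.quasiIso A)
    (E.restriction A ⋙ DerivedCategory.Q) res' := ⟨e⟩
  exact ⟨Localization.liftNatIso (E.mapFunctor DerivedCategory.Q) (E.quasiIso A) _ _ _ _
    (Iso.refl (E.restriction A ⋙ DerivedCategory.Q))⟩

/-- Both `*Q` and restriction followed by `Q` commute with shifts, and such a structure descends
along the localization `*Q`. It is compatible with `resFac` by construction, which is what allows
triangles to be compared through `resFac`. -/
noncomputable instance : (E.res A).CommShift ℤ :=
  Functor.commShiftOfLocalization (E.mapFunctor DerivedCategory.Q) (E.quasiIso A) ℤ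
    (E.restriction A ⋙ DerivedCategory.Q) (E.res A)

instance : NatTrans.CommShift (E.resFac A).hom ℤ :=
  NatTrans.commShift_iso_hom_of_localization (E.mapFunctor DerivedCategory.Q) (E.quasiIso A) ℤ
    (E.restriction A ⋙ DerivedCategory.Q) (E.res A)

/-- The cohomology of objects of `*D(A)` in standard degrees is the cohomology of their images
in `D(*A)`. -/
noncomputable def resHomologyIso (j : ℤ) :
    E.res A ⋙ DerivedCategory.homologyFunctor (E.Cat A) j ≅
      E.mapFunctor (DerivedCategory.homologyFunctor A j) :=
  Localization.liftNatIso (E.mapFunctor DerivedCategory.Q) (E.quasiIso A)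
    (E.mapFunctor DerivedCategory.Q ⋙ E.res A ⋙ DerivedCategory.homologyFunctor (E.Cat A) j)
    (E.mapFunctor DerivedCategory.Q ⋙ E.mapFunctor (DerivedCategory.homologyFunctor A j)) _ _
    ((Functor.associator _ _ _).symm ≪≫ Functor.isoWhiskerRight (E.resFac A) _ ≪≫
      Functor.associator _ _ _ ≪≫
      Functor.isoWhiskerLeft _ (DerivedCategory.homologyFunctorFactors (E.Cat A) j) ≪≫
      E.restrictionHomologyIso j ≪≫
      (E.mapNatIso (DerivedCategory.homologyFunctorFactors A j)).symm ≪≫ E.mapCompIso _ _)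

variable {A} in
-- The cohomology in degrees of `*ℤ` is the enlargement of a map in two variables; at a standard
-- degree it reduces to the enlargement of the functor `hʲ`, the only part of it that restriction
-- sees.
lemma cohomology_std (X : E.Cat (DerivedCategory A)) (j : ℤ) :
    E.cohomology X (E.std j) = (E.mapFunctor (DerivedCategory.homologyFunctor A j)).obj X := by
  rw [cohomology, starFun₂_std]
  rfl

variable {A} in
lemma isZero_homologyFunctor_obj_res_iff (X : E.Cat (DerivedCategory A)) (j : ℤ) :
    IsZero ((DerivedCategory.homologyFunctor (E.Cat A) j).obj ((E.res A).obj X)) ↔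
      IsZero (E.cohomology X (E.std j)) := by
  rw [cohomology_std]
  exact ((E.resHomologyIso A j).app X).isZero_iff

end Enlargement

/-! ### The pretriangulated structure on the enlargement of a pretriangulated category -/

open Pretriangulated

section Arrows

variable {C : Type*} [Category* C] [Preadditive C] [HasZeroObject C] [HasShift C ℤ]
  [∀ n : ℤ, (shiftFunctor C n).Additive] [Pretriangulated C]

/-- Three morphisms that form a distinguished triangle. -/
def Mor.IsDist (p : Arrow C × Arrow C × Arrow C) : Prop :=
  ∃ T ∈ distinguishedTriangles, p = (Arrow.mk T.mor₁, Arrow.mk T.mor₂, Arrow.mk T.mor₃)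

lemma Mor.isDist_mk_iff {X Y Z : C} (f : X ⟶ Y) (g : Y ⟶ Z) (h : Z ⟶ X⟦(1 : ℤ)⟧) :
    Mor.IsDist (Arrow.mk f, Arrow.mk g, Arrow.mk h) ↔ Triangle.mk f g h ∈ distTriang C := by
  constructor
  · rintro ⟨⟨X', Y', Z', f', g', h'⟩, hT, h⟩
    simp only [Prod.mk.injEq] at h
    obtain ⟨h1, h2, h3⟩ := h
    obtain rfl : X = X' := congr_arg Mor.dom h1
    obtain rfl : Y = Y' := congr_arg Mor.cod h1
    obtain rfl : Z = Z' := congr_arg Mor.cod h2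
    obtain rfl := Mor.mk_inj.1 h1
    obtain rfl := Mor.mk_inj.1 h2
    obtain rfl := Mor.mk_inj.1 h3
    exact hT
  · exact fun h => ⟨_, h, rfl⟩

end Arrows

namespace Enlargement

variable {S W : Type u} (E : Enlargement S W)

section ZeroObject

variable {C : Type*} [Category* C] [Preadditive C] [HasZeroObject C] [SmallCat S C]

instance hasZeroObject : HasZeroObject (E.Cat C) := by
  obtain ⟨Z, hZ⟩ := HasZeroObject.zero (C := C)
  have h : E.StarPred (fun X : C => Mor.ident X = Mor.zero X X) (E.std Z) :=
    (E.starPred_std _ _).2 (congr_arg Arrow.mk (hZ.eq_of_src _ _))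
  simp at h
  exact ⟨⟨⟨E.std Z⟩, (IsZero.iff_id_eq_zero _).2 (Cat.hom_ext h)⟩⟩

end ZeroObject

section Pretriangulated

variable {C : Type*} [Category* C] [Preadditive C] [HasZeroObject C] [HasShift C ℤ]
  [∀ n : ℤ, (shiftFunctor C n).Additive] [Pretriangulated C] [SmallCat S C]

/-- The enlargement of the set of the triples of morphisms that form a distinguished triangle. -/
def IsDistArr (f g h : E.Star (Arrow C)) : Prop := E.StarPred Mor.IsDist (E.pair f (E.pair g h))

@[simp] lemma starPred_isDist {G : Type*} [Coded S G] (x : E.Star G) (f g h : G → Arrow C) :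
    E.StarPred (fun x => Mor.IsDist (f x, g x, h x)) x ↔
      E.IsDistArr (E.starFun f x) (E.starFun g x) (E.starFun h x) := by
  rw [E.starPred_comp Mor.IsDist (fun x => (f x, g x, h x)) x, E.starFun_pair, E.starFun_pair]
  rfl

/-- This lemma and the next ones transfer the axioms of a pretriangulated category one at a time.
Each becomes a statement about finitely many elements of `Mor(C)`, in which composability is
expressed by equations between sources and targets. -/
lemma isDistArr_of_isIsoArr {f g h f' g' h' a b c : E.Star (Arrow C)}
    (hf : E.dom f' = E.dom a) (hf' : E.cod f' = E.dom b) (hg : E.dom g' = E.dom b)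
    (hg' : E.cod g' = E.dom c) (hh : E.dom h' = E.dom c)
    (hh' : E.cod h' = E.mapObj (shiftFunctor C (1 : ℤ)) (E.dom a))
    (ha : E.cod a = E.dom f) (hb : E.cod b = E.dom g) (hc : E.cod c = E.dom h)
    (hai : E.IsIsoArr a) (hbi : E.IsIsoArr b) (hci : E.IsIsoArr c)
    (h₁ : E.comp f' b = E.comp a f) (h₂ : E.comp g' c = E.comp b g)
    (h₃ : E.comp h' (E.mapArr (shiftFunctor C (1 : ℤ)) a) = E.comp c h)
    (hT : E.IsDistArr f g h) : E.IsDistArr f' g' h' := by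
  have := E.transfer_forall (P := fun f : Arrow C => ∀ g h f' g' h' a b c : Arrow C,
    Mor.dom f' = Mor.dom a → Mor.cod f' = Mor.dom b → Mor.dom g' = Mor.dom b →
    Mor.cod g' = Mor.dom c → Mor.dom h' = Mor.dom c →
    Mor.cod h' = (shiftFunctor C (1 : ℤ)).obj (Mor.dom a) →
    Mor.cod a = Mor.dom f → Mor.cod b = Mor.dom g → Mor.cod c = Mor.dom h →
    Mor.IsIso a → Mor.IsIso b → Mor.IsIso c → Mor.comp f' b = Mor.comp a f →
    Mor.comp g' c = Mor.comp b g →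
    Mor.comp h' (Mor.map (shiftFunctor C (1 : ℤ)) a) = Mor.comp c h → Mor.IsDist (f, g, h) →
    Mor.IsDist (f', g', h')) (by
      intro f g h f' g' h' a b c hf hf' hg hg' hh hh' ha hb hc hai hbi hci h₁ h₂ h₃ hT
      obtain ⟨T, hT', h⟩ := hT
      simp only [Prod.mk.injEq] at h
      obtain ⟨rfl, rfl, rfl⟩ := h
      obtain ⟨X', a, rfl⟩ := Mor.exists_mk_of_cod (Y := T.obj₁) ha
      obtain ⟨Y', b, rfl⟩ := Mor.exists_mk_of_cod (Y := T.obj₂) hb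
      obtain ⟨Z', c, rfl⟩ := Mor.exists_mk_of_cod (Y := T.obj₃) hc
      obtain ⟨f', rfl⟩ := Mor.exists_mk_of (X := X') (Y := Y') hf hf'
      obtain ⟨g', rfl⟩ := Mor.exists_mk_of (X := Y') (Y := Z') hg hg'
      obtain ⟨h', rfl⟩ := Mor.exists_mk_of (X := Z') (Y := X'⟦(1 : ℤ)⟧) hh hh'
      rw [Mor.isIso_mk_iff] at hai hbi hci
      rw [Mor.comp_mk, Mor.comp_mk, Mor.mk_inj] at h₁ h₂
      rw [Mor.map_mk, Mor.comp_mk, Mor.comp_mk, Mor.mk_inj] at h₃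
      rw [Mor.isDist_mk_iff]
      let ea := asIso a
      let eb := asIso b
      let ec := asIso c
      exact isomorphic_distinguished _ hT' _ (Triangle.isoMk _ _ ea eb ec h₁ h₂ h₃)) f
  simp at this
  exact this g h f' g' h' a b c hf hf' hg hg' hh hh' ha hb hc hai hbi hci h₁ h₂ h₃ hT

/-- The third object is any `Z` whose identity vanishes, since the zero object chosen in `*C` need
not be the image under `*` of the one chosen in `C`. -/
lemma isDistArr_contractible {X Z : E.Star C} (hZ : E.ident Z = E.zero Z Z) :
    E.IsDistArr (E.ident X) (E.zero X Z) (E.zero Z (E.mapObj (shiftFunctor C (1 : ℤ)) X)) := by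
  have := E.transfer_forall (P := fun X : C => ∀ Z : C, Mor.ident Z = Mor.zero Z Z →
    Mor.IsDist (Mor.ident X, Mor.zero X Z, Mor.zero Z ((shiftFunctor C (1 : ℤ)).obj X))) (by
      intro X Z hZ
      have hZ' : IsZero Z := (IsZero.iff_id_eq_zero _).2 (Mor.mk_inj.1 hZ)
      exact (Mor.isDist_mk_iff _ _ _).2 (isomorphic_distinguished _
        (contractible_distinguished X) _ (Triangle.isoMk _ _ (Iso.refl _) (Iso.refl _) hZ'.isoZero
          rfl ((isZero_zero C).eq_of_tgt _ _) (hZ'.eq_of_src _ _)))) X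
  simp at this
  exact this Z hZ

lemma exists_isDistArr (f : E.Star (Arrow C)) : ∃ g h : E.Star (Arrow C), E.dom g = E.cod f ∧
    E.dom h = E.cod g ∧ E.cod h = E.mapObj (shiftFunctor C (1 : ℤ)) (E.dom f) ∧
      E.IsDistArr f g h := by
  have := E.transfer_forall (P := fun f : Arrow C => ∃ g h : Arrow C, Mor.dom g = Mor.cod f ∧
    Mor.dom h = Mor.cod g ∧ Mor.cod h = (shiftFunctor C (1 : ℤ)).obj (Mor.dom f) ∧
      Mor.IsDist (f, g, h)) (by
      intro f
      obtain ⟨X, Y, f, rfl⟩ := Mor.exists_mk f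
      obtain ⟨Z, g, h, hT⟩ := distinguished_cocone_triangle f
      exact ⟨Arrow.mk g, Arrow.mk h, rfl, rfl, rfl, (Mor.isDist_mk_iff _ _ _).2 hT⟩) f
  simpa [-exists_and_left] using this

lemma isDistArr_rotate_iff {f g h : E.Star (Arrow C)} (hg : E.dom g = E.cod f)
    (hh : E.dom h = E.cod g) (hh' : E.cod h = E.mapObj (shiftFunctor C (1 : ℤ)) (E.dom f)) :
    E.IsDistArr f g h ↔ E.IsDistArr g h (E.neg (E.mapArr (shiftFunctor C (1 : ℤ)) f)) := by
  have := E.transfer_forall (P := fun f : Arrow C => ∀ g h : Arrow C, Mor.dom g = Mor.cod f →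
    Mor.dom h = Mor.cod g → Mor.cod h = (shiftFunctor C (1 : ℤ)).obj (Mor.dom f) →
      (Mor.IsDist (f, g, h) → Mor.IsDist (g, h, Mor.neg (Mor.map (shiftFunctor C (1 : ℤ)) f))) ∧
      (Mor.IsDist (g, h, Mor.neg (Mor.map (shiftFunctor C (1 : ℤ)) f)) →
        Mor.IsDist (f, g, h))) (by
      intro f g h hg hh hh'
      obtain ⟨X, Y, f, rfl⟩ := Mor.exists_mk f
      obtain ⟨Z, g, rfl⟩ := Mor.exists_mk_of_dom (X := Y) hg
      obtain ⟨h, rfl⟩ := Mor.exists_mk_of (X := Z) (Y := X⟦(1 : ℤ)⟧) hh hh'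
      have := rotate_distinguished_triangle (Triangle.mk f g h)
      exact ⟨fun hT => ⟨_, this.1 ((Mor.isDist_mk_iff _ _ _).1 hT), rfl⟩,
        fun hT => ⟨_, this.2 ((Mor.isDist_mk_iff g h (-f⟦1⟧')).1 hT), rfl⟩⟩) f
  simp at this
  exact ⟨(this g h hg hh hh').1, (this g h hg hh hh').2⟩

lemma exists_isDistArr_morphism {f g h f' g' h' a b : E.Star (Arrow C)}
    (hT : E.IsDistArr f g h) (hT' : E.IsDistArr f' g' h') (ha : E.dom a = E.dom f)
    (ha' : E.cod a = E.dom f') (hb : E.dom b = E.cod f) (hb' : E.cod b = E.cod f')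
    (hab : E.comp f b = E.comp a f') : ∃ c : E.Star (Arrow C), E.dom c = E.cod g ∧
      E.cod c = E.cod g' ∧ E.comp g c = E.comp b g' ∧
      E.comp h (E.mapArr (shiftFunctor C (1 : ℤ)) a) = E.comp c h' := by
  have := E.transfer_forall (P := fun f : Arrow C => ∀ g h f' g' h' a b : Arrow C,
    Mor.IsDist (f, g, h) → Mor.IsDist (f', g', h') → Mor.dom a = Mor.dom f →
    Mor.cod a = Mor.dom f' → Mor.dom b = Mor.cod f → Mor.cod b = Mor.cod f' →
    Mor.comp f b = Mor.comp a f' → ∃ c : Arrow C, Mor.dom c = Mor.cod g ∧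
      Mor.cod c = Mor.cod g' ∧ Mor.comp g c = Mor.comp b g' ∧
      Mor.comp h (Mor.map (shiftFunctor C (1 : ℤ)) a) = Mor.comp c h') (by
      intro f g h f' g' h' a b hT hT' ha ha' hb hb' hab
      obtain ⟨T, hT, eT⟩ := hT
      obtain ⟨T', hT', eT'⟩ := hT'
      simp only [Prod.mk.injEq] at eT eT'
      obtain ⟨rfl, rfl, rfl⟩ := eT
      obtain ⟨rfl, rfl, rfl⟩ := eT'
      obtain ⟨a, rfl⟩ := Mor.exists_mk_of (X := T.obj₁) (Y := T'.obj₁) ha ha'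
      obtain ⟨b, rfl⟩ := Mor.exists_mk_of (X := T.obj₂) (Y := T'.obj₂) hb hb'
      rw [Mor.comp_mk, Mor.comp_mk, Mor.mk_inj] at hab
      obtain ⟨c, hc, hc'⟩ := complete_distinguished_triangle_morphism _ _ hT hT' a b hab
      refine ⟨Arrow.mk c, rfl, rfl, ?_, ?_⟩
      · rw [Mor.comp_mk, Mor.comp_mk, hc]
      · rw [Mor.map_mk, Mor.comp_mk, Mor.comp_mk, hc']) f
  simp [-exists_and_left] at this
  exact this g h f' g' h' a b hT hT' ha ha' hb hb' hab

/-- The distinguished triangles of `*C` are the elements of the enlargement of the set of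
distinguished triangles of `C`. -/
instance pretriangulated : Pretriangulated (E.Cat C) where
  distinguishedTriangles :=
    {T | E.IsDistArr (Cat.arr T.mor₁) (Cat.arr T.mor₂) (Cat.arr T.mor₃)}
  isomorphic_distinguished T hT T' e := by
    have hi : ∀ {X Y : E.Cat C} (f : X ⟶ Y) [IsIso f], E.IsIsoArr (Cat.arr f) :=
      fun f _ => (E.isIsoArr_iff f).2 inferInstance
    exact E.isDistArr_of_isIsoArr (a := Cat.arr e.hom.hom₁) (b := Cat.arr e.hom.hom₂)
      (c := Cat.arr e.hom.hom₃) (by simp) (by simp) (by simp) (by simp) (by simp)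
      (by rw [Cat.cod_arr, Cat.dom_arr]; rfl) (by simp) (by simp) (by simp) (hi _) (hi _) (hi _)
      (congr_arg Cat.arr e.hom.comm₁) (congr_arg Cat.arr e.hom.comm₂)
      (congr_arg Cat.arr e.hom.comm₃) hT
  contractible_distinguished X :=
    E.isDistArr_contractible (congr_arg Cat.arr
      ((isZero_zero (E.Cat C)).eq_of_src (𝟙 _) 0))
  distinguished_cocone_triangle {X Y} f := by
    obtain ⟨g, h, hg, hh, hh', hT⟩ := E.exists_isDistArr (Cat.arr f)
    exact ⟨⟨E.cod g⟩, Cat.homMk g (hg.trans (Cat.cod_arr f)) rfl,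
      Cat.homMk h hh (hh'.trans (congr_arg _ (Cat.dom_arr f))), hT⟩
  rotate_distinguished_triangle T :=
    E.isDistArr_rotate_iff (by simp) (by simp) (by rw [Cat.cod_arr, Cat.dom_arr]; rfl)
  complete_distinguished_triangle_morphism T T' hT hT' a b hab := by
    obtain ⟨c, hc, hc', h, h'⟩ := E.exists_isDistArr_morphism hT hT' (a := Cat.arr a)
      (b := Cat.arr b) (by simp) (by simp) (by simp) (by simp) (congr_arg Cat.arr hab)
    exact ⟨Cat.homMk c (hc.trans (Cat.cod_arr _)) (hc'.trans (Cat.cod_arr _)), Cat.hom_ext h,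
      Cat.hom_ext h'⟩

lemma mem_distinguishedTriangles_iff (T : Triangle (E.Cat C)) : T ∈ distTriang (E.Cat C) ↔
    E.IsDistArr (Cat.arr T.mor₁) (Cat.arr T.mor₂) (Cat.arr T.mor₃) := Iff.rfl

end Pretriangulated

end Enlargement

/-! ### Mapping cones of `*`-complexes, and `res` as a triangulated functor -/

open Pretriangulated CochainComplex

section

variable {C : Type*} [Category* C] [Abelian C]

/-- In the homotopy category, triangles of degreewise split extensions are distinguished, and the
functor `Qh` to the derived category is triangulated. -/
lemma Q_mapTriangle_triangleOfDegreewiseSplit_distinguished (T : ShortComplex (CochainComplex C ℤ))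
    (σ : ∀ n, (T.map (HomologicalComplex.eval C _ n)).Splitting) :
    DerivedCategory.Q.mapTriangle.obj (triangleOfDegreewiseSplit T σ) ∈ distTriang _ :=
  isomorphic_distinguished _ (DerivedCategory.Qh.map_distinguished _
    ((HomotopyCategory.distinguished_iff_iso_trianglehOfDegreewiseSplit _).2
      ⟨T, σ, ⟨Iso.refl _⟩⟩)) _
    ((Functor.mapTriangleIso (DerivedCategory.quotientCompQhIso C)).symm.app _ ≪≫
      (Functor.mapTriangleCompIso (HomotopyCategory.quotient C _) DerivedCategory.Qh).app _)

end

namespace Enlargement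

variable {S W : Type u} (E : Enlargement S W)

section

variable {E} {C : Type*} [Category* C] [SmallCat S C] {G : Type*} [Coded S G]

/-- The member with index `x ∈ *G` of the enlargement of a family of morphisms, between objects
that are the members of the families of sources and targets. -/
noncomputable def memberHom (x : E.Star G) {a b : G → C} (φ : ∀ t, a t ⟶ b t) {X Y : E.Cat C}
    (hX : X.pt = E.starFun a x) (hY : Y.pt = E.starFun b x) : X ⟶ Y :=
  Cat.homMk (E.starFun (fun t => Arrow.mk (φ t)) x) (by rw [hX, ← starFun_dom]; rfl)
    (by rw [hY, ← starFun_cod]; rfl)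

lemma isMember_memberHom (x : E.Star G) {a b : G → C} (φ : ∀ t, a t ⟶ b t) {X Y : E.Cat C}
    (hX : X.pt = E.starFun a x) (hY : Y.pt = E.starFun b x) :
    IsMember x (memberHom x φ hX hY) φ := rfl

end

variable [Infinite S] {A : Type v} [Category.{w} A] [Abelian A] [SmallCat S A]

section

variable {E} {K L : E.Cat (CochainComplex A ℤ)} (f : K ⟶ L)

/-- The mapping cone of a morphism of `*`-complexes. -/
noncomputable def cone : E.Cat (CochainComplex A ℤ) :=
  ⟨E.starFun (fun t : Arrow (CochainComplex A ℤ) => mappingCone t.hom) (Cat.arr f)⟩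

/-- The inclusion into the mapping cone of a morphism of `*`-complexes. -/
noncomputable def coneInr : L ⟶ cone f :=
  memberHom (Cat.arr f) (fun t : Arrow (CochainComplex A ℤ) => mappingCone.inr t.hom)
    (IsMember.self f).target rfl

lemma isMember_coneInr : IsMember (Cat.arr f) (coneInr f) (fun t => mappingCone.inr t.hom) := rfl

lemma pt_shift_source (n : ℤ) : (K⟦n⟧).pt =
    E.starFun (fun t : Arrow (CochainComplex A ℤ) => t.left⟦n⟧) (Cat.arr f) :=
  ((IsMember.self f).map (CategoryTheory.shiftFunctor _ n)).source

/-- The connecting morphism of the mapping cone of a morphism of `*`-complexes. -/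
noncomputable def coneδ : cone f ⟶ K⟦(1 : ℤ)⟧ :=
  memberHom (Cat.arr f) (fun t : Arrow (CochainComplex A ℤ) => (mappingCone.triangle t.hom).mor₃)
    rfl (pt_shift_source f 1)

lemma isMember_coneδ :
    IsMember (Cat.arr f) (coneδ f) (fun t => (mappingCone.triangle t.hom).mor₃) := rfl

/-- The triangle of the mapping cone of a morphism of `*`-complexes. -/
noncomputable abbrev coneTriangle : Triangle (E.Cat (CochainComplex A ℤ)) :=
  Triangle.mk f (coneInr f) (coneδ f)

/-- The image triangle is the member, at index `f`, of the family of mapping cone triangles in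
`D(A)` of all morphisms of complexes, and each triangle of that family is distinguished. -/
lemma mapFunctor_Q_coneTriangle_distinguished :
    (E.mapFunctor DerivedCategory.Q).mapTriangle.obj (coneTriangle f) ∈ distTriang _ := by
  have h₃ : IsMember (Cat.arr f)
      (((E.mapFunctor DerivedCategory.Q).mapTriangle.obj (coneTriangle f)).mor₃)
      (fun t => DerivedCategory.Q.map (mappingCone.triangle t.hom).mor₃ ≫
        (DerivedCategory.Q.commShiftIso (1 : ℤ)).hom.app t.left) :=
    ((isMember_coneδ f).map DerivedCategory.Q).comp
      ((E.isMember_commShiftIso_hom_app DerivedCategory.Q (1 : ℤ) K).reindex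
        (fun t : Arrow (CochainComplex A ℤ) => t.left) (IsMember.self f).source)
  have h₂ : IsMember (Cat.arr f)
      (((E.mapFunctor DerivedCategory.Q).mapTriangle.obj (coneTriangle f)).mor₂)
      (fun t => DerivedCategory.Q.map (mappingCone.inr t.hom)) :=
    (isMember_coneInr f).map DerivedCategory.Q
  have h₁ : IsMember (Cat.arr f)
      (((E.mapFunctor DerivedCategory.Q).mapTriangle.obj (coneTriangle f)).mor₁)
      (fun t => DerivedCategory.Q.map t.hom) :=
    (IsMember.self f).map DerivedCategory.Q
  rw [mem_distinguishedTriangles_iff, show Cat.arr _ = _ from h₁, show Cat.arr _ = _ from h₂,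
    show Cat.arr _ = _ from h₃, ← starPred_isDist]
  exact E.transfer_forall (fun t => ⟨_, DerivedCategory.mappingCone_triangle_distinguished t.hom,
    rfl⟩) _

end

/-- A distinguished triangle is determined up to isomorphism by its first morphism. Written as a
fraction `s⁻¹g`, that morphism becomes the image of `g` once the source is replaced along the
isomorphism induced by `s`. -/
lemma exists_iso_mapTriangle_coneTriangle (T : Triangle (E.Cat (DerivedCategory A)))
    (hT : T ∈ distTriang _) : ∃ (K L : E.Cat (CochainComplex A ℤ)) (f : K ⟶ L),
      Nonempty (T ≅ (E.mapFunctor DerivedCategory.Q).mapTriangle.obj (coneTriangle f)) := by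
  let eX := (E.mapFunctor DerivedCategory.Q).objObjPreimageIso T.obj₁
  let eY := (E.mapFunctor DerivedCategory.Q).objObjPreimageIso T.obj₂
  obtain ⟨K, s, hs, g, hg⟩ := E.mapFunctor_exists_fraction (L := DerivedCategory.Q (C := A))
    (fun X Y f => by
      obtain ⟨X', s, hs, g, rfl⟩ := DerivedCategory.right_fac f
      exact ⟨X', s, hs, g, by simp⟩) (eX.hom ≫ T.mor₁ ≫ eY.inv)
  let eX' := asIso ((E.mapFunctor DerivedCategory.Q).map s) ≪≫ eX
  have hg' : eX'.inv ≫ (E.mapFunctor DerivedCategory.Q).map g = T.mor₁ ≫ eY.inv := by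
    rw [Iso.inv_comp_eq, ← hg]
    exact (Category.assoc _ _ _).symm
  obtain ⟨e, -⟩ := exists_iso_of_arrow_iso T _ hT (mapFunctor_Q_coneTriangle_distinguished g)
    (Arrow.isoMk (f := Arrow.mk T.mor₁) (g := Arrow.mk ((E.mapFunctor DerivedCategory.Q).map g))
      eX'.symm eY.symm hg')
  exact ⟨K, _, g, ⟨e⟩⟩

section

variable {E} {K L : E.Cat (CochainComplex A ℤ)} (f : K ⟶ L)

instance : (E.restriction A).Additive where
  map_add := by
    intros
    ext i
    exact (E.mapFunctor (HomologicalComplex.eval A _ i)).map_add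

lemma coneInr_comp_coneδ : coneInr f ≫ coneδ f = 0 :=
  ((isMember_coneInr f).comp (isMember_coneδ f)).eq
    (IsMember.zero (IsMember.self f).target (pt_shift_source f 1)) (fun t =>
      congr_arg Arrow.mk (mappingCone.triangleRotateShortComplex t.hom).zero)

/-- The restriction of the rotated triangle of a mapping cone, as a short complex. -/
noncomputable def coneShortComplex : ShortComplex (CochainComplex (E.Cat A) ℤ) where
  f := (E.restriction A).map (coneInr f)
  g := (E.restriction A).map (coneδ f) ≫ ((E.restriction A).commShiftIso (1 : ℤ)).hom.app K
  zero := by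
    rw [← Category.assoc, ← Functor.map_comp, coneInr_comp_coneδ, Functor.map_zero, zero_comp]

lemma isMember_coneShortComplex_f_f (n : ℤ) : IsMember (Cat.arr f) ((coneShortComplex f).f.f n)
    (fun t => (mappingCone.inr t.hom).f n) :=
  (isMember_coneInr f).restriction_map_f n

lemma isMember_coneShortComplex_g_f (n : ℤ) : IsMember (Cat.arr f) ((coneShortComplex f).g.f n)
    (fun t => (mappingCone.triangle t.hom).mor₃.f n) := by
  have h : IsMember (Cat.arr f) (((E.restriction A).commShiftIso (1 : ℤ)).hom.app K |>.f n)
      (fun t => 𝟙 ((t.left⟦(1 : ℤ)⟧).X n)) :=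
    (E.isMember_restrictionShiftXIso_hom 1 K n).reindex
      (fun t : Arrow (CochainComplex A ℤ) => t.left) (IsMember.self f).source
  exact (((isMember_coneδ f).restriction_map_f n).comp h).congr (fun t =>
    congr_arg Arrow.mk (Category.comp_id _))

lemma isMember_coneShortComplex_d (i j : ℤ) : IsMember (Cat.arr f)
    ((coneShortComplex f).X₂.d i j) (fun t => (mappingCone t.hom).d i j) :=
  IsMember.reindex (x := (cone f).pt) _ rfl (E.isMember_restriction_d (cone f) i j)

/-- The restriction of the rotated triangle of a mapping cone is split in each degree. -/
noncomputable def coneSplitting (n : ℤ) :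
    ((coneShortComplex f).map (HomologicalComplex.eval _ _ n)).Splitting where
  r := memberHom (Cat.arr f)
    (fun t => (mappingCone.triangleRotateShortComplexSplitting t.hom n).r)
    (isMember_coneShortComplex_f_f f n).target (isMember_coneShortComplex_f_f f n).source
  s := memberHom (Cat.arr f)
    (fun t => (mappingCone.triangleRotateShortComplexSplitting t.hom n).s)
    (isMember_coneShortComplex_g_f f n).target (isMember_coneShortComplex_g_f f n).source
  f_r := ((isMember_coneShortComplex_f_f f n).comp (isMember_memberHom _ _ _ _)).eq
    (IsMember.id (isMember_coneShortComplex_f_f f n).source) (fun t => congr_arg Arrow.mk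
      (mappingCone.triangleRotateShortComplexSplitting t.hom n).f_r)
  s_g := ((isMember_memberHom _ _ _ _).comp (isMember_coneShortComplex_g_f f n)).eq
    (IsMember.id (isMember_coneShortComplex_g_f f n).target) (fun t => congr_arg Arrow.mk
      (mappingCone.triangleRotateShortComplexSplitting t.hom n).s_g)
  id := (((isMember_memberHom _ _ _ _).comp (isMember_coneShortComplex_f_f f n)).add
    ((isMember_coneShortComplex_g_f f n).comp (isMember_memberHom _ _ _ _))).eq
    (IsMember.id (isMember_coneShortComplex_f_f f n).target) (fun t => congr_arg Arrow.mk
      (mappingCone.triangleRotateShortComplexSplitting t.hom n).id)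

lemma isMember_coneSplitting_s (n : ℤ) : IsMember (Cat.arr f) (coneSplitting f n).s
    (fun t => (mappingCone.triangleRotateShortComplexSplitting t.hom n).s) := rfl

lemma isMember_coneSplitting_r (n : ℤ) : IsMember (Cat.arr f) (coneSplitting f n).r
    (fun t => (mappingCone.triangleRotateShortComplexSplitting t.hom n).r) := rfl

/-- The connecting morphism of a degreewise split extension is computed from section, differential
and retraction. All three are members of the corresponding families for mapping cones in `Kom(A)`,
where the result is `-f` in degree `n + 1`. -/
lemma homOfDegreewiseSplit_coneSplitting :
    homOfDegreewiseSplit (coneShortComplex f) (coneSplitting f) =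
      -((E.restriction A).map f)⟦(1 : ℤ)⟧' := by
  ext n
  rw [homOfDegreewiseSplit_f]
  have h : IsMember (Cat.arr f)
      ((cocycleOfDegreewiseSplit (coneShortComplex f) (coneSplitting f)).1.v n (n + 1) rfl)
      (fun t => (cocycleOfDegreewiseSplit _
        (mappingCone.triangleRotateShortComplexSplitting t.hom)).1.v n (n + 1) rfl) :=
    (isMember_coneSplitting_s f n).comp ((isMember_coneShortComplex_d f n (n + 1)).comp
      (isMember_coneSplitting_r f (n + 1)))
  have h' : IsMember (Cat.arr f) (-((E.restriction A).map f).f (n + 1))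
      (fun t => -t.hom.f (n + 1)) := (E.isMember_restriction_map_f f (n + 1)).neg
  exact h.eq h' (fun t => congr_arg Arrow.mk
    (mappingCone.cocycleOfDegreewiseSplit_triangleRotateShortComplexSplitting_v t.hom n))

/-- The rotated triangle `L ⟶ cone f ⟶ K⟦1⟧ ⟶ L⟦1⟧` is the one that comes from a degreewise split
extension. Working with it avoids a comparison of the restriction of the internal cone with the cone
of the restricted morphism. -/
lemma rotate_restriction_coneTriangle :
    ((E.restriction A).mapTriangle.obj (coneTriangle f)).rotate =
      triangleOfDegreewiseSplit (coneShortComplex f) (coneSplitting f) := by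
  rw [triangleOfDegreewiseSplit, homOfDegreewiseSplit_coneSplitting]
  rfl

/-- The restriction of the triangle of a mapping cone is distinguished in the derived category. -/
lemma Q_mapTriangle_restriction_coneTriangle_distinguished :
    DerivedCategory.Q.mapTriangle.obj ((E.restriction A).mapTriangle.obj (coneTriangle f)) ∈
      distTriang _ := by
  rw [rotate_distinguished_triangle]
  exact isomorphic_distinguished _ (Q_mapTriangle_triangleOfDegreewiseSplit_distinguished
    (coneShortComplex f) (coneSplitting f)) _
    (DerivedCategory.Q.mapTriangleRotateIso.app _ ≪≫
      DerivedCategory.Q.mapTriangle.mapIso (eqToIso (rotate_restriction_coneTriangle f)))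

end

variable (A)

/-- Through `resFac`, the image of the triangle of an internal cone is the image under `Q` of its
restriction, and every distinguished triangle is isomorphic to the triangle of such a cone. -/
instance : (E.res A).IsTriangulated where
  map_distinguished T hT := by
    obtain ⟨K, L, f, ⟨e⟩⟩ := E.exists_iso_mapTriangle_coneTriangle T hT
    exact isomorphic_distinguished _ (Q_mapTriangle_restriction_coneTriangle_distinguished f) _
      ((E.res A).mapTriangle.mapIso e ≪≫ (Functor.mapTriangleCompIso _ _).symm.app _ ≪≫
        (Functor.mapTriangleIso (E.resFac A)).app _ ≪≫ (Functor.mapTriangleCompIso _ _).app _)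

end Enlargement

end Enlarging

/-! ### Dévissage: bijectivity of a triangulated functor on morphisms, extended from generators -/

namespace CategoryTheory.Functor

open Category Pretriangulated ZeroObject

variable {C : Type*} {D : Type*} [Category* C] [Category* D] (F : C ⥤ D)

/-- `F` is bijective on morphisms from `X` to `Y`. -/
def BijOn (X Y : C) : Prop := Function.Bijective (F.map : (X ⟶ Y) → (F.obj X ⟶ F.obj Y))

variable {F}

lemma BijOn.of_iso_left {X X' Y : C} (e : X ≅ X') (h : F.BijOn X Y) : F.BijOn X' Y := by
  constructor
  · intro f g hfg
    have := h.1 (a₁ := e.hom ≫ f) (a₂ := e.hom ≫ g) (by simp only [F.map_comp, hfg])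
    simpa using this
  · intro k
    obtain ⟨f, hf⟩ := h.2 (F.map e.hom ≫ k)
    exact ⟨e.inv ≫ f, by rw [F.map_comp, hf, ← assoc, ← F.map_comp]; simp⟩

lemma BijOn.of_iso_right {X Y Y' : C} (e : Y ≅ Y') (h : F.BijOn X Y) : F.BijOn X Y' := by
  constructor
  · intro f g hfg
    have := h.1 (a₁ := f ≫ e.inv) (a₂ := g ≫ e.inv) (by simp only [F.map_comp, hfg])
    simpa using this
  · intro k
    obtain ⟨f, hf⟩ := h.2 (k ≫ F.map e.inv)
    exact ⟨f ≫ e.hom, by rw [F.map_comp, hf, assoc, ← F.map_comp]; simp⟩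

lemma BijOn.shift [HasShift C ℤ] [HasShift D ℤ] [F.CommShift ℤ] {X Y : C} (h : F.BijOn X Y)
    (n : ℤ) : F.BijOn (X⟦n⟧) (Y⟦n⟧) := by
  have h1 : ∀ f : X ⟶ Y, F.map (f⟦n⟧') =
      (F.commShiftIso n).hom.app X ≫ (F.map f)⟦n⟧' ≫ (F.commShiftIso n).inv.app Y := by
    intro f
    have := (F.commShiftIso n).hom.naturality f
    dsimp at this
    rw [← assoc, ← this]
    simp
  constructor
  · intro f g hfg
    obtain ⟨f, rfl⟩ := (shiftFunctor C n).map_surjective f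
    obtain ⟨g, rfl⟩ := (shiftFunctor C n).map_surjective g
    rw [h1, h1, cancel_epi, cancel_mono] at hfg
    rw [h.1 ((shiftFunctor D n).map_injective hfg)]
  · intro k
    obtain ⟨l, hl⟩ := (shiftFunctor D n).map_surjective
      ((F.commShiftIso n).inv.app X ≫ k ≫ (F.commShiftIso n).hom.app Y)
    obtain ⟨f, rfl⟩ := h.2 l
    refine ⟨f⟦n⟧', ?_⟩
    rw [h1, hl]
    simp

variable [HasShift C ℤ] [HasShift D ℤ] [F.CommShift ℤ]

/-- Moves a shift from the target to the source, to pass between the conditions `bijOnRight` and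
`bijOnLeft`. -/
lemma BijOn.of_shift_right {X Y : C} (n : ℤ) (h : F.BijOn X (Y⟦n⟧)) : F.BijOn (X⟦-n⟧) Y :=
  (h.shift (-n)).of_iso_right ((shiftEquiv C n).unitIso.app Y).symm

variable [HasZeroObject C] [HasZeroObject D] [Preadditive C] [Preadditive D]
  [∀ n : ℤ, (shiftFunctor C n).Additive] [∀ n : ℤ, (shiftFunctor D n).Additive]
  [Pretriangulated C] [Pretriangulated D] [F.IsTriangulated]

lemma bijOn_of_isZero_left {X Y : C} (hX : IsZero X) : F.BijOn X Y :=
  ⟨fun _ _ _ => hX.eq_of_src _ _, fun _ => ⟨0, (F.map_isZero hX).eq_of_src _ _⟩⟩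

lemma bijOn_of_isZero_right {X Y : C} (hY : IsZero Y) : F.BijOn X Y :=
  ⟨fun _ _ _ => hY.eq_of_tgt _ _, fun _ => ⟨0, (F.map_isZero hY).eq_of_tgt _ _⟩⟩

lemma BijOn.eq_zero {X Y : C} (h : F.BijOn X Y) {f : X ⟶ Y} (hf : F.map f = 0) : f = 0 :=
  h.1 (by rw [hf, F.map_zero])

/-- The inverse rotation. Only the middle morphism is recorded, since the five-lemma arguments need
no description of the other two. -/
lemma exists_distinguished_of_mor₁ {T : Triangle C} (hT : T ∈ distTriang C) :
    ∃ (t : T.obj₃⟦(-1 : ℤ)⟧ ⟶ T.obj₁) (g : T.obj₂ ⟶ (T.obj₃⟦(-1 : ℤ)⟧)⟦(1 : ℤ)⟧),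
      Triangle.mk t T.mor₁ g ∈ distTriang C :=
  ⟨_, _, inv_rot_of_distTriang _ hT⟩

lemma map_coyoneda_exact₂ {T : Triangle C} (hT : T ∈ distTriang C) {X : D} (f : X ⟶ F.obj T.obj₂)
    (hf : f ≫ F.map T.mor₂ = 0) : ∃ g : X ⟶ F.obj T.obj₁, f = g ≫ F.map T.mor₁ :=
  Triangle.coyoneda_exact₂ _ (F.map_distinguished _ hT) f hf

lemma map_yoneda_exact₂ {T : Triangle C} (hT : T ∈ distTriang C) {X : D} (f : F.obj T.obj₂ ⟶ X)
    (hf : F.map T.mor₁ ≫ f = 0) : ∃ g : F.obj T.obj₃ ⟶ X, f = F.map T.mor₂ ≫ g :=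
  Triangle.yoneda_exact₂ _ (F.map_distinguished _ hT) f hf

lemma map_yoneda_exact₃ {T : Triangle C} (hT : T ∈ distTriang C) {X : D} (f : F.obj T.obj₃ ⟶ X)
    (hf : F.map T.mor₂ ≫ f = 0) : ∃ g : F.obj (T.obj₁⟦(1 : ℤ)⟧) ⟶ X, f = F.map T.mor₃ ≫ g :=
  map_yoneda_exact₂ (rot_of_distTriang _ hT) f hf

/-- The five lemma for the exact sequences of morphisms into `Y` and into `F.obj Y`. Injectivity
uses the terms at `T.obj₁`, `T.obj₃` and `T.obj₁⟦1⟧`; surjectivity those at `T.obj₃⟦-1⟧`, `T.obj₁`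
and `T.obj₃`. -/
lemma bijOn_ext₂_left {T : Triangle C} (hT : T ∈ distTriang C) {Y : C}
    (h₁ : F.BijOn T.obj₁ Y) (h₃ : F.BijOn T.obj₃ Y) (h₄ : F.BijOn (T.obj₁⟦(1 : ℤ)⟧) Y)
    (h₀ : F.BijOn (T.obj₃⟦(-1 : ℤ)⟧) Y) : F.BijOn T.obj₂ Y := by
  constructor
  · rw [← F.coe_mapAddHom, injective_iff_map_eq_zero]
    intro a (ha : F.map a = 0)
    obtain ⟨b, rfl⟩ := Triangle.yoneda_exact₂ T hT a
      (h₁.eq_zero (by rw [F.map_comp, ha, comp_zero]))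
    obtain ⟨c, hc⟩ := map_yoneda_exact₃ hT (F.map b) (by rw [← F.map_comp, ha])
    obtain ⟨d, rfl⟩ := h₄.2 c
    rw [← F.map_comp] at hc
    rw [h₃.1 hc, ← assoc, comp_distTriang_mor_zero₂₃ _ hT, zero_comp]
  · intro k
    obtain ⟨a, ha⟩ := h₁.2 (F.map T.mor₁ ≫ k)
    obtain ⟨t, g, hT'⟩ := exists_distinguished_of_mor₁ hT
    have h0 : t ≫ T.mor₁ = 0 := comp_distTriang_mor_zero₁₂ _ hT'
    -- The preimage `a` of the restriction of `k` extends to `T.obj₂`, because its obstruction on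
    -- `T.obj₃⟦-1⟧` is killed by `F`. The remaining difference `k - F.map b` then comes from
    -- `T.obj₃`.
    obtain ⟨b, hb⟩ : ∃ b : T.obj₂ ⟶ Y, a = T.mor₁ ≫ b :=
      Triangle.yoneda_exact₂ _ hT' a (h₀.eq_zero (by
        change F.map (t ≫ a) = 0
        rw [F.map_comp, ha, ← assoc, ← F.map_comp, h0, F.map_zero, zero_comp]))
    obtain ⟨c, hc⟩ := map_yoneda_exact₂ hT (k - F.map b) (by
      rw [Preadditive.comp_sub, ← ha, hb, F.map_comp, sub_self])
    obtain ⟨d, rfl⟩ := h₃.2 c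
    refine ⟨b + T.mor₂ ≫ d, ?_⟩
    rw [F.map_add, F.map_comp, ← hc, add_sub_cancel]

lemma bijOn_ext₂_right {T : Triangle C} (hT : T ∈ distTriang C) {X : C}
    (h₁ : F.BijOn X T.obj₁) (h₃ : F.BijOn X T.obj₃) (h₄ : F.BijOn X (T.obj₁⟦(1 : ℤ)⟧))
    (h₀ : F.BijOn X (T.obj₃⟦(-1 : ℤ)⟧)) : F.BijOn X T.obj₂ := by
  constructor
  · rw [← F.coe_mapAddHom, injective_iff_map_eq_zero]
    intro a (ha : F.map a = 0)
    obtain ⟨b, rfl⟩ := Triangle.coyoneda_exact₂ T hT a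
      (h₃.eq_zero (by rw [F.map_comp, ha, zero_comp]))
    obtain ⟨t, g, hT'⟩ := exists_distinguished_of_mor₁ hT
    have h0 : t ≫ T.mor₁ = 0 := comp_distTriang_mor_zero₁₂ _ hT'
    obtain ⟨c, hc⟩ : ∃ c : F.obj X ⟶ F.obj (T.obj₃⟦(-1 : ℤ)⟧), F.map b = c ≫ F.map t :=
      map_coyoneda_exact₂ hT' (F.map b) ((F.map_comp _ _).symm.trans ha)
    obtain ⟨d, rfl⟩ := h₀.2 c
    rw [← F.map_comp] at hc
    rw [h₁.1 hc, assoc, h0, comp_zero]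
  · intro k
    obtain ⟨a, ha⟩ := h₃.2 (k ≫ F.map T.mor₂)
    obtain ⟨b, hb⟩ := Triangle.coyoneda_exact₃ _ hT a
      (h₄.eq_zero (by rw [F.map_comp, ha, assoc, ← F.map_comp, comp_distTriang_mor_zero₂₃ _ hT,
        F.map_zero, comp_zero]))
    obtain ⟨c, hc⟩ := map_coyoneda_exact₂ hT (k - F.map b) (by
      rw [Preadditive.sub_comp, ← ha, hb, F.map_comp, sub_self])
    obtain ⟨d, rfl⟩ := h₁.2 c
    refine ⟨b + d ≫ T.mor₁, ?_⟩
    rw [F.map_add, F.map_comp, ← hc, add_sub_cancel]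

variable (F)

/-- The objects `X` such that `F` is bijective on morphisms from all shifts of `X` to `Y`. -/
def bijOnLeft (Y : C) : ObjectProperty C := fun X => ∀ n : ℤ, F.BijOn (X⟦n⟧) Y

/-- The objects `Y` such that `F` is bijective on morphisms from `X` to all shifts of `Y`. -/
def bijOnRight (X : C) : ObjectProperty C := fun Y => ∀ n : ℤ, F.BijOn X (Y⟦n⟧)

instance (Y : C) : (F.bijOnLeft Y).IsClosedUnderIsomorphisms where
  of_iso e h n := (h n).of_iso_left ((shiftFunctor C n).mapIso e)

instance (X : C) : (F.bijOnRight X).IsClosedUnderIsomorphisms where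
  of_iso e h n := (h n).of_iso_right ((shiftFunctor C n).mapIso e)

/-- Requiring bijectivity for all shifts makes the class stable under shifts and provides the outer
terms of the five lemma, which are the shifts by `n + 1` and `n - 1`. -/
instance (Y : C) : (F.bijOnLeft Y).IsTriangulated where
  exists_zero := ⟨0, isZero_zero C, fun n =>
    bijOn_of_isZero_left ((shiftFunctor C n).map_isZero (isZero_zero C))⟩
  isStableUnderShiftBy m := ⟨fun X h n =>
    (h (m + n)).of_iso_left ((shiftFunctorAdd C m n).app X)⟩
  toIsTriangulatedClosed₂ := .mk' fun T hT h₁ h₃ n => by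
    refine bijOn_ext₂_left (Triangle.shift_distinguished T hT n) (h₁ n) (h₃ n) ?_ ?_
    · exact (h₁ (n + 1)).of_iso_left ((shiftFunctorAdd C n 1).app _)
    · exact (h₃ (n + (-1))).of_iso_left ((shiftFunctorAdd C n (-1)).app _)

instance (X : C) : (F.bijOnRight X).IsTriangulated where
  exists_zero := ⟨0, isZero_zero C, fun n =>
    bijOn_of_isZero_right ((shiftFunctor C n).map_isZero (isZero_zero C))⟩
  isStableUnderShiftBy m := ⟨fun Y h n =>
    (h (m + n)).of_iso_right ((shiftFunctorAdd C m n).app Y)⟩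
  toIsTriangulatedClosed₂ := .mk' fun T hT h₁ h₃ n => by
    refine bijOn_ext₂_right (Triangle.shift_distinguished T hT n) (h₁ n) (h₃ n) ?_ ?_
    · exact (h₁ (n + 1)).of_iso_right ((shiftFunctorAdd C n 1).app _)
    · exact (h₃ (n + (-1))).of_iso_right ((shiftFunctorAdd C n (-1)).app _)

variable {F}

/-- A triangulated functor that is bijective on morphisms between shifts of objects of `H` is so
on morphisms between objects of any `P` contained in the triangulated subcategories that
contain `H`. -/
lemma bijOn_of_generators {H P : ObjectProperty C}
    (hP : ∀ Q : ObjectProperty C, ∀ [Q.IsTriangulated], ∀ [Q.IsClosedUnderIsomorphisms],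
      H ≤ Q → P ≤ Q)
    (hF : ∀ X Y, H X → H Y → ∀ n : ℤ, F.BijOn X (Y⟦n⟧)) {X Y : C} (hX : P X) (hY : P Y) :
    F.BijOn X Y := by
  -- First the target varies while the source is a generator; then the source varies with the target
  -- fixed.
  have h1 : ∀ X, H X → F.bijOnRight X Y := fun X hX =>
    hP (F.bijOnRight X) (fun Y hY => hF X Y hX hY) Y hY
  have h2 : F.bijOnLeft Y X := hP (F.bijOnLeft Y) (fun X hX n => by
    have := (h1 X hX (-n)).of_shift_right
    rwa [neg_neg] at this) X hX
  exact (h2 0).of_iso_left ((shiftFunctorZero C ℤ).app X)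

end CategoryTheory.Functor

/-! ### Comparison of morphisms between shifted objects of hearts by effaceability -/

namespace CategoryTheory.Functor

open Category Pretriangulated

section Hearts

variable {H C D : Type*} [Category* H] [Category* C] [Category* D] {F : C ⥤ D}
  {s : H ⥤ C} {s' : H ⥤ D} (e : s ⋙ F ≅ s')

include e in
-- Two out of three for bijections: `s` and `s ⋙ F ≅ s'` are both bijective on morphisms.
lemma bijOn_of_full_of_faithful [s.Full] [s.Faithful] [s'.Full] [s'.Faithful] (X Y : H) :
    F.BijOn (s.obj X) (s.obj Y) := by
  have : (s ⋙ F).Full := Full.of_iso e.symm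
  have : (s ⋙ F).Faithful := Faithful.of_iso e.symm
  have h1 : Function.Bijective (s.map : (X ⟶ Y) → _) := ⟨s.map_injective, s.map_surjective⟩
  have h2 : Function.Bijective ((s ⋙ F).map : (X ⟶ Y) → _) :=
    ⟨(s ⋙ F).map_injective, (s ⋙ F).map_surjective⟩
  exact (Function.Bijective.of_comp_iff _ h1).1 h2

variable [HasShift C ℤ] [HasShift D ℤ] [F.CommShift ℤ]

lemma BijOn.shift_succ {X Y : C} {n : ℤ} (h : F.BijOn X (Y⟦n⟧)) :
    F.BijOn (X⟦(1 : ℤ)⟧) (Y⟦n + 1⟧) :=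
  (h.shift 1).of_iso_right ((shiftFunctorAdd C n 1).app Y).symm

/-- The comparison of morphisms between the images under `F` of shifts of objects of `s` with
those between shifts of objects of `s'`. -/
noncomputable def shiftedHomEquiv (X Y : H) (n : ℤ) :
    (F.obj (s.obj X) ⟶ F.obj ((s.obj Y)⟦n⟧)) ≃ (s'.obj X ⟶ (s'.obj Y)⟦n⟧) :=
  Iso.homCongr (e.app X) ((F.commShiftIso n).app (s.obj Y) ≪≫
    (CategoryTheory.shiftFunctor D n).mapIso (e.app Y))

lemma shiftedHomEquiv_comp {X' X Y : H} {n : ℤ} (p : X' ⟶ X)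
    (f : F.obj (s.obj X) ⟶ F.obj ((s.obj Y)⟦n⟧)) :
    shiftedHomEquiv e X' Y n (F.map (s.map p) ≫ f) = s'.map p ≫ shiftedHomEquiv e X Y n f := by
  have := e.inv.naturality p
  dsimp at this
  simp [shiftedHomEquiv, Iso.homCongr, reassoc_of% this]

lemma shiftedHomEquiv_zero [Preadditive D]
    [∀ n : ℤ, (CategoryTheory.shiftFunctor D n).Additive] (X Y : H) (n : ℤ) : shiftedHomEquiv e X Y n 0 = 0 := by
  change (e.app X).inv ≫ (0 : F.obj (s.obj X) ⟶ F.obj ((s.obj Y)⟦n⟧)) ≫ _ = 0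
  exact (congr_arg _ zero_comp).trans comp_zero

variable [HasZeroObject C] [HasZeroObject D] [Preadditive C] [Preadditive D]
  [∀ n : ℤ, (CategoryTheory.shiftFunctor C n).Additive]
  [∀ n : ℤ, (CategoryTheory.shiftFunctor D n).Additive]
  [Pretriangulated C] [Pretriangulated D] [F.IsTriangulated]

variable (s) in
/-- `s.map p` is the second morphism of a distinguished triangle whose first morphism is in the
image of `s`. -/
def HasTriangle {X' X : H} (p : X' ⟶ X) : Prop :=
  ∃ (K : H) (i : K ⟶ X') (h : s.obj X ⟶ (s.obj K)⟦(1 : ℤ)⟧),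
    Triangle.mk (s.map i) (s.map p) h ∈ distTriang C

include e in
/-- A triangulated functor is bijective on morphisms between shifts of objects of hearts `H`, if
it is so on the hearts, and if the morphisms of positive degree are effaceable. -/
lemma bijOn_shift_of_effaceable [s.Full] [s.Faithful] [s'.Full] [s'.Faithful]
    (hneg : ∀ n : ℤ, n < 0 → ∀ (X Y : H) (f : s.obj X ⟶ (s.obj Y)⟦n⟧), f = 0)
    (hneg' : ∀ n : ℤ, n < 0 → ∀ (X Y : H) (f : s'.obj X ⟶ (s'.obj Y)⟦n⟧), f = 0)
    (heff : ∀ n : ℤ, 0 < n → ∀ (X Y : H) (f : s.obj X ⟶ (s.obj Y)⟦n⟧),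
      ∃ (X' : H) (p : X' ⟶ X), HasTriangle s p ∧ s.map p ≫ f = 0)
    (heff' : ∀ n : ℤ, 0 < n → ∀ (X Y : H) (f : s'.obj X ⟶ (s'.obj Y)⟦n⟧),
      ∃ (X' : H) (p : X' ⟶ X), HasTriangle s p ∧ s'.map p ≫ f = 0) (X Y : H) (n : ℤ) :
    F.BijOn (s.obj X) ((s.obj Y)⟦n⟧) := by
  have hpos : ∀ n : ℕ, ∀ X Y : H, F.BijOn (s.obj X) ((s.obj Y)⟦(n : ℤ)⟧) := by
    intro n
    induction n with
    | zero =>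
      intro X Y
      exact (bijOn_of_full_of_faithful e X Y).of_iso_right
        ((shiftFunctorZero C ℤ).app (s.obj Y)).symm
    | succ n ih =>
      intro X Y
      rw [Nat.cast_add_one]
      constructor
      · rw [← F.coe_mapAddHom, injective_iff_map_eq_zero]
        intro f (hf : F.map f = 0)
        -- Injectivity: as `p` kills `f`, the morphism `f` factors through the connecting morphism
        -- `h` by some `g` on `K⟦1⟧`, which has degree `n` on `K`. Since `F` kills `h ≫ g`, the
        -- image of `g` factors through the next morphism of the rotated triangle. By induction this
        -- factorization lifts to `C`, where `h` followed by that next morphism vanishes.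
        obtain ⟨X', p, ⟨K, i, h, hT⟩, hp⟩ := heff (n + 1) (by omega) X Y f
        obtain ⟨g, rfl⟩ : ∃ g : (s.obj K)⟦(1 : ℤ)⟧ ⟶ _, f = h ≫ g :=
          Triangle.yoneda_exact₃ _ hT f hp
        obtain ⟨k, hk⟩ := map_yoneda_exact₃ (rot_of_distTriang _ hT) (F.map g)
          ((F.map_comp h g).symm.trans hf)
        obtain ⟨m, rfl⟩ := (ih X' Y).shift_succ.2 k
        have hg : g = (-(s.map i)⟦1⟧') ≫ m :=
          (ih K Y).shift_succ.1 (hk.trans (F.map_comp _ _).symm)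
        have := comp_distTriang_mor_zero₂₃ _ (rot_of_distTriang _ hT)
        rw [hg, ← assoc]
        erw [this]
        exact zero_comp
      · intro k
        -- Surjectivity: here `p` kills the given morphism in `D`, but its triangle lies in `C`. So
        -- `k` factors through `F.map h` by a morphism of degree `n` on `K`, which lifts by
        -- induction.
        obtain ⟨X', p, ⟨K, i, h, hT⟩, hp⟩ := heff' (n + 1) (by omega) X Y
          (shiftedHomEquiv e X Y _ k)
        rw [← shiftedHomEquiv_comp] at hp
        obtain ⟨c, hc⟩ := map_yoneda_exact₃ hT k
          ((shiftedHomEquiv e X' Y _).injective (hp.trans (shiftedHomEquiv_zero e X' Y _).symm))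
        obtain ⟨m, rfl⟩ := (ih K Y).shift_succ.2 c
        exact ⟨h ≫ m, (F.map_comp _ _).trans hc.symm⟩
  rcases lt_or_ge n 0 with hn | hn
  -- In negative degrees there are no nonzero morphisms on either side.
  · constructor
    · intro f g _
      rw [hneg n hn X Y f, hneg n hn X Y g]
    · intro k
      exact ⟨0, (shiftedHomEquiv e X Y n).injective
        ((hneg' n hn _ _ _).trans (hneg' n hn _ _ _).symm)⟩
  · obtain ⟨n, rfl⟩ := Int.eq_ofNat_of_zero_le hn
    exact hpos n X Y

end Hearts

end CategoryTheory.Functor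

/-! ### Vanishing and effaceability in the derived category of an abelian category -/

namespace DerivedCategory

open Category Pretriangulated

variable {B : Type v} [Category.{w} B] [Abelian B]

/-- Orthogonality of the t-structure: the target lives in degrees at least `-n > 0` and the source
in degree `0`. -/
lemma singleFunctor_hom_shift_eq_zero {n : ℤ} (hn : n < 0) (X Y : B)
    (f : (singleFunctor B 0).obj X ⟶ ((singleFunctor B 0).obj Y)⟦n⟧) : f = 0 := by
  have : (((singleFunctor B 0).obj Y)⟦n⟧).IsGE (-n) :=
    TStructure.t.isGE_shift _ 0 n (-n) (by omega)
  exact TStructure.t.zero_of_isLE_of_isGE f 0 (-n) (by omega) inferInstance inferInstance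

lemma exists_singleFunctor_triangle {X' X : B} (p : X' ⟶ X) [Epi p] :
    (singleFunctor B 0).HasTriangle p := by
  have hS : (ShortComplex.mk (kernel.ι p) p (kernel.condition p)).ShortExact :=
    { exact := ShortComplex.exact_of_f_is_kernel _ (kernelIsKernel p) }
  exact ⟨_, _, _, hS.singleTriangle_distinguished⟩

end DerivedCategory

namespace CochainComplex

open HomologicalComplex

variable {B : Type v} [Category.{w} B] [Abelian B]

/-- The morphism from the term of degree `0` of a complex that vanishes in positive degrees. -/
noncomputable def fromSingle (K : CochainComplex B ℤ) [K.IsStrictlyLE 0] :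
    (single B (ComplexShape.up ℤ) 0).obj (K.X 0) ⟶ K :=
  mkHomFromSingle (𝟙 _) (fun j hj => (K.isZero_of_isStrictlyLE 0 j (by
    have : (0 : ℤ) + 1 = j := hj
    omega)).eq_of_tgt _ _)

/-- Since `K` vanishes in positive degrees, all of `K.X 0` consists of cycles, and these surject
onto the homology in degree `0`, which `s` identifies with `X`. -/
lemma epi_f_zero_of_quasiIso (K : CochainComplex B ℤ) [K.IsStrictlyLE 0] {X : B}
    (s : K ⟶ (single B (ComplexShape.up ℤ) 0).obj X) [QuasiIso s] : Epi (s.f 0) := by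
  have h1 : Epi (cyclesMap s 0) := by
    have := ((single B (ComplexShape.up ℤ) 0).obj X).isIso_homologyπ (-1) 0 (by simp) (by simp)
    have h : K.homologyπ 0 ≫ homologyMap s 0 ≫ inv (homologyπ _ 0) = cyclesMap s 0 := by
      rw [← Category.assoc, homologyπ_naturality, Category.assoc, IsIso.hom_inv_id,
        Category.comp_id]
    rw [← h]
    infer_instance
  have h2 : IsIso (K.iCycles 0) := K.isIso_iCycles 0 1 (by simp)
    ((K.isZero_of_isStrictlyLE 0 1 (by omega)).eq_of_tgt _ _)
  have h3 : inv (K.iCycles 0) ≫ cyclesMap s 0 ≫ iCycles _ 0 = s.f 0 := by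
    rw [cyclesMap_i, IsIso.inv_hom_id_assoc]
  have h4 : IsIso (iCycles ((single B (ComplexShape.up ℤ) 0).obj X) 0) :=
    isIso_iCycles _ 0 1 (by simp) (by simp)
  rw [← h3]
  infer_instance

end CochainComplex

namespace DerivedCategory

open Category Pretriangulated HomologicalComplex

variable {B : Type v} [Category.{w} B] [Abelian B]

/-- Morphisms of positive degree between objects of the heart are effaceable. -/
lemma exists_epi_comp_eq_zero {n : ℤ} (hn : 0 < n) (X Y : B)
    (f : (singleFunctor B 0).obj X ⟶ ((singleFunctor B 0).obj Y)⟦n⟧) :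
    ∃ (X' : B) (p : X' ⟶ X), Epi p ∧ (singleFunctor B 0).map p ≫ f = 0 := by
  let sX := (single B (ComplexShape.up ℤ) 0).obj X
  let sY := (single B (ComplexShape.up ℤ) 0).obj Y
  -- The source lies in degrees at most `0`, so `f` is a fraction `s⁻¹g` whose middle complex `K`
  -- vanishes in positive degrees. The effacing epimorphism is `s` in degree `0`, and it factors
  -- through `K`.
  obtain ⟨K, hK, s, hs, g, hg⟩ := right_fac_of_isStrictlyLE (X := sX) (Y := sY⟦n⟧)
    (f ≫ (Q.commShiftIso n).inv.app sY) 0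
  have : QuasiIso s := (isIso_Q_map_iff_quasiIso B s).1 hs
  have := K.epi_f_zero_of_quasiIso s
  let p : K.X 0 ⟶ X := s.f 0 ≫ (singleObjXSelf (ComplexShape.up ℤ) 0 X).hom
  have hp : K.fromSingle ≫ s = (single B (ComplexShape.up ℤ) 0).map p := by
    apply from_single_hom_ext
    simp [p, CochainComplex.fromSingle, single_map_f_self]
  have hz : K.fromSingle ≫ g = 0 := by
    apply from_single_hom_ext
    -- The shifted complex is concentrated in degree `-n`, which is not `0`.
    have : IsZero ((sY⟦n⟧).X 0) := isZero_single_obj_X (ComplexShape.up ℤ) 0 Y (0 + n) (by omega)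
    exact this.eq_of_tgt _ _
  refine ⟨K.X 0, p, epi_comp _ _, ?_⟩
  have h : Q.map ((single B (ComplexShape.up ℤ) 0).map p) ≫
      f ≫ (Q.commShiftIso n).inv.app sY = 0 := by
    rw [hg, ← hp, Q.map_comp, assoc, IsIso.hom_inv_id_assoc, ← Q.map_comp, hz, Q.map_zero]
  exact (cancel_mono ((Q.commShiftIso n).inv.app sY)).1
    ((assoc _ _ _).trans (h.trans zero_comp.symm))

end DerivedCategory

/-! ### The hearts `*A` of `*D(A)` and of `D(*A)`, and the comparison by `res` -/

namespace Enlarging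

lemma Mor.isEpi_mk {C : Type*} [Category* C] {X Y : C} (f : X ⟶ Y) [Epi f] :
    Mor.IsEpi (Arrow.mk f) := by
  intro a b ha hb hab h
  obtain ⟨Z, a, rfl⟩ := Mor.exists_mk_of_dom (X := Y) ha
  obtain ⟨b, rfl⟩ := Mor.exists_mk_of (X := Y) (Y := Z) hb hab.symm
  rw [Mor.comp_mk, Mor.comp_mk, Mor.mk_inj, cancel_epi] at h
  rw [h]

namespace Enlargement

open Pretriangulated

variable {S W : Type u} (E : Enlargement S W)

section

variable {C : Type v} [Category.{w} C] [SmallCat S C]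
  {D : Type v'} [Category.{w'} D] [SmallCat S D] [Preadditive D] [HasZeroObject D]

lemma isZero_mapFunctor_obj {F : C ⥤ D} (h : IsZero F) (X : E.Cat C) :
    IsZero ((E.mapFunctor F).obj X) := by
  rw [IsZero.iff_id_eq_zero]
  refine IsMember.eq (x := X.pt) (a := fun t : C => F.obj t) (b := fun t : C => F.obj t)
    (a' := fun t : C => F.obj t) (b' := fun t : C => F.obj t) (φ := fun t => 𝟙 (F.obj t))
    (φ' := fun t => 0) (IsMember.id rfl) (IsMember.zero rfl rfl) ?_
  intro t
  exact congr_arg Arrow.mk (((F.isZero_iff).1 h t).eq_of_src (𝟙 (F.obj t)) 0)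

end

variable [Infinite S] {A : Type v} [Category.{w} A] [Abelian A] [SmallCat S A]

section Single

open HomologicalComplex

variable (A) in
/-- The inclusion of `*A` in `*D(A)`, as the complexes concentrated in degree `0`. -/
noncomputable abbrev heart : E.Cat A ⥤ E.Cat (DerivedCategory A) :=
  E.mapFunctor (DerivedCategory.singleFunctor A 0)

/-- The term of degree `0` of the restriction of a complex concentrated in degree `0`. -/
noncomputable def restrictionSingleXIso (X : E.Cat A) :
    ((E.restriction A).obj ((E.mapFunctor (single A (ComplexShape.up ℤ) 0)).obj X)).X 0 ≅ X :=
  ((E.mapCompIso (single A (ComplexShape.up ℤ) 0) (eval A (ComplexShape.up ℤ) 0)).symm ≪≫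
    E.mapNatIso (singleCompEvalIsoSelf A (ComplexShape.up ℤ) 0) ≪≫ E.mapIdIso).app X

lemma restrictionSingleXIso_hom_naturality {X Y : E.Cat A} (f : X ⟶ Y) :
    ((E.restriction A).map ((E.mapFunctor (single A (ComplexShape.up ℤ) 0)).map f)).f 0 ≫
      (E.restrictionSingleXIso Y).hom = (E.restrictionSingleXIso X).hom ≫ f :=
  ((E.mapCompIso (single A (ComplexShape.up ℤ) 0) (eval A (ComplexShape.up ℤ) 0)).symm ≪≫
    E.mapNatIso (singleCompEvalIsoSelf A (ComplexShape.up ℤ) 0) ≪≫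
      E.mapIdIso).hom.naturality f

lemma isZero_restriction_single_X (X : E.Cat A) (i : ℤ) (hi : i ≠ 0) :
    IsZero (((E.restriction A).obj
      ((E.mapFunctor (single A (ComplexShape.up ℤ) 0)).obj X)).X i) :=
  (E.isZero_mapFunctor_obj (isZero_single_comp_eval A (ComplexShape.up ℤ) 0 i hi) X).of_iso
    ((E.mapCompIso (single A (ComplexShape.up ℤ) 0) (eval A (ComplexShape.up ℤ) i)).symm.app X)

/-- The restriction of a complex concentrated in degree `0` is concentrated in degree `0`. -/
noncomputable def restrictionSingleHom (X : E.Cat A) :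
    (E.restriction A).obj ((E.mapFunctor (single A (ComplexShape.up ℤ) 0)).obj X) ⟶
      (single (E.Cat A) (ComplexShape.up ℤ) 0).obj X :=
  mkHomToSingle (E.restrictionSingleXIso X).hom (fun i hi =>
    (E.isZero_restriction_single_X X i (by
      have : i + 1 = 0 := hi
      omega)).eq_of_src _ _)

instance (X : E.Cat A) : IsIso (E.restrictionSingleHom X) := by
  have (i : ℤ) : IsIso ((E.restrictionSingleHom X).f i) := by
    by_cases hi : i = 0
    · subst hi
      rw [restrictionSingleHom, mkHomToSingle_f]
      infer_instance
    · exact (E.isZero_restriction_single_X X i hi).isIso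
        (isZero_single_obj_X (ComplexShape.up ℤ) 0 X i hi) _
  exact Hom.isIso_of_components _

variable (A) in
/-- The restriction of complexes concentrated in degree `0`. -/
noncomputable def restrictionSingleIso :
    E.mapFunctor (single A (ComplexShape.up ℤ) 0) ⋙ E.restriction A ≅
      single (E.Cat A) (ComplexShape.up ℤ) 0 :=
  NatIso.ofComponents (fun X => asIso (E.restrictionSingleHom X)) (fun {X Y} f => by
    apply to_single_hom_ext
    change _ ≫ (E.restrictionSingleHom Y).f 0 = (E.restrictionSingleHom X).f 0 ≫ _
    dsimp [restrictionSingleHom]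
    rw [mkHomToSingle_f, mkHomToSingle_f, single_map_f_self]
    simp only [Category.assoc, Iso.inv_hom_id_assoc]
    rw [← Category.assoc, restrictionSingleXIso_hom_naturality, Category.assoc])

variable (A) in
/-- The functor `res` identifies the hearts. -/
noncomputable def heartCompResIso :
    E.heart A ⋙ E.res A ≅ DerivedCategory.singleFunctor (E.Cat A) 0 :=
  Functor.isoWhiskerRight (E.mapCompIso (single A (ComplexShape.up ℤ) 0) DerivedCategory.Q)
      (E.res A) ≪≫
    Functor.associator _ _ _ ≪≫
    Functor.isoWhiskerLeft (E.mapFunctor (single A (ComplexShape.up ℤ) 0)) (E.resFac A) ≪≫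
    (Functor.associator _ _ _).symm ≪≫
    Functor.isoWhiskerRight (E.restrictionSingleIso A) DerivedCategory.Q

end Single

section Effaceable

open DerivedCategory

/-- The degree `n` is a standard integer, so it acts as a parameter of the transferred statement;
only `f`, `X` and `Y` are quantified. -/
lemma heart_hom_shift_eq_zero {n : ℤ} (hn : n < 0) {X Y : E.Cat A}
    (f : (E.heart A).obj X ⟶ ((E.heart A).obj Y)⟦n⟧) : f = 0 := by
  have := E.transfer_forall (P := fun f : Arrow (DerivedCategory A) => ∀ X Y : A,
    Mor.dom f = (singleFunctor A 0).obj X →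
    Mor.cod f = (shiftFunctor (DerivedCategory A) n).obj ((singleFunctor A 0).obj Y) →
    f = Mor.zero ((singleFunctor A 0).obj X)
      ((shiftFunctor (DerivedCategory A) n).obj ((singleFunctor A 0).obj Y))) (by
      intro f X Y hX hY
      obtain ⟨f, rfl⟩ := Mor.exists_mk_of (X := (singleFunctor A 0).obj X)
        (Y := ((singleFunctor A 0).obj Y)⟦n⟧) hX hY
      rw [singleFunctor_hom_shift_eq_zero hn X Y f]
      rfl) (Cat.arr f)
  simp at this
  exact Cat.hom_ext (this X.pt Y.pt rfl rfl)

/-- The epimorphism is required in its internal form, as that is what transfer produces and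
consumes. An epimorphism of `*A` satisfies it by `Cat.starPred_isEpi`. -/
lemma hasTriangle_heart {X' X : E.Cat A} (p : X' ⟶ X) (hp : E.StarPred Mor.IsEpi (Cat.arr p)) :
    (E.heart A).HasTriangle p := by
  have := E.transfer_forall (P := fun p : Arrow A => Mor.IsEpi p →
    ∃ (i : Arrow A) (h : Arrow (DerivedCategory A)), Mor.cod i = Mor.dom p ∧
      Mor.dom h = (singleFunctor A 0).obj (Mor.cod p) ∧
      Mor.cod h = (shiftFunctor (DerivedCategory A) (1 : ℤ)).obj
        ((singleFunctor A 0).obj (Mor.dom i)) ∧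
      Mor.IsDist (Mor.map (singleFunctor A 0) i, Mor.map (singleFunctor A 0) p, h)) (by
      intro p hp
      obtain ⟨X', X, p, rfl⟩ := Mor.exists_mk p
      have := hp.epi
      obtain ⟨K, i, h, hT⟩ := exists_singleFunctor_triangle p
      exact ⟨Arrow.mk i, Arrow.mk h, rfl, rfl, rfl, (Mor.isDist_mk_iff _ _ _).2 hT⟩) (Cat.arr p)
  rw [starPred_imp] at this
  replace this := this hp
  simp [-exists_and_left] at this
  obtain ⟨i, h, hi, hh, hh', hT⟩ := this
  exact ⟨⟨E.dom i⟩, Cat.homMk i rfl hi, Cat.homMk h hh hh', hT⟩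

lemma exists_hasTriangle_heart_comp_eq_zero {n : ℤ} (hn : 0 < n) (X Y : E.Cat A)
    (f : (E.heart A).obj X ⟶ ((E.heart A).obj Y)⟦n⟧) :
    ∃ (X' : E.Cat A) (p : X' ⟶ X), (E.heart A).HasTriangle p ∧ (E.heart A).map p ≫ f = 0 := by
  have := E.transfer_forall (P := fun f : Arrow (DerivedCategory A) => ∀ X Y : A,
    Mor.dom f = (singleFunctor A 0).obj X →
    Mor.cod f = (shiftFunctor (DerivedCategory A) n).obj ((singleFunctor A 0).obj Y) →
    ∃ p : Arrow A, Mor.cod p = X ∧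
      Mor.comp (Mor.map (singleFunctor A 0) p) f =
        Mor.zero ((singleFunctor A 0).obj (Mor.dom p))
          ((shiftFunctor (DerivedCategory A) n).obj ((singleFunctor A 0).obj Y)) ∧
      Mor.IsEpi p) (by
      intro f X Y hX hY
      obtain ⟨f, rfl⟩ := Mor.exists_mk_of (X := (singleFunctor A 0).obj X)
        (Y := ((singleFunctor A 0).obj Y)⟦n⟧) hX hY
      obtain ⟨X', p, hp, h⟩ := exists_epi_comp_eq_zero hn X Y f
      refine ⟨Arrow.mk p, rfl, ?_, Mor.isEpi_mk p⟩
      rw [Mor.map_mk, Mor.comp_mk, h]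
      rfl) (Cat.arr f)
  simp [-exists_and_left] at this
  obtain ⟨p, hp, h, hp'⟩ := this X.pt Y.pt rfl rfl
  have hp'' : E.StarPred Mor.IsEpi p := by
    simpa using (E.starPred_comp Mor.IsEpi
      (fun x : ((Arrow (DerivedCategory A) × A) × A) × Arrow A => x.2) _).1 hp'
  let q : (⟨E.dom p⟩ : E.Cat A) ⟶ X := Cat.homMk p rfl hp
  exact ⟨_, q, E.hasTriangle_heart q hp'', Cat.hom_ext h⟩

/-- The functor `res` is bijective on morphisms between shifts of objects of the hearts. -/
lemma bijOn_res_heart (X Y : E.Cat A) (n : ℤ) :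
    (E.res A).BijOn ((E.heart A).obj X) (((E.heart A).obj Y)⟦n⟧) := by
  refine Functor.bijOn_shift_of_effaceable (E.heartCompResIso A)
    (fun n hn X Y f => E.heart_hom_shift_eq_zero hn f)
    (fun n hn X Y f => singleFunctor_hom_shift_eq_zero hn X Y f)
    (fun n hn X Y f => E.exists_hasTriangle_heart_comp_eq_zero hn X Y f) ?_ X Y n
  intro n hn X Y f
  -- For `D(*A)` no transfer is needed to efface: the result for derived categories applies to the
  -- abelian category `*A` itself. The triangle of the epimorphism so obtained is nevertheless
  -- needed in `*D(A)`, where `hasTriangle_heart` provides it.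
  obtain ⟨X', p, hp, h⟩ := exists_epi_comp_eq_zero hn X Y f
  exact ⟨X', p, E.hasTriangle_heart p (Cat.starPred_isEpi p), h⟩

end Effaceable

end Enlargement

end Enlarging

/-! ### Filtration of bounded objects by shifts of objects of the heart -/

namespace CategoryTheory.ObjectProperty

open Pretriangulated

variable {H C : Type*} [Category* H] [Category* C] [HasShift C ℤ] [HasZeroObject C] [Preadditive C]
  [∀ n : ℤ, (shiftFunctor C n).Additive] [Pretriangulated C]

/-- Objects that are built by finitely many extensions from shifts of the objects of `s` lie in
any triangulated subcategory that contains the objects of `s`. -/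
lemma prop_of_isTriangulated_of_filtration {s : H ⥤ C} {R : ℤ → ℤ → ObjectProperty C}
    (hzero : ∀ a b X, b < a → R a b X → IsZero X)
    (hstep : ∀ a b X, a ≤ b → R a b X → ∃ (X' : C) (M : H) (f : X' ⟶ X)
      (g : X ⟶ (s.obj M)⟦-b⟧) (h : (s.obj M)⟦-b⟧ ⟶ X'⟦(1 : ℤ)⟧),
        Triangle.mk f g h ∈ distTriang C ∧ R a (b - 1) X')
    (P : ObjectProperty C) [P.IsTriangulated] [P.IsClosedUnderIsomorphisms]
    (hP : ∀ M, P (s.obj M)) {a b : ℤ} {X : C} (hX : R a b X) : P X := by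
  -- Induction on the width of the interval. It is an external induction, available because the
  -- endpoints are ordinary integers.
  obtain ⟨n, hn⟩ : ∃ n : ℕ, b < a + n := ⟨(b - a).toNat + 1, by omega⟩
  induction n generalizing b X with
  | zero => exact P.prop_of_isZero (hzero a b X (by simpa using hn) hX)
  | succ n ih =>
    by_cases hab : b < a
    · exact P.prop_of_isZero (hzero a b X hab hX)
    · obtain ⟨X', M, f, g, h, hT, hX'⟩ := hstep a b X (by omega) hX
      exact P.ext_of_isTriangulatedClosed₂ _ hT (ih hX' (by push_cast at hn; omega))
        (P.le_shift (-b) _ (hP M))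

end CategoryTheory.ObjectProperty

namespace DerivedCategory

open Pretriangulated TStructure

variable {B : Type v} [Category.{w} B] [Abelian B]

/-- The cohomology of `X` vanishes outside of the interval `[a, b]`. -/
def IsConcentrated (a b : ℤ) : ObjectProperty (DerivedCategory B) := fun X => X.IsGE a ∧ X.IsLE b

namespace IsConcentrated

variable {a b a' b' : ℤ} {X Y : DerivedCategory B}

lemma of_iso (h : IsConcentrated a b X) (e : X ≅ Y) : IsConcentrated a b Y :=
  have := h.1
  have := h.2
  ⟨t.isGE_of_iso e a, t.isLE_of_iso e b⟩

lemma mono (h : IsConcentrated a b X) (ha : a' ≤ a) (hb : b ≤ b') : IsConcentrated a' b' X :=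
  have := h.1
  have := h.2
  ⟨t.isGE_of_ge X a' a ha, t.isLE_of_le X b b' hb⟩

lemma of_isZero (h : IsZero X) (a b : ℤ) : IsConcentrated a b X :=
  ⟨(isGE_iff X a).2 fun _ _ => (homologyFunctor B _).map_isZero h,
    (isLE_iff X b).2 fun _ _ => (homologyFunctor B _).map_isZero h⟩

lemma isZero (h : IsConcentrated a b X) (hab : b < a) : IsZero X :=
  have := h.1
  have := h.2
  t.isZero X b a hab

lemma shift (h : IsConcentrated a b X) (n : ℤ) : IsConcentrated (a - n) (b - n) (X⟦n⟧) :=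
  have := h.1
  have := h.2
  ⟨t.isGE_shift X a n _ (by omega), t.isLE_shift X b n _ (by omega)⟩

lemma ext₂ {T : Triangle (DerivedCategory B)} (hT : T ∈ distTriang (DerivedCategory B))
    (h₁ : IsConcentrated a b T.obj₁) (h₃ : IsConcentrated a b T.obj₃) :
    IsConcentrated a b T.obj₂ :=
  ⟨t.isGE₂ T hT a h₁.1 h₃.1, t.isLE₂ T hT b h₁.2 h₃.2⟩

/-- The truncation triangle below degree `b`: its third object has cohomology only in degree `b`, so
it is a shifted object of the heart. -/
lemma exists_triangle (h : IsConcentrated a b X) (hab : a ≤ b) :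
    ∃ (X' : DerivedCategory B) (M : B) (f : X' ⟶ X) (g : X ⟶ ((singleFunctor B 0).obj M)⟦-b⟧)
      (k : ((singleFunctor B 0).obj M)⟦-b⟧ ⟶ X'⟦(1 : ℤ)⟧),
      Triangle.mk f g k ∈ distTriang (DerivedCategory B) ∧ IsConcentrated a (b - 1) X' := by
  obtain ⟨X', X'', h', h'', f, g, k, hT⟩ := t.exists_triangle X (b - 1) b (by omega)
  have h' : t.IsLE X' (b - 1) := ⟨h'⟩
  have h'' : t.IsGE X'' b := ⟨h''⟩
  -- The upper bound for `X''` comes from the rotated triangle `X ⟶ X'' ⟶ X'⟦1⟧`, and the lower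
  -- bound for `X'` from the inversely rotated one `X''⟦-1⟧ ⟶ X' ⟶ X`.
  have : t.IsLE (X'⟦(1 : ℤ)⟧) (b - 2) := t.isLE_shift X' (b - 1) 1 _ (by omega)
  have : t.IsGE (X''⟦(-1 : ℤ)⟧) (b + 1) := t.isGE_shift X'' b (-1) _ (by omega)
  have : X''.IsLE b := t.isLE₂ _ (rot_of_distTriang _ hT) b h.2
    (t.isLE_of_le (X'⟦(1 : ℤ)⟧) (b - 2) b (by omega))
  have h₃ : X'.IsGE a := t.isGE₂ _ (inv_rot_of_distTriang _ hT) a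
    (t.isGE_of_ge (X''⟦(-1 : ℤ)⟧) a (b + 1) (by omega)) h.1
  obtain ⟨M, ⟨e⟩⟩ := exists_iso_singleFunctor_obj_of_isGE_of_isLE X'' b
  let e' : X'' ≅ ((singleFunctor B 0).obj M)⟦-b⟧ :=
    e ≪≫ (((singleFunctors B).shiftIso (-b) b 0 (by omega)).app M).symm
  exact ⟨X', M, f, g ≫ e'.hom, e'.inv ≫ k, isomorphic_distinguished _ hT _
    (Triangle.isoMk _ _ (Iso.refl X') (Iso.refl X) e'.symm
      ((Category.comp_id f).trans (Category.id_comp f).symm)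
      ((Category.assoc g e'.hom e'.inv).trans (by
        rw [e'.hom_inv_id, Category.comp_id]
        exact (Category.id_comp g).symm))
      ((congr_arg (fun l => (e'.inv ≫ k) ≫ l) ((shiftFunctor _ (1 : ℤ)).map_id X')).trans
        (Category.comp_id _))), h₃, h'⟩

end IsConcentrated

lemma isConcentrated_neg_iff (i : ℕ) (X : DerivedCategory B) : IsConcentrated (-i) i X ↔
    ∀ j : ℤ, (i : ℤ) < |j| → IsZero ((homologyFunctor B j).obj X) := by
  rw [IsConcentrated, isGE_iff, isLE_iff]
  constructor
  · rintro ⟨h, h'⟩ j hj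
    rcases lt_abs.1 hj with hj | hj
    · exact h' j hj
    · exact h j (by omega)
  · exact fun h => ⟨fun j hj => h j (lt_abs.2 (Or.inr (by omega))),
      fun j hj => h j (lt_abs.2 (Or.inl hj))⟩

lemma prop_of_bounded (P : ObjectProperty (DerivedCategory B)) [P.IsTriangulated]
    [P.IsClosedUnderIsomorphisms] (hP : ∀ M, P ((singleFunctor B 0).obj M))
    {X : DerivedCategory B} (hX : bounded B X) : P X := by
  obtain ⟨i, hi⟩ := hX
  exact P.prop_of_isTriangulated_of_filtration (fun a b X hab hX => IsConcentrated.isZero hX hab)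
    (fun a b X hab hX => IsConcentrated.exists_triangle hX hab) hP
    ((isConcentrated_neg_iff i X).2 hi)

end DerivedCategory

/-! ### Finitely bounded objects of `*D(A)` -/

namespace Enlarging.Enlargement

open Pretriangulated DerivedCategory

variable {S W : Type u} (E : Enlargement S W)

lemma starPred_isZero_iff {C : Type*} [Category* C] [Preadditive C] [SmallCat S C] (X : E.Cat C) :
    E.StarPred (fun X : C => IsZero X) X.pt ↔ IsZero X := by
  rw [E.starPred_congr (Q := fun X : C => Mor.ident X = Mor.zero X X)
    (fun X => (IsZero.iff_id_eq_zero X).trans Mor.mk_inj.symm), IsZero.iff_id_eq_zero]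
  simp
  exact ⟨fun h => Cat.hom_ext h, fun h => congr_arg Cat.arr h⟩

variable [Infinite S] {A : Type v} [Category.{w} A] [Abelian A] [SmallCat S A]

/-- The cohomology of `X` vanishes outside of the interval `[a, b]` of `*ℤ`, for standard `a`
and `b`. -/
def IsStarConcentrated (a b : ℤ) : ObjectProperty (E.Cat (DerivedCategory A)) :=
  fun X => E.StarPred (IsConcentrated a b) X.pt

lemma starPred_isConcentrated {G : Type*} [Coded S G] (x : E.Star G) (a b : ℤ)
    (f : G → DerivedCategory A) : E.StarPred (fun x => IsConcentrated a b (f x)) x ↔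
      E.StarPred (IsConcentrated a b) (E.starFun f x) :=
  E.starPred_comp (IsConcentrated a b) f x

namespace IsStarConcentrated

variable {E} {a b a' b' : ℤ} {X Y : E.Cat (DerivedCategory A)}

lemma of_iso (h : E.IsStarConcentrated a b X) (e : X ≅ Y) : E.IsStarConcentrated a b Y := by
  have := E.transfer_forall (P := fun f : Arrow (DerivedCategory A) => Mor.IsIso f →
    IsConcentrated a b (Mor.dom f) → IsConcentrated a b (Mor.cod f)) (by
      intro f hf h
      obtain ⟨X, Y, f, rfl⟩ := Mor.exists_mk f
      rw [Mor.isIso_mk_iff] at hf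
      let e := asIso f
      exact h.of_iso e) (Cat.arr e.hom)
  simp [starPred_isConcentrated] at this
  exact this ((E.isIsoArr_iff e.hom).2 inferInstance) h

lemma mono (h : E.IsStarConcentrated a b X) (ha : a' ≤ a) (hb : b ≤ b') :
    E.IsStarConcentrated a' b' X := by
  have := E.transfer_forall (P := fun X : DerivedCategory A => IsConcentrated a b X →
    IsConcentrated a' b' X) (fun X h => h.mono ha hb) X.pt
  rw [starPred_imp] at this
  exact this h

lemma of_isZero (h : IsZero X) (a b : ℤ) : E.IsStarConcentrated a b X := by
  have := E.transfer_forall (P := fun X : DerivedCategory A => IsZero X →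
    IsConcentrated a b X) (fun X h => .of_isZero h a b) X.pt
  rw [starPred_imp] at this
  exact this ((E.starPred_isZero_iff X).2 h)

lemma isZero (h : E.IsStarConcentrated a b X) (hab : b < a) : IsZero X := by
  have := E.transfer_forall (P := fun X : DerivedCategory A => IsConcentrated a b X →
    IsZero X) (fun X h => h.isZero hab) X.pt
  rw [starPred_imp] at this
  exact (E.starPred_isZero_iff X).1 (this h)

lemma shift (h : E.IsStarConcentrated a b X) (n : ℤ) :
    E.IsStarConcentrated (a - n) (b - n) (X⟦n⟧) := by
  have := E.transfer_forall (P := fun X : DerivedCategory A => IsConcentrated a b X →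
    IsConcentrated (a - n) (b - n) ((shiftFunctor (DerivedCategory A) n).obj X))
    (fun X h => h.shift n) X.pt
  rw [starPred_imp] at this
  exact (E.starPred_isConcentrated _ _ _ _).1 (this h)

lemma ext₂ {T : Triangle (E.Cat (DerivedCategory A))}
    (hT : T ∈ distTriang (E.Cat (DerivedCategory A)))
    (h₁ : E.IsStarConcentrated a b T.obj₁) (h₃ : E.IsStarConcentrated a b T.obj₃) :
    E.IsStarConcentrated a b T.obj₂ := by
  have := E.transfer_forall (P := fun f : Arrow (DerivedCategory A) =>
    ∀ g h : Arrow (DerivedCategory A), Mor.IsDist (f, g, h) → IsConcentrated a b (Mor.dom f) →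
      IsConcentrated a b (Mor.cod g) → IsConcentrated a b (Mor.cod f)) (by
      rintro f g h ⟨T, hT, hfgh⟩ h₁ h₃
      simp only [Prod.mk.injEq] at hfgh
      obtain ⟨rfl, rfl, rfl⟩ := hfgh
      exact IsConcentrated.ext₂ hT h₁ h₃) (Cat.arr T.mor₁)
  simp [starPred_isConcentrated] at this
  have := this (Cat.arr T.mor₂) (Cat.arr T.mor₃) hT h₁
  rw [Cat.cod_arr] at this
  exact this h₃

/-- The truncation triangle of `D(A)` transferred for fixed standard `a` and `b`; the object `M` is
one of `*A`. -/
lemma exists_triangle (h : E.IsStarConcentrated a b X) (hab : a ≤ b) :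
    ∃ (X' : E.Cat (DerivedCategory A)) (M : E.Cat A) (f : X' ⟶ X)
      (g : X ⟶ ((E.heart A).obj M)⟦-b⟧) (k : ((E.heart A).obj M)⟦-b⟧ ⟶ X'⟦(1 : ℤ)⟧),
      Triangle.mk f g k ∈ distTriang (E.Cat (DerivedCategory A)) ∧
        E.IsStarConcentrated a (b - 1) X' := by
  have := E.transfer_forall (P := fun X : DerivedCategory A => IsConcentrated a b X →
    ∃ (M : A) (f g k : Arrow (DerivedCategory A)), Mor.cod f = X ∧ Mor.dom g = X ∧
      Mor.cod g = (shiftFunctor (DerivedCategory A) (-b)).obj ((singleFunctor A 0).obj M) ∧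
      Mor.dom k = (shiftFunctor (DerivedCategory A) (-b)).obj ((singleFunctor A 0).obj M) ∧
      Mor.cod k = (shiftFunctor (DerivedCategory A) (1 : ℤ)).obj (Mor.dom f) ∧
      Mor.IsDist (f, g, k) ∧ IsConcentrated a (b - 1) (Mor.dom f)) (by
      intro X h
      obtain ⟨X', M, f, g, k, hT, h'⟩ := h.exists_triangle hab
      exact ⟨M, Arrow.mk f, Arrow.mk g, Arrow.mk k, rfl, rfl, rfl, rfl, rfl,
        (Mor.isDist_mk_iff _ _ _).2 hT, h'⟩) X.pt
  rw [starPred_imp] at this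
  replace this := this h
  simp [-exists_and_left, starPred_isConcentrated] at this
  obtain ⟨M, f, g, k, h1, h2, h3, h4, h5, hT, h'⟩ := this
  exact ⟨⟨E.dom f⟩, ⟨M⟩, Cat.homMk f rfl h1, Cat.homMk g h2 h3, Cat.homMk k h4 h5, hT, h'⟩

end IsStarConcentrated

/-- The quantifier over `ℤ` in the condition on `D(A)` becomes one over `*ℤ`, so nonstandard degrees
are covered too. -/
lemma isStarConcentrated_neg_iff (i : ℕ) (X : E.Cat (DerivedCategory A)) :
    E.IsStarConcentrated (-i) i X ↔ ∀ j : E.Star ℤ,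
      E.StarRel (fun a b : ℤ => a < b) (E.std (i : ℤ)) (E.starFun (fun n : ℤ => |n|) j) →
        IsZero (E.cohomology X j) := by
  refine (E.starPred_congr (isConcentrated_neg_iff i) X.pt).trans ?_
  rw [starPred_forall]
  refine forall_congr' fun j => ?_
  rw [starPred_imp]
  refine imp_congr ?_ ?_
  · rw [E.starPred_rel (fun a b : ℤ => a < b), starFun_const, E.starFun_comp (fun n : ℤ => |n|),
      starFun_snd]
  · rw [← E.starPred_isZero_iff]
    exact E.starPred_comp (fun X : A => IsZero X)
      (fun p : DerivedCategory A × ℤ => (homologyFunctor A p.2).obj p.1) (E.pair X.pt j)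

lemma finitelyBounded_iff (X : E.Cat (DerivedCategory A)) :
    E.finitelyBounded X ↔ ∃ i : ℕ, E.IsStarConcentrated (-i) i X :=
  exists_congr fun i => (E.isStarConcentrated_neg_iff i X).symm

/-- The standard bound is essential here: it makes the filtration by truncations finite in the
external sense, so that an arbitrary, possibly external, property `P` propagates along it. -/
lemma prop_of_finitelyBounded (P : ObjectProperty (E.Cat (DerivedCategory A))) [P.IsTriangulated]
    [P.IsClosedUnderIsomorphisms] (hP : ∀ M, P ((E.heart A).obj M))
    {X : E.Cat (DerivedCategory A)} (hX : E.finitelyBounded X) : P X := by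
  obtain ⟨i, hi⟩ := (E.finitelyBounded_iff X).1 hX
  exact P.prop_of_isTriangulated_of_filtration
    (fun a b X hab hX => IsStarConcentrated.isZero hX hab)
    (fun a b X hab hX => IsStarConcentrated.exists_triangle hX hab) hP hi

instance : (E.finitelyBounded (A := A)).IsClosedUnderIsomorphisms where
  of_iso e h := by
    obtain ⟨i, hi⟩ := (E.finitelyBounded_iff _).1 h
    exact (E.finitelyBounded_iff _).2 ⟨i, hi.of_iso e⟩

instance : (E.finitelyBounded (A := A)).IsTriangulated where
  exists_zero := by
    obtain ⟨Z, hZ⟩ := HasZeroObject.zero (C := E.Cat (DerivedCategory A))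
    exact ⟨Z, hZ, (E.finitelyBounded_iff _).2 ⟨0, .of_isZero hZ _ _⟩⟩
  isStableUnderShiftBy n := ⟨fun X h => by
    obtain ⟨i, hi⟩ := (E.finitelyBounded_iff _).1 h
    -- The interval `[-i, i]` moved by `-n` stays inside the symmetric interval of radius `i + |n|`.
    exact (E.finitelyBounded_iff _).2 ⟨i + n.natAbs,
      (hi.shift n).mono (by omega) (by omega)⟩⟩
  toIsTriangulatedClosed₂ := .mk' fun T hT h₁ h₃ => by
    obtain ⟨i, hi⟩ := (E.finitelyBounded_iff _).1 h₁
    obtain ⟨j, hj⟩ := (E.finitelyBounded_iff _).1 h₃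
    exact (E.finitelyBounded_iff _).2 ⟨i + j, .ext₂ hT
      (hi.mono (by push_cast; omega) (by push_cast; omega))
      (hj.mono (by push_cast; omega) (by push_cast; omega))⟩

end Enlarging.Enlargement

/-! ### The equivalence between `*D^fb(A)` and `D^b(*A)` -/

namespace Enlarging

open Pretriangulated DerivedCategory

namespace Enlargement

variable {S W : Type u} [Infinite S] (E : Enlargement S W)
  {A : Type v} [Category.{w} A] [Abelian A] [SmallCat S A]

/-- `E.Distinguished` and `E.shift` unfold to the distinguished triangles and the shift by `1` of
the pretriangulated structure on `*D(A)`, so the closure properties are those of the instances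
above. -/
lemma isTriangulatedSubcategory_finitelyBounded :
    E.IsTriangulatedSubcategory (E.finitelyBounded (A := A)) where
  zero := by
    obtain ⟨X, hX, h⟩ := (E.finitelyBounded (A := A)).exists_prop_of_containsZero
    exact ⟨X, h, hX⟩
  iso e h := E.finitelyBounded.prop_of_iso e h
  shift_iff X := E.finitelyBounded.prop_shift_iff_of_isStableUnderShift X (1 : ℤ)
  ext₁ f g h hT := E.finitelyBounded.ext_of_isTriangulatedClosed₁ (Triangle.mk f g h) hT
  ext₂ f g h hT := E.finitelyBounded.ext_of_isTriangulatedClosed₂ (Triangle.mk f g h) hT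
  ext₃ f g h hT := E.finitelyBounded.ext_of_isTriangulatedClosed₃ (Triangle.mk f g h) hT

lemma std_lt_abs_std {i j : ℤ} (h : i < |j|) :
    E.StarRel (fun a b : ℤ => a < b) (E.std i) (E.starFun (fun n : ℤ => |n|) (E.std j)) := by
  have : E.StarPred (fun j : ℤ => i < |j|) (E.std j) := (E.starPred_std _ _).2 h
  rwa [E.starPred_rel (fun a b : ℤ => a < b), starFun_const] at this

/-- The image under `res` has cohomology in standard degrees only, where it agrees with that of `X`;
the same bound works. -/
lemma bounded_res_obj {X : E.Cat (DerivedCategory A)} (hX : E.finitelyBounded X) :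
    bounded (E.Cat A) ((E.res A).obj X) := by
  obtain ⟨i, hi⟩ := hX
  exact ⟨i, fun j hj => (E.isZero_homologyFunctor_obj_res_iff X j).2
    (hi _ (E.std_lt_abs_std hj))⟩

lemma finitelyBounded_heart_obj (M : E.Cat A) : E.finitelyBounded ((E.heart A).obj M) := by
  refine (E.finitelyBounded_iff _).2 ⟨0, ?_⟩
  have := E.transfer_forall (P := fun M : A => IsConcentrated (-(0 : ℕ)) (0 : ℕ)
    ((singleFunctor A 0).obj M)) (fun M => by
      simp only [Nat.cast_zero, neg_zero]
      exact ⟨inferInstance, inferInstance⟩) M.pt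
  exact (E.starPred_isConcentrated _ _ _ _).1 this

/-- The objects of the heart generate the finitely bounded objects, so the dévissage reduces the
claim to `bijOn_res_heart`. -/
lemma bijOn_res {X Y : E.Cat (DerivedCategory A)} (hX : E.finitelyBounded X)
    (hY : E.finitelyBounded Y) : (E.res A).BijOn X Y :=
  Functor.bijOn_of_generators (F := E.res A) (P := E.finitelyBounded)
    (H := fun X => ∃ M, X = (E.heart A).obj M)
    (fun Q _ _ hQ X hX => E.prop_of_finitelyBounded Q (fun M => hQ _ ⟨M, rfl⟩) hX)
    (by rintro _ _ ⟨M, rfl⟩ ⟨N, rfl⟩ n; exact E.bijOn_res_heart M N n) hX hY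

variable (A) in
/-- The restriction of `res` to the finitely bounded objects. -/
noncomputable abbrev resFinitelyBounded :
    (E.finitelyBounded (A := A)).FullSubcategory ⥤ DerivedCategory (E.Cat A) :=
  E.finitelyBounded.ι ⋙ E.res A

instance : (E.resFinitelyBounded A).Full where
  map_surjective {X Y} k := by
    obtain ⟨l, rfl⟩ := (E.bijOn_res X.property Y.property).2 k
    exact ⟨ObjectProperty.homMk l, rfl⟩

instance : (E.resFinitelyBounded A).Faithful where
  map_injective {X Y} _ _ h :=
    ObjectProperty.hom_ext _ ((E.bijOn_res X.property Y.property).1 h)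

/-- Since the functor is full, its essential image is a triangulated subcategory: a morphism between
images lifts, and so does its cone. It contains the heart, which generates the bounded objects. -/
lemma essImage_resFinitelyBounded_of_bounded {Y : DerivedCategory (E.Cat A)}
    (hY : bounded (E.Cat A) Y) : (E.resFinitelyBounded A).essImage Y :=
  prop_of_bounded (E.resFinitelyBounded A).essImage (fun M =>
    ⟨⟨(E.heart A).obj M, E.finitelyBounded_heart_obj M⟩, ⟨(E.heartCompResIso A).app M⟩⟩) hY

variable (A) in
/-- The functor `*D^fb(A) ⥤ D^b(*A)` that is induced by `res`. -/
noncomputable def resBounded :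
    (E.finitelyBounded (A := A)).FullSubcategory ⥤ BoundedDerivedCategory (E.Cat A) :=
  (bounded (E.Cat A)).lift (E.resFinitelyBounded A) (fun X => E.bounded_res_obj X.property)

noncomputable instance : (E.resBounded A).CommShift ℤ :=
  inferInstanceAs (((bounded (E.Cat A)).lift (E.resFinitelyBounded A) _).CommShift ℤ)

instance : (E.resBounded A).IsTriangulated :=
  inferInstanceAs (((bounded (E.Cat A)).lift (E.resFinitelyBounded A) _).IsTriangulated)

instance : (E.resBounded A).Full :=
  inferInstanceAs (((bounded (E.Cat A)).lift (E.resFinitelyBounded A) _).Full)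

instance : (E.resBounded A).Faithful :=
  inferInstanceAs (((bounded (E.Cat A)).lift (E.resFinitelyBounded A) _).Faithful)

instance : (E.resBounded A).EssSurj where
  mem_essImage Y := by
    obtain ⟨X, ⟨e⟩⟩ := E.essImage_resFinitelyBounded_of_bounded Y.property
    exact ⟨X, ⟨(bounded (E.Cat A)).isoMk e⟩⟩

instance : (E.resBounded A).IsEquivalence where

variable (A) in
/-- The equivalence of `*D^fb(A)` and `D^b(*A)`. -/
noncomputable def boundedEquivalence :
    (E.finitelyBounded (A := A)).FullSubcategory ≌ BoundedDerivedCategory (E.Cat A) :=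
  (E.resBounded A).asEquivalence

noncomputable instance : (E.boundedEquivalence A).functor.CommShift ℤ :=
  inferInstanceAs ((E.resBounded A).CommShift ℤ)

instance : (E.boundedEquivalence A).functor.IsTriangulated :=
  inferInstanceAs (E.resBounded A).IsTriangulated

noncomputable instance : (E.boundedEquivalence A).inverse.CommShift ℤ :=
  (E.boundedEquivalence A).commShiftInverse ℤ

instance : (E.boundedEquivalence A).CommShift ℤ :=
  (E.boundedEquivalence A).commShift_of_functor ℤ

instance : (E.boundedEquivalence A).inverse.IsTriangulated :=
  (Equivalence.IsTriangulated.mk' (E := E.boundedEquivalence A)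
    inferInstance).rightAdjoint_isTriangulated

variable (A) in
/-- The functor `Φ : D^b(*A) ⥤ *D(A)`. -/
noncomputable abbrev boundedEmbedding :
    BoundedDerivedCategory (E.Cat A) ⥤ E.Cat (DerivedCategory A) :=
  (E.boundedEquivalence A).inverse ⋙ E.finitelyBounded.ι

/-- Detection of distinguished triangles is automatic for a fully faithful triangulated functor. -/
lemma isTriangulatedFunctor_boundedEmbedding : E.IsTriangulatedFunctor (E.boundedEmbedding A) :=
  ⟨(E.boundedEmbedding A).commShiftIso 1, fun T =>
    ((E.boundedEmbedding A).map_distinguished_iff T).symm⟩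

lemma essImage_boundedEmbedding : (E.boundedEmbedding A).essImage = E.finitelyBounded := by
  ext X
  constructor
  · rintro ⟨Y, ⟨e⟩⟩
    exact E.finitelyBounded.prop_of_iso e ((E.boundedEquivalence A).inverse.obj Y).property
  · intro hX
    exact ⟨_, ⟨E.finitelyBounded.ι.mapIso ((E.boundedEquivalence A).unitIso.symm.app ⟨X, hX⟩)⟩⟩

end Enlargement

end Enlarging

theorem mainTheorem12 {S W : Type u} [Infinite S] (E : Enlargement S W)
    (A : Type v) [Category.{w} A] [Abelian A] [SmallCat S A] :
    E.IsTriangulatedSubcategory (E.finitelyBounded (A := A)) ∧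
    ∃ res : E.Cat (DerivedCategory A) ⥤ DerivedCategory (E.Cat A),
      E.IsInducedByRestriction res ∧
      (∀ res' : E.Cat (DerivedCategory A) ⥤ DerivedCategory (E.Cat A),
        E.IsInducedByRestriction res' → Nonempty (res' ≅ res)) ∧
      ∃ (hres : ∀ X : E.Cat (DerivedCategory A),
          E.finitelyBounded X → bounded (E.Cat A) (res.obj X))
        (Φ : BoundedDerivedCategory (E.Cat A) ⥤ E.Cat (DerivedCategory A))
        (hΦ : ∀ X, E.finitelyBounded (Φ.obj X)),
        Φ.Full ∧ Φ.Faithful ∧ Φ.essImage = E.finitelyBounded ∧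
        E.IsTriangulatedFunctor Φ ∧
        Nonempty (E.finitelyBounded.lift Φ hΦ ⋙
          (bounded (E.Cat A)).lift (E.finitelyBounded.ι ⋙ res)
            (fun X => hres X.obj X.property) ≅ 𝟭 _) ∧
        Nonempty ((bounded (E.Cat A)).lift (E.finitelyBounded.ι ⋙ res)
            (fun X => hres X.obj X.property) ⋙ E.finitelyBounded.lift Φ hΦ ≅ 𝟭 _) :=
  ⟨E.isTriangulatedSubcategory_finitelyBounded, E.res A, E.isInducedByRestriction_res A,
    fun _ h => h.nonempty_iso, fun _ hX => E.bounded_res_obj hX, E.boundedEmbedding A,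
    fun X => ((E.boundedEquivalence A).inverse.obj X).property, inferInstance, inferInstance,
    E.essImage_boundedEmbedding, E.isTriangulatedFunctor_boundedEmbedding,
    ⟨(E.boundedEquivalence A).counitIso⟩, ⟨(E.boundedEquivalence A).unitIso.symm⟩⟩
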